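/- Let $n\ge 2$, $N,r\in\mathbb N$ with $r\ge1$, $p\in(1,\infty)$, $\kappa\ge 0$, $\alpha\in(0,1]$, and for $\xi\in\mathbb R^{N\times n}$ set $V(\xi):=(\kappa+|\xi|)^{\frac{p-2}{2}}\xi$, where $|\cdot|$ is the Frobenius norm. Let $\Omega\subset\mathbb R^n$ be a bounded polyhedral domain, i.e. $\Omega$ is open and connected, $\overline\Omega$ is a finite union of closed $n$-simplices, and $\Omega$ is the interior of $\overline\Omega$. Let $\mathcal T_h$ be a finite partition of $\overline\Omega$ into closed nondegenerate $n$-simplices any two of which intersect in a common face or not at all. For $T\in\mathcal T_h$ let $h_T$ be its diameter and $\rho_T$ the supremum of the diameters of balls contained in $T$, and let $h=\max_{T}h_T$. Assume that $\mathcal T_h$ is shape regular with constant $\gamma$ ($h_T\le\gamma\rho_T$ for all $T\in\mathcal T_h$) and quasi-uniform with constant $\sigma$ ($h\le\sigma h_T$ for all $T\in\mathcal T_h$), and that for every $T\in\mathcal T_h$ the interior of the union of all $T'\in\mathcal T_h$ with $T\cap T'\neq\emptyset$ is connected. Let $$V_h=\{w\in (W^{1,1}_0(\Omega))^N : w|_T\in(\mathscr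 P_r(T))^N\ \text{for all } T\in\mathcal T_h\},$$ where $\mathscr P_r(T)$ denotes the polynomials of degree at most $r$, and let $\Pi_2$ be the $L^2$-projection onto $V_h$: for $v\in (L^1(\Omega))^N$, $\Pi_2v$ is the element of $V_h$ with $\int_\Omega (v-\Pi_2v)\cdot\xi\,dx=0$ for all $\xi\in V_h$ (for $v \in (L^2(\Omega))^N$ this is the orthogonal projection). For a function $u$ on $\Omega$ let $$[u]_{N^{\alpha,2}(\Omega)}=\sup_{z\in\mathbb R^n\setminus\{0\}}|z|^{-\alpha}\Big(\int_{\Omega\cap(\Omega-z)}|u(x+z)-u(x)|^2\,dx\Big)^{1/2}\in[0,\infty].$$ Then for every $v\in (W^{1,p}_0(\Omega))^N$ the projection $\Pi_2 v$ exists and $$\|V(\nabla v)-V(\nabla\Pi_2v)\|_{L^2(\Omega)}\le C\,h^{\alpha}\,[V(\nabla v)]_{N^{\alpha,2}(\Omega)},$$ where the constant $C>0$ depends only on $n,N,r,p,\gamma$ and $\sigma$; in particular it does not depend on $h$, $\mathcal T_h$, $\Omega$, $\kappa$, $\alpha$ or $v$. -/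

import Mathlib

open MeasureTheory Filter Topology
open scoped ENNReal ContDiff

noncomputable section

namespace FEM

/-- `ℝⁿ` with the Euclidean norm. -/
abbrev Pt (n : ℕ) : Type := EuclideanSpace ℝ (Fin n)

/-- `ℝ^{N × n}`; the Euclidean norm of this space is the Frobenius norm. -/
abbrev Mat (N n : ℕ) : Type := EuclideanSpace ℝ (Fin N × Fin n)

/-! ### The nonlinear map `V` -/

/-- `V(ξ) = (κ + |ξ|)^{(p-2)/2} ξ`. -/
def V {N n : ℕ} (κ p : ℝ) (ξ : Mat N n) : Mat N n :=
  ((κ + ‖ξ‖) ^ ((p - 2) / 2)) • ξ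

/-! ### Sobolev and Nikolskii spaces -/

/-- The classical gradient (Jacobian matrix) of a map `ℝⁿ → ℝᴺ`. -/
def grad {N n : ℕ} (φ : Pt n → Pt N) (x : Pt n) : Mat N n :=
  WithLp.toLp 2 fun ij => fderiv ℝ φ x (EuclideanSpace.single ij.2 1) ij.1

/-- `φ ∈ C_0^∞(Ω)`: smooth with compact support contained in `Ω`. -/
def IsTest {n : ℕ} {F : Type*} [NormedAddCommGroup F] [NormedSpace ℝ F]
    (Ω : Set (Pt n)) (φ : Pt n → F) : Prop :=
  ContDiff ℝ ∞ φ ∧ HasCompactSupport φ ∧ tsupport φ ⊆ Ω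

/-- `G` is the weak (distributional) gradient of `v` on the open set `Ω`. -/
def HasWeakGrad {N n : ℕ} (Ω : Set (Pt n)) (v : Pt n → Pt N) (G : Pt n → Mat N n) : Prop :=
  LocallyIntegrableOn v Ω volume ∧ LocallyIntegrableOn G Ω volume ∧
    ∀ φ : Pt n → ℝ, IsTest Ω φ → ∀ (i : Fin N) (j : Fin n),
      ∫ x in Ω, v x i * fderiv ℝ φ x (EuclideanSpace.single j 1) = -∫ x in Ω, G x (i, j) * φ x

open Classical in
/-- The weak gradient `∇v` on `Ω` (unique up to null sets; `0` if there is none). -/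
def weakGrad {N n : ℕ} (Ω : Set (Pt n)) (v : Pt n → Pt N) : Pt n → Mat N n :=
  if h : ∃ G, HasWeakGrad Ω v G then h.choose else 0

/-- `v ∈ W^{1,q}_0(Ω)`: `v` belongs to `W^{1,q}(Ω)` and is a limit in the norm of `W^{1,q}(Ω)`
of functions in `C_0^∞(Ω)`. -/
def MemW0 {N n : ℕ} (Ω : Set (Pt n)) (q : ℝ≥0∞) (v : Pt n → Pt N) : Prop :=
  ∃ G : Pt n → Mat N n, HasWeakGrad Ω v G ∧
    MemLp v q (volume.restrict Ω) ∧ MemLp G q (volume.restrict Ω) ∧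
    ∃ φ : ℕ → Pt n → Pt N, (∀ k, IsTest Ω (φ k)) ∧
      Tendsto (fun k => eLpNorm (fun x => v x - φ k x) q (volume.restrict Ω)) atTop (𝓝 0) ∧
      Tendsto (fun k => eLpNorm (fun x => G x - grad (φ k) x) q (volume.restrict Ω)) atTop (𝓝 0)

/-- The Nikolskii semi-norm
`[u]_{N^{α,q}(Ω)} = sup_{z ≠ 0} |z|^{-α} ‖u(· + z) - u‖_{L^q(Ω ∩ (Ω - z))}`, with values in
`[0, ∞]`. -/
def nikolskii {n : ℕ} {F : Type*} [NormedAddCommGroup F]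
    (α : ℝ) (q : ℝ≥0∞) (Ω : Set (Pt n)) (u : Pt n → F) : ℝ≥0∞ :=
  ⨆ (z : Pt n) (_ : z ≠ 0), ENNReal.ofReal (‖z‖ ^ (-α)) *
    eLpNorm (fun x => u (x + z) - u x) q (volume.restrict (Ω ∩ {x | x + z ∈ Ω}))

/-! ### Polyhedral domains and triangulations

An `n`-simplex is represented by its set of vertices. -/

/-- The closed simplex with vertex set `T`. -/
def elem {n : ℕ} (T : Finset (Pt n)) : Set (Pt n) := convexHull ℝ (T : Set (Pt n))

/-- `T` is the vertex set of a nondegenerate `n`-simplex in `ℝⁿ`. -/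
def IsSimplex {n : ℕ} (T : Finset (Pt n)) : Prop :=
  T.card = n + 1 ∧ AffineIndependent ℝ (fun x : T => (x : Pt n))

/-- A (bounded) polyhedral domain: open, connected, and equal to the interior of its closure,
which is a finite union of closed `n`-simplices. -/
structure IsPolyhedralDomain {n : ℕ} (Ω : Set (Pt n)) : Prop where
  isOpen : IsOpen Ω
  isConnected : IsConnected Ω
  interior_closure : interior (closure Ω) = Ω
  polyhedral : ∃ S : Finset (Finset (Pt n)), (∀ T ∈ S, IsSimplex T) ∧ closure Ω = ⋃ T ∈ S, elem T

/-- A regular partition of `Ω` into closed `n`-simplices: the elements cover the closure of `Ω`,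
and two elements meet in a common face, possibly empty (no hanging nodes). -/
structure IsTriangulation {n : ℕ} (Ω : Set (Pt n)) (𝒯 : Finset (Finset (Pt n))) : Prop where
  simplex : ∀ T ∈ 𝒯, IsSimplex T
  cover : ⋃ T ∈ 𝒯, elem T = closure Ω
  conforming : ∀ T ∈ 𝒯, ∀ T' ∈ 𝒯,
    elem T ∩ elem T' = convexHull ℝ ((T : Set (Pt n)) ∩ (T' : Set (Pt n)))

/-- `h_T`, the diameter of the element. -/
def hT {n : ℕ} (T : Finset (Pt n)) : ℝ := Metric.diam (elem T)

/-- `ρ_T`, the supremum of the diameters `2 s` of the balls contained in the element. -/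
def rhoT {n : ℕ} (T : Finset (Pt n)) : ℝ :=
  sSup {d : ℝ | ∃ (x : Pt n) (s : ℝ), 0 ≤ s ∧ Metric.closedBall x s ⊆ elem T ∧ d = 2 * s}

/-- The mesh size `h = max_T h_T`. -/
def meshSize {n : ℕ} (𝒯 : Finset (Finset (Pt n))) : ℝ := ⨆ T : 𝒯, hT (T : Finset (Pt n))

/-- Shape regularity with constant `γ`. -/
def ShapeRegular {n : ℕ} (γ : ℝ) (𝒯 : Finset (Finset (Pt n))) : Prop :=
  ∀ T ∈ 𝒯, hT T ≤ γ * rhoT T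

/-- Quasi-uniformity with constant `σ` (the inequality `h_T ≤ h` always holds). -/
def QuasiUniform {n : ℕ} (σ : ℝ) (𝒯 : Finset (Finset (Pt n))) : Prop :=
  ∀ T ∈ 𝒯, meshSize 𝒯 ≤ σ * hT T

/-- The interior of the union of all elements that touch `T`. -/
def patch {n : ℕ} (𝒯 : Finset (Finset (Pt n))) (T : Finset (Pt n)) : Set (Pt n) :=
  interior (⋃ T' ∈ {T' ∈ (𝒯 : Set (Finset (Pt n))) | (elem T ∩ elem T').Nonempty}, elem T')

/-- All patches are connected. -/
def PatchesConnected {n : ℕ} (𝒯 : Finset (Finset (Pt n))) : Prop :=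
  ∀ T ∈ 𝒯, IsConnected (patch 𝒯 T)

/-! ### The finite element space and the `L²`-projection -/

/-- The finite element space `V_h`: functions in `W^{1,1}_0(Ω)` whose components agree on every
element (almost everywhere) with a polynomial of total degree at most `r`. -/
def Vh {n : ℕ} (N r : ℕ) (Ω : Set (Pt n)) (𝒯 : Finset (Finset (Pt n))) : Set (Pt n → Pt N) :=
  {w | MemW0 Ω 1 w ∧ ∀ T ∈ 𝒯, ∀ i : Fin N, ∃ P : MvPolynomial (Fin n) ℝ,
    P.totalDegree ≤ r ∧ ∀ᵐ x ∂(volume.restrict (elem T)), w x i = P.eval (fun j => x j)}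

/-- `w` is the `L²`-projection of `v` onto `V_h`: `w ∈ V_h` and `v - w` is `L²`-orthogonal to
`V_h`. As the functions in `V_h` are bounded, this makes sense for every `v ∈ L¹(Ω)`. -/
def IsL2Proj {n N : ℕ} (r : ℕ) (Ω : Set (Pt n)) (𝒯 : Finset (Finset (Pt n)))
    (v w : Pt n → Pt N) : Prop :=
  w ∈ Vh N r Ω 𝒯 ∧ ∀ ξ ∈ Vh N r Ω 𝒯, ∫ x in Ω, inner ℝ (v x - w x) (ξ x) = 0

open Classical in
/-- The `L²`-projection `Π₂ v` of `v` onto `V_h` (unique up to null sets). -/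
def l2Proj {n N : ℕ} (r : ℕ) (Ω : Set (Pt n)) (𝒯 : Finset (Finset (Pt n)))
    (v : Pt n → Pt N) : Pt n → Pt N :=
  if h : ∃ w, IsL2Proj r Ω 𝒯 v w then h.choose else 0

end FEM

end

/-! Write A for the weak gradient of v and B for that of Π₂v. Everything rests on a weighted
pointwise estimate, valid for almost every x in Ω (`exists_gradient_estimate_l2Proj`): h^n |B(x) -
A(x)| ≤ C ∫_Ω (1 + |x - y| / h)^(-m) |A(y) - A(x)| dy. It involves neither V nor p.

From this estimate to the theorem (`exists_eLpNorm_V_sub_le`). The quantity |V(P) - V(Q)|² is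
comparable to ψ(|P - Q|), where ψ(t) = (a + t)^(p-2) t² and a = κ + |Q|, with constants depending on
p only (`exists_V_bounds`). Since ψ(t)/t increases and ψ is doubling, a Jensen inequality up to
constants holds for kernels of bounded mass (`shiftFun_le_lintegral`). With the shift a = κ + |A(x)|
frozen at x, this bounds |V(A(x)) - V(B(x))|² by a multiple of the average of |V(A(y)) - V(A(x))|²
with weight k(y - x), where k is the decay kernel scaled to length h. Integration in x and the
substitution z = y - x leave the squared Nikolskii seminorm times the moment ∫ k(z) |z|^(2α) dz,
which is at most C h^(2α) when m = n + 3.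

The pointwise estimate (`exists_gradient_estimate`) is proved with an arbitrary constant Q in place
of A(x). An affine function with gradient Q cannot simply be subtracted, because V_h has zero
boundary values. Instead a quasi-interpolant u in V_h is used, for which v - u and ∇u - Q are
controlled by the integral of |∇v - Q| over the star of each element, also at the boundary
(`exists_interp_estimate`). There the reason is that v vanishes on a whole facet through every
boundary vertex, which controls the affine part as well. Connectedness of the patches lets L¹ bounds
pass from element to element through facets.

Since u belongs to V_h, Π₂v - u is the projection of v - u, hence the sum over the elements T' of
the projections of v - u restricted to T'. Each of these decays exponentially away from T'
(`exists_fe_decay`): the energies E_k outside the ball of radius k h satisfy E_(k+1) ≤ C (E_k -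
E_(k+1)), as one sees by testing with a truncation that stays in the finite element space and equals
the function far away. Summation over T' with bounded overlap of the stars gives the estimate.

The space V_h is defined through W^{1,1}_0. It is identified almost everywhere with the continuous
piecewise polynomials vanishing outside Ω (`mem_Vh_of_isFE`, `exists_isFE_of_mem_Vh`), and the
argument is carried out for the latter, component by component. -/

open scoped NNReal

noncomputable section

namespace FEM

/-! ### Polynomial functions on `ℝⁿ` -/

/-- `p` is a polynomial function of total degree at most `r`. -/
def IsPoly {n : ℕ} (r : ℕ) (p : Pt n → ℝ) : Prop :=
  ∃ P : MvPolynomial (Fin n) ℝ, P.totalDegree ≤ r ∧ ∀ x, p x = P.eval (fun j => x j)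

namespace IsPoly

variable {n r s : ℕ} {p q : Pt n → ℝ}

lemma mono (hp : IsPoly r p) (h : r ≤ s) : IsPoly s p := by
  obtain ⟨P, hP, h'⟩ := hp
  exact ⟨P, hP.trans h, h'⟩

lemma const (c : ℝ) : IsPoly r (fun _ : Pt n => c) :=
  ⟨MvPolynomial.C c, by simp, by simp⟩

lemma add (hp : IsPoly r p) (hq : IsPoly r q) : IsPoly r (fun x => p x + q x) := by
  obtain ⟨P, hP, h⟩ := hp
  obtain ⟨Q, hQ, h'⟩ := hq
  exact ⟨P + Q, (MvPolynomial.totalDegree_add _ _).trans (max_le hP hQ), by simp [h, h']⟩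

lemma mul (hp : IsPoly r p) (hq : IsPoly s q) : IsPoly (r + s) (fun x => p x * q x) := by
  obtain ⟨P, hP, h⟩ := hp
  obtain ⟨Q, hQ, h'⟩ := hq
  exact ⟨P * Q, (MvPolynomial.totalDegree_mul _ _).trans (add_le_add hP hQ), by simp [h, h']⟩

lemma const_mul (c : ℝ) (hp : IsPoly r p) : IsPoly r (fun x => c * p x) := by
  simpa using (const (r := 0) c).mul hp

lemma neg (hp : IsPoly r p) : IsPoly r (fun x => -p x) := by
  simpa using hp.const_mul (-1)

lemma sub (hp : IsPoly r p) (hq : IsPoly r q) : IsPoly r (fun x => p x - q x) := by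
  simpa [sub_eq_add_neg] using hp.add hq.neg

lemma sum {ι : Type*} (S : Finset ι) (f : ι → Pt n → ℝ) (hf : ∀ i ∈ S, IsPoly r (f i)) :
    IsPoly r (fun x => ∑ i ∈ S, f i x) := by
  classical
  induction S using Finset.induction_on with
  | empty => simpa using const (r := r) (n := n) 0
  | insert a S ha ih =>
    simp only [Finset.sum_insert ha]
    exact (hf a (by simp)).add (ih fun i hi => hf i (by simp [hi]))

lemma pow (hp : IsPoly r p) (k : ℕ) : IsPoly (k * r) (fun x => p x ^ k) := by
  obtain ⟨P, hP, h⟩ := hp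
  exact ⟨P ^ k, (MvPolynomial.totalDegree_pow _ _).trans (Nat.mul_le_mul_left _ hP), by simp [h]⟩

lemma prod {ι : Type*} (S : Finset ι) (f : ι → Pt n → ℝ) (d : ι → ℕ)
    (hf : ∀ i ∈ S, IsPoly (d i) (f i)) : IsPoly (∑ i ∈ S, d i) (fun x => ∏ i ∈ S, f i x) := by
  classical
  induction S using Finset.induction_on with
  | empty => simpa using const (r := 0) (n := n) 1
  | insert a S ha ih =>
    simp only [Finset.prod_insert ha, Finset.sum_insert ha]
    exact (hf a (by simp)).mul (ih fun i hi => hf i (by simp [hi]))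

lemma coord (j : Fin n) : IsPoly 1 (fun x : Pt n => x j) :=
  ⟨MvPolynomial.X j, by simp, by simp⟩

lemma linear (f : Pt n →ₗ[ℝ] ℝ) : IsPoly 1 f := by
  have h : ∀ x, f x = ∑ j, f (EuclideanSpace.single j 1) * x j := by
    intro x
    conv_lhs => rw [← (EuclideanSpace.basisFun (Fin n) ℝ).sum_repr x]
    simp [map_sum, mul_comm]
  have h2 : (f : Pt n → ℝ) = fun x => ∑ j, f (EuclideanSpace.single j 1) * x j := funext h
  rw [h2]
  exact sum _ _ fun j _ => (coord j).const_mul _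

lemma affine (f : Pt n →ᵃ[ℝ] ℝ) : IsPoly 1 f := by
  rw [f.decomp]
  exact (linear f.linear).add (const (f 0))

lemma contDiff (hp : IsPoly r p) {k : WithTop ℕ∞} : ContDiff ℝ k p := by
  obtain ⟨P, -, h⟩ := hp
  have : p = fun x => ∑ d ∈ P.support, P.coeff d * ∏ i, x i ^ d i := by
    ext x; rw [h, MvPolynomial.eval_eq']
  rw [this]
  fun_prop

lemma continuous (hp : IsPoly r p) : Continuous p := (hp.contDiff (k := 0)).continuous

lemma differentiable (hp : IsPoly r p) : Differentiable ℝ p :=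
  (hp.contDiff (k := 1)).differentiable (by simp)

/-- Homogenization: `σ ^ r * p (y / σ)` is a polynomial of degree at most `r` if `σ` and the
components of `y` are affine. -/
lemma exists_homogenize (hp : IsPoly r p) (hr : 1 ≤ r) {σ : Pt n → ℝ} {y : Pt n → Pt n}
    (hσ : IsPoly 1 σ) (hy : ∀ j, IsPoly 1 (fun x => y x j)) :
    ∃ R : Pt n → ℝ, IsPoly r R ∧ (∀ x, σ x ≠ 0 → R x = σ x ^ r * p ((σ x)⁻¹ • y x)) ∧
      ∀ x, σ x = 0 → y x = 0 → R x = 0 := by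
  obtain ⟨P, hP, h⟩ := hp
  have hdeg : ∀ d ∈ P.support, ∑ j, d j ≤ r := fun d hd => by
    have := MvPolynomial.le_totalDegree hd
    rw [Finsupp.sum_fintype _ _ (by simp)] at this
    exact this.trans hP
  -- Each monomial is multiplied by the power of `σ` missing from its degree, so that no inverse of
  -- `σ` survives and the degree stays at most `r`.
  refine ⟨fun x => ∑ d ∈ P.support, P.coeff d * (σ x ^ (r - ∑ j, d j) * ∏ j, y x j ^ d j),
    sum _ _ fun d hd => ?_, ?_, ?_⟩
  · have h1 := (hσ.pow (r - ∑ j, d j)).mul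
      (prod Finset.univ (fun j x => y x j ^ d j) (fun j => d j * 1) fun j _ => (hy j).pow (d j))
    refine (h1.const_mul _).mono ?_
    have := hdeg d hd
    simp only [mul_one]
    omega
  · intro x hx
    rw [h, MvPolynomial.eval_eq', Finset.mul_sum]
    refine Finset.sum_congr rfl fun d hd => ?_
    have h1 : ∏ j, (((σ x)⁻¹ • y x) j) ^ d j = ((σ x)⁻¹) ^ (∑ j, d j) * ∏ j, y x j ^ d j := by
      simp only [PiLp.smul_apply, smul_eq_mul, mul_pow, Finset.prod_mul_distrib,
        Finset.prod_pow_eq_pow_sum]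
    rw [h1, inv_pow, ← Nat.sub_add_cancel (hdeg d hd), pow_add]
    simp only [Nat.add_sub_cancel]
    field_simp
  · intro x hx hy0
    refine Finset.sum_eq_zero fun d hd => ?_
    -- A constant monomial carries the factor `σ ^ r` with `r ≥ 1`; every other monomial contains a
    -- component of `y`.
    by_cases h0 : ∑ j, d j = 0
    · rw [h0, hx, Nat.sub_zero, zero_pow (by omega)]; simp
    · obtain ⟨j, -, hj⟩ := Finset.exists_ne_zero_of_sum_ne_zero h0
      rw [Finset.prod_eq_zero (Finset.mem_univ j) (by simp [hy0, hj])]; simp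

/-- The homogenization for `σ = 1` is substitution of an affine map. -/
lemma comp_homothety (hp : IsPoly r p) (hr : 1 ≤ r) (x₀ : Pt n) (h : ℝ) :
    IsPoly r (fun y => p (x₀ + h • y)) := by
  obtain ⟨R, hR, h1, -⟩ := hp.exists_homogenize hr (σ := fun _ => 1) (y := fun y => x₀ + h • y)
    (const 1) (fun j => by
      simpa using (const (r := 1) (x₀ j)).add ((coord j).const_mul h))
  have : (fun y => p (x₀ + h • y)) = R := by
    ext y; rw [h1 y one_ne_zero]; simp
  rwa [this]

end IsPoly

/-- A polynomial vanishing on a neighbourhood of a point is zero. -/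
lemma mvPolynomial_eq_zero_of_eventually {n : ℕ} (P : MvPolynomial (Fin n) ℝ) (x₀ : Pt n)
    (h : ∀ᶠ x in 𝓝 x₀, P.eval (fun j => x j) = 0) : P = 0 := by
  have hc : Continuous fun y : Fin n → ℝ => (WithLp.toLp 2 y : Pt n) := PiLp.continuous_toLp 2 _
  have h2 : ∀ᶠ y in 𝓝 (fun j => x₀ j), P.eval y = 0 :=
    (hc.tendsto (fun j => x₀ j)).eventually (p := fun x : Pt n => P.eval (fun j => x j) = 0) h
  obtain ⟨ε, hε, hball⟩ := Metric.eventually_nhds_iff_ball.1 h2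
  refine MvPolynomial.funext_set (fun i => Metric.ball (x₀ i) ε) (fun i => ?_) fun y hy => ?_
  · rw [Real.ball_eq_Ioo]
    exact Set.Ioo_infinite (by linarith)
  · rw [map_zero]
    exact hball y (by rwa [ball_pi _ hε])

/-- Equivalence of norms on polynomials, on concentric balls. -/
lemma exists_poly_bound (n r : ℕ) (c : ℝ) (hc : 0 < c) :
    ∃ C : ℝ, 0 < C ∧ ∀ p : Pt n → ℝ, IsPoly r p → ∀ x ∈ Metric.closedBall (0 : Pt n) 2,
      |p x| ≤ C * ∫ y in Metric.closedBall (0 : Pt n) c, |p y| ∧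
      ‖fderiv ℝ p x‖ ≤ C * ∫ y in Metric.closedBall (0 : Pt n) c, |p y| := by
  classical
  let W := MvPolynomial.restrictTotalDegree (Fin n) ℝ r
  let b := Module.finBasis ℝ W
  let e : Fin (Module.finrank ℝ W) → Pt n → ℝ := fun i x => (b i : MvPolynomial (Fin n) ℝ).eval (fun j => x j)
  have he : ∀ i, IsPoly r (e i) := fun i =>
    ⟨b i, (MvPolynomial.mem_restrictTotalDegree _ _ _).1 (b i).2, fun x => rfl⟩
  let B := Metric.closedBall (0 : Pt n) c
  have hB : IsCompact B := isCompact_closedBall _ _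
  have hcont : ∀ a : Fin (Module.finrank ℝ W) → ℝ, Continuous fun x => ∑ i, a i * e i x := fun a =>
    continuous_finsetSum _ fun i _ => (he i).continuous.const_mul _
  have hInt : ∀ a : Fin (Module.finrank ℝ W) → ℝ,
      Integrable (fun x => ∑ i, a i * e i x) (volume.restrict B) := fun a =>
    (hcont a).continuousOn.integrableOn_compact hB
  -- `Φ` sends coefficients to the class of the polynomial in L¹ of the ball. Being linear and
  -- injective on a finite-dimensional space it is antilipschitz, so the L¹ norm bounds the
  -- coefficients.
  let Φ : (Fin (Module.finrank ℝ W) → ℝ) →ₗ[ℝ] (Pt n →₁[volume.restrict B] ℝ) :=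
    { toFun := fun a => (hInt a).toL1 _
      map_add' := fun a a' => by
        rw [← Integrable.toL1_add]
        congr 1
        ext x
        simp [add_mul, Finset.sum_add_distrib]
      map_smul' := fun t a => by
        simp only [RingHom.id_apply]
        rw [← Integrable.toL1_smul]
        congr 1
        ext x
        simp [Finset.mul_sum, mul_assoc] }
  have hker : LinearMap.ker Φ = ⊥ := by
    rw [LinearMap.ker_eq_bot']
    intro a ha
    have h1 : (fun x => ∑ i, a i * e i x) =ᵐ[volume.restrict B] (fun _ => 0) :=
      (Integrable.toL1_eq_toL1_iff _ _ (hInt a) (integrable_zero _ _ _)).1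
        (ha.trans (Integrable.toL1_zero _).symm)
    have h2 := Measure.eqOn_of_ae_eq h1 (hcont a).continuousOn continuousOn_const
      (by rw [interior_closedBall _ hc.ne', closure_ball _ hc.ne'])
    have h3 : ((∑ i, a i • b i : W) : MvPolynomial (Fin n) ℝ) = 0 := by
      refine mvPolynomial_eq_zero_of_eventually _ 0 ?_
      filter_upwards [Metric.closedBall_mem_nhds (0 : Pt n) hc] with x hx
      have := h2 hx
      simp only [e] at this
      simpa [map_sum, MvPolynomial.smul_eval] using this
    have h4 : ∑ i, a i • b i = 0 := Subtype.ext h3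
    ext i
    exact Fintype.linearIndependent_iff.1 b.linearIndependent a h4 i
  obtain ⟨K, hK, hanti⟩ := Φ.exists_antilipschitzWith hker
  have hA : IsCompact (Metric.closedBall (0 : Pt n) 2) := isCompact_closedBall _ _
  have h1 : ∀ i, ∃ M, ∀ x ∈ Metric.closedBall (0 : Pt n) 2, ‖e i x‖ ≤ M := fun i =>
    hA.exists_bound_of_continuousOn (he i).continuous.continuousOn
  have h2 : ∀ i, ∃ M, ∀ x ∈ Metric.closedBall (0 : Pt n) 2, ‖fderiv ℝ (e i) x‖ ≤ M := fun i =>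
    hA.exists_bound_of_continuousOn
      (((he i).contDiff (k := 1)).continuous_fderiv (by simp)).continuousOn
  choose M1 hM1 using h1
  choose M2 hM2 using h2
  -- `K` bounds the coefficients, `M1` and `M2` the basis polynomials and their gradients on the
  -- ball of radius 2; the `+ 1` makes the constant positive.
  refine ⟨K * (∑ i, (|M1 i| + |M2 i|)) + 1, by positivity, ?_⟩
  rintro p ⟨P, hP, hp⟩ x hx
  let a : Fin (Module.finrank ℝ W) → ℝ := b.repr ⟨P, (MvPolynomial.mem_restrictTotalDegree _ _ _).2 hP⟩
  have hpa : p = fun x => ∑ i, a i * e i x := by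
    ext x
    have h3 := b.sum_repr ⟨P, (MvPolynomial.mem_restrictTotalDegree _ _ _).2 hP⟩
    have h4 : ((∑ i, a i • b i : W) : MvPolynomial (Fin n) ℝ) = P := congrArg Subtype.val h3
    rw [hp, ← h4]
    simp [map_sum, MvPolynomial.smul_eval, e]
  have hna : ‖a‖ ≤ K * ∫ y in B, |p y| := by
    have h3 := hanti.le_mul_dist a 0
    rw [dist_zero_right, map_zero, dist_zero_right] at h3
    refine h3.trans (le_of_eq ?_)
    congr 1
    change ‖(hInt a).toL1 _‖ = _
    rw [L1.norm_of_fun_eq_integral_norm, hpa]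
    rfl
  have hI : 0 ≤ ∫ y in B, |p y| := integral_nonneg fun _ => abs_nonneg _
  have hfin : ∀ v : Fin (Module.finrank ℝ W) → ℝ, (∀ i, v i ≤ |M1 i| + |M2 i|) →
      ∑ i, |a i| * v i ≤ (K * (∑ i, (|M1 i| + |M2 i|)) + 1) * ∫ y in B, |p y| := by
    intro v hv
    calc ∑ i, |a i| * v i ≤ ∑ i, ‖a‖ * (|M1 i| + |M2 i|) := by
          refine Finset.sum_le_sum fun i _ => ?_
          refine (mul_le_mul_of_nonneg_left (hv i) (abs_nonneg _)).trans ?_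
          exact mul_le_mul_of_nonneg_right (norm_le_pi_norm a i) (by positivity)
      _ = ‖a‖ * ∑ i, (|M1 i| + |M2 i|) := by rw [Finset.mul_sum]
      _ ≤ (K * ∫ y in B, |p y|) * ∑ i, (|M1 i| + |M2 i|) :=
          mul_le_mul_of_nonneg_right hna (by positivity)
      _ ≤ _ := by nlinarith
  constructor
  · refine le_trans ?_ (hfin (fun i => |e i x|) fun i => ?_)
    · rw [hpa]
      refine (Finset.abs_sum_le_sum_abs _ _).trans (le_of_eq ?_)
      simp [abs_mul]
    · have := hM1 i x hx
      rw [Real.norm_eq_abs] at this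
      linarith [le_abs_self (M1 i), abs_nonneg (M2 i)]
  · refine le_trans ?_ (hfin (fun i => ‖fderiv ℝ (e i) x‖) fun i => ?_)
    · have h3 : HasFDerivAt p (∑ i, a i • fderiv ℝ (e i) x) x := by
        rw [hpa]
        exact HasFDerivAt.fun_sum fun i _ =>
          ((he i).differentiable x).hasFDerivAt.const_mul (a i)
      rw [h3.fderiv]
      refine (norm_sum_le _ _).trans (le_of_eq ?_)
      simp [norm_smul]
    · have := hM2 i x hx
      linarith [le_abs_self (M2 i), abs_nonneg (M1 i)]

open scoped Pointwise in
/-- Change of variables under a homothety. -/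
lemma setIntegral_closedBall_homothety {n : ℕ} (f : Pt n → ℝ) (x₀ : Pt n) {h : ℝ} (hh : 0 < h)
    (c : ℝ) : ∫ y in Metric.closedBall (0 : Pt n) c, f (x₀ + h • y) =
      (h ^ n)⁻¹ * ∫ y in Metric.closedBall x₀ (c * h), f y := by
  have h1 := Measure.setIntegral_comp_smul_of_pos (volume : Measure (Pt n)) (fun y => f (x₀ + y))
    (Metric.closedBall (0 : Pt n) c) hh
  rw [h1, finrank_euclideanSpace_fin, smul_eq_mul]
  congr 1
  have h2 : h • Metric.closedBall (0 : Pt n) c = (fun y => x₀ + y) ⁻¹' Metric.closedBall x₀ (c * h) := by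
    rw [smul_closedBall' hh.ne']
    ext y
    simp [dist_eq_norm, abs_of_pos hh, mul_comm]
  rw [h2]
  exact (measurePreserving_add_left volume x₀).setIntegral_preimage_emb
    (MeasurableEquiv.addLeft x₀).measurableEmbedding f _

/-- Inverse estimate for polynomials: the values and the gradient of a polynomial of degree at
most `r` on a ball of radius `2 * h` are controlled by its mean on a ball of radius `ch`. -/
lemma exists_inverse_estimate (n r : ℕ) (hr : 1 ≤ r) (c : ℝ) (hc : 0 < c) :
    ∃ C : ℝ, 0 < C ∧ ∀ p : Pt n → ℝ, IsPoly r p → ∀ (x₀ : Pt n) (h : ℝ), 0 < h →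
      ∀ x ∈ Metric.closedBall x₀ (2 * h),
      |p x| ≤ C * (h ^ n)⁻¹ * ∫ y in Metric.closedBall x₀ (c * h), |p y| ∧
      ‖fderiv ℝ p x‖ ≤ C * (h ^ (n + 1))⁻¹ * ∫ y in Metric.closedBall x₀ (c * h), |p y| := by
  obtain ⟨C, hC, hb⟩ := exists_poly_bound n r c hc
  refine ⟨C, hC, fun p hp x₀ h hh x hx => ?_⟩
  have hx' : h⁻¹ • (x - x₀) ∈ Metric.closedBall (0 : Pt n) 2 := by
    rw [mem_closedBall_zero_iff, norm_smul, norm_inv, Real.norm_of_nonneg hh.le,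
      inv_mul_le_iff₀ hh, ← dist_eq_norm, mul_comm]
    exact hx
  obtain ⟨h1, h2⟩ := hb _ (hp.comp_homothety hr x₀ h) _ hx'
  have hxe : x₀ + h • h⁻¹ • (x - x₀) = x := by
    rw [smul_inv_smul₀ hh.ne']; abel
  rw [setIntegral_closedBall_homothety (fun y => |p y|) x₀ hh c] at h1 h2
  rw [hxe] at h1
  refine ⟨by rwa [mul_assoc], ?_⟩
  have hd : HasFDerivAt (fun y => p (x₀ + h • y)) (h • fderiv ℝ p x) (h⁻¹ • (x - x₀)) := by
    have h3 : HasFDerivAt (fun y : Pt n => x₀ + h • y) (h • ContinuousLinearMap.id ℝ (Pt n))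
        (h⁻¹ • (x - x₀)) := ((hasFDerivAt_id _).const_smul h).const_add x₀
    have h4 : HasFDerivAt p (fderiv ℝ p x) (x₀ + h • h⁻¹ • (x - x₀)) := by
      rw [hxe]; exact (hp.differentiable x).hasFDerivAt
    have h5 := HasFDerivAt.comp (f := fun y : Pt n => x₀ + h • y) (h⁻¹ • (x - x₀)) h4 h3
    rwa [ContinuousLinearMap.comp_smul, ContinuousLinearMap.comp_id] at h5
  rw [hd.fderiv, norm_smul, Real.norm_of_nonneg hh.le] at h2
  calc ‖fderiv ℝ p x‖ = h⁻¹ * (h * ‖fderiv ℝ p x‖) := by field_simp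
    _ ≤ h⁻¹ * (C * ((h ^ n)⁻¹ * ∫ y in Metric.closedBall x₀ (c * h), |p y|)) :=
        mul_le_mul_of_nonneg_left h2 (by positivity)
    _ = _ := by rw [pow_succ, mul_inv]; ring

/-! ### Barycentric coordinates -/

section Barycentric

variable {n : ℕ} {T T' : Finset (Pt n)}

/-- The vertices of a nondegenerate `n`-simplex form an affine basis of `ℝⁿ`. -/
def IsSimplex.basis (hT : IsSimplex T) : AffineBasis T ℝ (Pt n) where
  toFun := fun x => x
  ind' := hT.2
  tot' := by
    rw [hT.2.affineSpan_eq_top_iff_card_eq_finrank_add_one]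
    simp [hT.1]

open Classical in
/-- The barycentric coordinate of the simplex `T` belonging to the vertex `v`, extended by affinity
to the whole space; it is `0` if `v` is not a vertex. -/
def bary (T : Finset (Pt n)) (v : Pt n) : Pt n →ᵃ[ℝ] ℝ :=
  if h : IsSimplex T ∧ v ∈ T then h.1.basis.coord ⟨v, h.2⟩ else AffineMap.const ℝ _ 0

lemma bary_eq_coord (hT : IsSimplex T) (v : T) : bary T v = hT.basis.coord v := by
  simp [bary, hT]

lemma bary_of_notMem {v : Pt n} (hv : v ∉ T) (x : Pt n) : bary T v x = 0 := by
  simp [bary, hv]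

lemma continuous_bary (T : Finset (Pt n)) (v : Pt n) : Continuous (bary T v) :=
  (bary T v).continuous_of_finiteDimensional

lemma sum_bary (hT : IsSimplex T) (x : Pt n) : ∑ v ∈ T, bary T v x = 1 := by
  rw [← Finset.sum_coe_sort T (fun v => bary T v x)]
  simp only [bary_eq_coord hT]
  exact hT.basis.sum_coord_apply_eq_one x

lemma sum_bary_smul (hT : IsSimplex T) (x : Pt n) : ∑ v ∈ T, bary T v x • v = x := by
  rw [← Finset.sum_coe_sort T (fun v => bary T v x • v)]
  simp only [bary_eq_coord hT]
  exact hT.basis.linear_combination_coord_eq_self x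

lemma bary_unique (hT : IsSimplex T) {c : Pt n → ℝ} {x : Pt n} (h1 : ∑ v ∈ T, c v = 1)
    (hx : ∑ v ∈ T, c v • v = x) {v : Pt n} (hv : v ∈ T) : bary T v x = c v := by
  have h2 : Finset.univ.affineCombination ℝ (fun w : T => (w : Pt n)) (fun w : T => c w) = x := by
    rw [Finset.affineCombination_eq_linear_combination _ _ _
      (by rw [Finset.sum_coe_sort T c]; exact h1), Finset.sum_coe_sort T (fun w => c w • w), hx]
  rw [bary_eq_coord hT ⟨v, hv⟩, ← h2]
  exact hT.basis.coord_apply_combination_of_mem (Finset.mem_univ _)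
    (by rw [Finset.sum_coe_sort T c]; exact h1)

open Classical in
lemma bary_vertex (hT : IsSimplex T) {v w : Pt n} (hv : v ∈ T) (hw : w ∈ T) :
    bary T v w = if v = w then 1 else 0 := by
  refine bary_unique hT (c := fun v => if v = w then 1 else 0) ?_ ?_ hv
  · simp [hw]
  · simp [hw]

lemma mem_elem_iff (hT : IsSimplex T) {x : Pt n} : x ∈ elem T ↔ ∀ v, 0 ≤ bary T v x := by
  have h1 : elem T = convexHull ℝ (Set.range hT.basis) := by
    have : Set.range hT.basis = (T : Set (Pt n)) := Subtype.range_coe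
    rw [this]; rfl
  rw [h1, hT.basis.convexHull_eq_nonneg_coord]
  constructor
  · intro h v
    by_cases hv : v ∈ T
    · rw [bary_eq_coord hT ⟨v, hv⟩]; exact h ⟨v, hv⟩
    · rw [bary_of_notMem hv]
  · intro h v
    have := h v
    rwa [bary_eq_coord hT v] at this

lemma mem_interior_elem_iff (hT : IsSimplex T) {x : Pt n} :
    x ∈ interior (elem T) ↔ ∀ v ∈ T, 0 < bary T v x := by
  have h1 : elem T = convexHull ℝ (Set.range hT.basis) := by
    have : Set.range hT.basis = (T : Set (Pt n)) := Subtype.range_coe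
    rw [this]; rfl
  rw [h1, hT.basis.interior_convexHull]
  constructor
  · intro h v hv
    rw [bary_eq_coord hT ⟨v, hv⟩]; exact h ⟨v, hv⟩
  · intro h v
    have := h v v.2
    rwa [bary_eq_coord hT v] at this

lemma bary_le_one (hT : IsSimplex T) {x : Pt n} (hx : x ∈ elem T) (v : Pt n) :
    bary T v x ≤ 1 := by
  by_cases hv : v ∈ T
  · rw [← sum_bary hT x]
    exact Finset.single_le_sum (fun w _ => (mem_elem_iff hT).1 hx w) hv
  · rw [bary_of_notMem hv]; exact zero_le_one

lemma bary_eq_zero_of_mem_face (hT : IsSimplex T) {F : Finset (Pt n)} (hF : F ⊆ T) {x : Pt n}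
    (hx : x ∈ convexHull ℝ (F : Set (Pt n))) {v : Pt n} (hv : v ∉ F) : bary T v x = 0 := by
  classical
  by_cases hvT : v ∈ T
  · obtain ⟨w, -, h1, h2⟩ := Finset.mem_convexHull'.1 hx
    have := bary_unique hT (c := fun v => if v ∈ F then w v else 0) (x := x) ?_ ?_ hvT
    · rw [this, if_neg hv]
    · rw [← h1, ← Finset.sum_filter, Finset.filter_mem_eq_inter, Finset.inter_eq_right.2 hF]
    · rw [← h2]
      simp only [ite_smul, zero_smul]
      rw [← Finset.sum_filter, Finset.filter_mem_eq_inter, Finset.inter_eq_right.2 hF]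
  · exact bary_of_notMem hvT x

lemma mem_face_of_bary_eq_zero (hT : IsSimplex T) {F : Finset (Pt n)} (hF : F ⊆ T) {x : Pt n}
    (hx : x ∈ elem T) (h0 : ∀ v ∈ T, v ∉ F → bary T v x = 0) :
    x ∈ convexHull ℝ (F : Set (Pt n)) := by
  refine Finset.mem_convexHull'.2 ⟨fun v => bary T v x, fun v _ => (mem_elem_iff hT).1 hx v, ?_, ?_⟩
  · rw [← sum_bary hT x]
    exact Finset.sum_subset hF h0
  · conv_rhs => rw [← sum_bary_smul hT x]
    exact Finset.sum_subset hF fun v hv hvF => by simp [h0 v hv hvF]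

lemma isCompact_elem (T : Finset (Pt n)) : IsCompact (elem T) :=
  T.finite_toSet.isCompact_convexHull (𝕜 := ℝ)

lemma isClosed_elem (T : Finset (Pt n)) : IsClosed (elem T) := (isCompact_elem T).isClosed

lemma convex_elem (T : Finset (Pt n)) : Convex ℝ (elem T) := convex_convexHull ℝ _

lemma measurableSet_elem (T : Finset (Pt n)) : MeasurableSet (elem T) :=
  (isClosed_elem T).measurableSet

lemma subset_elem (T : Finset (Pt n)) : (T : Set (Pt n)) ⊆ elem T := subset_convexHull ℝ _

lemma IsSimplex.interior_nonempty (hT : IsSimplex T) : (interior (elem T)).Nonempty := by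
  refine ⟨∑ v ∈ T, ((n : ℝ) + 1)⁻¹ • v, (mem_interior_elem_iff hT).2 fun v hv => ?_⟩
  rw [bary_unique hT (c := fun _ => ((n : ℝ) + 1)⁻¹) _ rfl hv]
  · positivity
  · have : ((n : ℝ) + 1) ≠ 0 := by positivity
    simp [hT.1, this]

lemma IsSimplex.closure_interior (hT : IsSimplex T) : closure (interior (elem T)) = elem T := by
  rw [(convex_elem T).closure_interior_eq_closure_of_nonempty_interior hT.interior_nonempty,
    (isClosed_elem T).closure_eq]

lemma volume_frontier_elem (T : Finset (Pt n)) : volume (frontier (elem T)) = 0 :=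
  (convex_elem T).addHaar_frontier volume

lemma bary_add (T : Finset (Pt n)) (v x d : Pt n) :
    bary T v (x + d) = bary T v x + (bary T v).linear d := by
  rw [add_comm x d, ← vadd_eq_add, AffineMap.map_vadd, vadd_eq_add, add_comm]

lemma bary_sub (T : Finset (Pt n)) (v x y : Pt n) :
    bary T v x - bary T v y = (bary T v).linear (x - y) := by
  have := bary_add T v y (x - y)
  rw [add_sub_cancel] at this
  rw [this, add_sub_cancel_left]

/-- A barycentric coordinate takes values in [0, 1] on the simplex, so it changes by at most 1 along
a radius of an inscribed ball. -/
lemma abs_bary_linear_le (hT : IsSimplex T) {x₀ : Pt n} {s : ℝ} (hs : 0 < s)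
    (hball : Metric.closedBall x₀ s ⊆ elem T) (v d : Pt n) :
    |(bary T v).linear d| ≤ ‖d‖ / s := by
  rcases eq_or_ne d 0 with rfl | hd
  · simp
  have hd' : 0 < ‖d‖ := norm_pos_iff.2 hd
  have hmem : x₀ + (s / ‖d‖) • d ∈ elem T := hball (by
    rw [mem_closedBall_iff_norm, add_sub_cancel_left, norm_smul, Real.norm_of_nonneg (by positivity),
      div_mul_cancel₀ _ hd'.ne'])
  have hmem0 : x₀ ∈ elem T := hball (Metric.mem_closedBall_self hs.le)
  have h1 := bary_add T v x₀ ((s / ‖d‖) • d)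
  rw [map_smul, smul_eq_mul] at h1
  have h2 := (mem_elem_iff hT).1 hmem v
  have h3 := bary_le_one hT hmem v
  have h4 := (mem_elem_iff hT).1 hmem0 v
  have h5 := bary_le_one hT hmem0 v
  have h6 : |s / ‖d‖ * (bary T v).linear d| ≤ 1 := by
    rw [abs_le]; constructor <;> linarith
  rw [abs_mul, abs_of_pos (by positivity : 0 < s / ‖d‖)] at h6
  rw [le_div_iff₀ hs]
  calc |(bary T v).linear d| * s = ‖d‖ * (s / ‖d‖ * |(bary T v).linear d|) := by field_simp
    _ ≤ ‖d‖ * 1 := mul_le_mul_of_nonneg_left h6 hd'.le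
    _ = ‖d‖ := mul_one _

lemma isPoly_bary (T : Finset (Pt n)) (v : Pt n) : IsPoly 1 (bary T v) := IsPoly.affine _

end Barycentric

/-! ### Meshes -/

/-- A triangulation with connected patches whose elements have diameter at most `h` and contain a
ball of radius `c * h`. -/
structure IsMesh {n : ℕ} (c h : ℝ) (Ω : Set (Pt n)) (𝒯 : Finset (Finset (Pt n))) : Prop where
  tri : IsTriangulation Ω 𝒯
  isOpen : IsOpen Ω
  interior_closure : interior (closure Ω) = Ω
  h_pos : 0 < h
  c_pos : 0 < c
  c_le : c ≤ 1
  dist_le : ∀ T ∈ 𝒯, ∀ x ∈ elem T, ∀ y ∈ elem T, dist x y ≤ h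
  ball : ∀ T ∈ 𝒯, ∃ x, Metric.closedBall x (c * h) ⊆ elem T
  connected : PatchesConnected 𝒯

/-- The elements touching `T`. -/
def nbrs {n : ℕ} (𝒯 : Finset (Finset (Pt n))) (T : Finset (Pt n)) : Finset (Finset (Pt n)) :=
  open Classical in 𝒯.filter fun T' => (elem T ∩ elem T').Nonempty

open Classical in
/-- The barycentric coordinates of `x` with respect to any element containing `x`; as functions of
`x` these are the hat functions of the mesh. -/
def weight {n : ℕ} (𝒯 : Finset (Finset (Pt n))) (x v : Pt n) : ℝ :=
  if h : ∃ T ∈ 𝒯, x ∈ elem T then bary h.choose v x else 0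

namespace IsTriangulation

variable {n : ℕ} {Ω : Set (Pt n)} {𝒯 : Finset (Finset (Pt n))} {T T' : Finset (Pt n)}

lemma elem_subset_closure (h : IsTriangulation Ω 𝒯) (hT : T ∈ 𝒯) : elem T ⊆ closure Ω := by
  rw [← h.cover]; exact Set.subset_biUnion_of_mem (u := elem) hT

lemma exists_mem (h : IsTriangulation Ω 𝒯) {x : Pt n} (hx : x ∈ closure Ω) :
    ∃ T ∈ 𝒯, x ∈ elem T := by
  rw [← h.cover] at hx; simpa using hx

open Classical in
lemma inter_eq (h : IsTriangulation Ω 𝒯) (hT : T ∈ 𝒯) (hT' : T' ∈ 𝒯) :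
    elem T ∩ elem T' = convexHull ℝ ((T ∩ T' : Finset (Pt n)) : Set (Pt n)) := by
  rw [h.conforming T hT T' hT', Finset.coe_inter]

/-- By conformity a common point is a convex combination of the common vertices, and this is its
barycentric representation in both simplices. This makes the hat functions well defined. -/
lemma bary_congr (h : IsTriangulation Ω 𝒯) (hT : T ∈ 𝒯) (hT' : T' ∈ 𝒯) {x : Pt n}
    (hx : x ∈ elem T) (hx' : x ∈ elem T') (v : Pt n) : bary T v x = bary T' v x := by
  classical
  have hm : x ∈ convexHull ℝ ((T ∩ T' : Finset (Pt n)) : Set (Pt n)) := by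
    rw [← h.inter_eq hT hT']; exact ⟨hx, hx'⟩
  by_cases hv : v ∈ T ∩ T'
  · obtain ⟨w, -, h1, h2⟩ := Finset.mem_convexHull'.1 hm
    have key : ∀ S : Finset (Pt n), IsSimplex S → T ∩ T' ⊆ S → bary S v x = w v := by
      intro S hS hsub
      rw [bary_unique hS (c := fun v => if v ∈ T ∩ T' then w v else 0) (x := x) ?_ ?_ (hsub hv),
        if_pos hv]
      · rw [← h1, ← Finset.sum_filter, Finset.filter_mem_eq_inter, Finset.inter_eq_right.2 hsub]
      · rw [← h2]
        simp only [ite_smul, zero_smul]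
        rw [← Finset.sum_filter, Finset.filter_mem_eq_inter, Finset.inter_eq_right.2 hsub]
    rw [key T (h.simplex T hT) Finset.inter_subset_left,
      key T' (h.simplex T' hT') Finset.inter_subset_right]
  · rw [bary_eq_zero_of_mem_face (h.simplex T hT) Finset.inter_subset_left hm hv,
      bary_eq_zero_of_mem_face (h.simplex T' hT') Finset.inter_subset_right hm hv]

lemma weight_eq (h : IsTriangulation Ω 𝒯) (hT : T ∈ 𝒯) {x : Pt n} (hx : x ∈ elem T) (v : Pt n) :
    weight 𝒯 x v = bary T v x := by
  have hex : ∃ T ∈ 𝒯, x ∈ elem T := ⟨T, hT, hx⟩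
  rw [weight, dif_pos hex]
  exact h.bary_congr hex.choose_spec.1 hT hex.choose_spec.2 hx v

lemma weight_eq_zero (h : IsTriangulation Ω 𝒯) {x : Pt n} (hx : x ∉ closure Ω) (v : Pt n) :
    weight 𝒯 x v = 0 := by
  rw [weight, dif_neg]
  rintro ⟨T, hT, hxT⟩
  exact hx (h.elem_subset_closure hT hxT)

/-- The intersection of two distinct elements is a null set. -/
lemma volume_inter (h : IsTriangulation Ω 𝒯) (hT : T ∈ 𝒯) (hT' : T' ∈ 𝒯) (hne : T ≠ T') :
    volume (elem T ∩ elem T') = 0 := by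
  classical
  refine measure_mono_null (fun x hx => ?_) (volume_frontier_elem T)
  rw [(isClosed_elem T).frontier_eq]
  refine ⟨hx.1, fun hi => ?_⟩
  have hsub : ¬ T ⊆ T' := fun hs => hne
    (Finset.eq_of_subset_of_card_le hs (by rw [(h.simplex T hT).1, (h.simplex T' hT').1]))
  obtain ⟨v, hv, hv'⟩ := Finset.not_subset.1 hsub
  have h1 := (mem_interior_elem_iff (h.simplex T hT)).1 hi v hv
  rw [h.bary_congr hT hT' hx.1 hx.2, bary_of_notMem hv'] at h1
  exact lt_irrefl _ h1

end IsTriangulation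

namespace IsMesh

variable {n : ℕ} {c h : ℝ} {Ω : Set (Pt n)} {𝒯 : Finset (Finset (Pt n))} {T T' : Finset (Pt n)}

lemma simplex (M : IsMesh c h Ω 𝒯) (hT : T ∈ 𝒯) : IsSimplex T := M.tri.simplex T hT

lemma interior_elem_subset (M : IsMesh c h Ω 𝒯) (hT : T ∈ 𝒯) : interior (elem T) ⊆ Ω := by
  rw [← M.interior_closure]; exact interior_mono (M.tri.elem_subset_closure hT)

/-- A point of an element lies in `Ω` as soon as some point of the smallest face containing it
does. -/
lemma mem_of_support_subset (M : IsMesh c h Ω 𝒯) (hT : T ∈ 𝒯) {x y : Pt n} (hx : x ∈ elem T)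
    (hy : y ∈ elem T) (hxy : ∀ v, bary T v x = 0 → bary T v y = 0) (hyΩ : y ∈ Ω) : x ∈ Ω := by
  have hTs := M.simplex hT
  have hline : Tendsto (fun t : ℝ => AffineMap.lineMap y x t) (𝓝[>] 0) (𝓝 y) := by
    have : Tendsto (fun t : ℝ => AffineMap.lineMap y x t) (𝓝 0) (𝓝 (AffineMap.lineMap y x (0 : ℝ))) :=
      (AffineMap.lineMap_continuous).tendsto 0
    rw [AffineMap.lineMap_apply_zero] at this
    exact this.mono_left nhdsWithin_le_nhds
  have h1 := (hline.eventually (M.isOpen.mem_nhds hyΩ)).and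
    (Ioo_mem_nhdsGT (zero_lt_one : (0 : ℝ) < 1))
  obtain ⟨t, htΩ, ht0, ht1⟩ := h1.exists
  -- A point of `Ω` near `y` on the segment towards `x`, having exactly the same vanishing
  -- coordinates as `x`.
  set y' := AffineMap.lineMap y x t with hy'
  have hb : ∀ v, bary T v y' = (1 - t) * bary T v y + t * bary T v x := fun v => by
    rw [hy', AffineMap.apply_lineMap, AffineMap.lineMap_apply_ring]
  have hy'T : y' ∈ elem T := (convex_elem T).lineMap_mem hy hx ⟨ht0.le, ht1.le⟩
  have hz : ∀ v, bary T v y' = 0 ↔ bary T v x = 0 := fun v => by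
    constructor
    · intro h0
      rw [hb] at h0
      have e1 := (mem_elem_iff hTs).1 hx v
      have e2 := (mem_elem_iff hTs).1 hy v
      nlinarith
    · intro h0
      rw [hb, h0, hxy v h0]; ring
  have hcl : ∀ᶠ d in 𝓝 (0 : Pt n), y' + d ∈ closure Ω := by
    have : Tendsto (fun d : Pt n => y' + d) (𝓝 0) (𝓝 y') := 
      Continuous.tendsto' (by fun_prop) _ _ (by simp)
    exact (this.eventually (M.isOpen.mem_nhds htΩ)).mono fun d hd => subset_closure hd
  have hne : ∀ᶠ d in 𝓝 (0 : Pt n), ∀ T' ∈ 𝒯, y' ∉ elem T' → y' + d ∉ elem T' := by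
    rw [Filter.eventually_all_finset]
    intro T' hT'
    by_cases hm : y' ∈ elem T'
    · simp [hm]
    · have : Tendsto (fun d : Pt n => y' + d) (𝓝 0) (𝓝 y') := 
      Continuous.tendsto' (by fun_prop) _ _ (by simp)
      exact (this.eventually ((isClosed_elem T').isOpen_compl.mem_nhds hm)).mono fun d hd _ => hd
  have hpos : ∀ᶠ d in 𝓝 (0 : Pt n), ∀ T' ∈ 𝒯, ∀ v ∈ T', 0 < bary T' v x → 0 < bary T' v (x + d) := by
    rw [Filter.eventually_all_finset]
    intro T' hT'
    rw [Filter.eventually_all_finset]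
    intro v hv
    by_cases hm : 0 < bary T' v x
    · have : Tendsto (fun d : Pt n => bary T' v (x + d)) (𝓝 0) (𝓝 (bary T' v x)) := 
        ((continuous_bary T' v).comp (continuous_const.add continuous_id)).tendsto' _ _ (by simp)
      exact (this.eventually (lt_mem_nhds hm)).mono fun d hd _ => hd
    · simp [hm]
  -- For small `d`, an element containing `y' + d` contains `y'` and hence also `x`, which lies on
  -- the same open face. The constraints active at `x` are active at `y'`, where `d` does not
  -- violate them; the others survive a small shift. So `x + d` lies in that element.
  have hfin : ∀ᶠ d in 𝓝 (0 : Pt n), x + d ∈ closure Ω := by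
    filter_upwards [hcl, hne, hpos] with d h1 h2 h3
    obtain ⟨T', hT', hd⟩ := M.tri.exists_mem h1
    have hyT' : y' ∈ elem T' := by by_contra hc; exact h2 T' hT' hc hd
    have hcong := fun v => M.tri.bary_congr hT hT' hy'T hyT' v
    have hxT' : x ∈ elem T' := by
      have h4 : x ∈ convexHull ℝ ((T : Set (Pt n)) ∩ T') := by
        classical
        rw [← Finset.coe_inter]
        refine mem_face_of_bary_eq_zero hTs Finset.inter_subset_left hx fun v hv hvn => ?_
        rw [← hz, hcong]
        exact bary_of_notMem (fun h => hvn (Finset.mem_inter.2 ⟨hv, h⟩)) _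
      rw [← M.tri.conforming T hT T' hT'] at h4
      exact h4.2
    refine M.tri.elem_subset_closure hT' ((mem_elem_iff (M.simplex hT')).2 fun v => ?_)
    by_cases hv : v ∈ T'
    · rcases ((mem_elem_iff (M.simplex hT')).1 hxT' v).eq_or_lt with h0 | h0
      · have h5 := (mem_elem_iff (M.simplex hT')).1 hd v
        have h6 : bary T' v y' = 0 := by
          rw [← hcong, hz, M.tri.bary_congr hT hT' hx hxT', ← h0]
        rw [bary_add, h6] at h5
        rw [bary_add, ← h0]; exact h5
      · exact (h3 T' hT' v hv h0).le
    · rw [bary_of_notMem hv]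
  rw [← M.interior_closure, mem_interior_iff_mem_nhds]
  have h7 : Tendsto (fun z : Pt n => z - x) (𝓝 x) (𝓝 0) := 
    Continuous.tendsto' (by fun_prop) _ _ (by simp)
  filter_upwards [h7.eventually hfin] with z hz
  simpa using hz

end IsMesh

/-! ### Facets -/

lemma affineSpan_ne_top_of_card_le {n : ℕ} (F : Finset (Pt n)) (hF : F.card ≤ n) :
    affineSpan ℝ (F : Set (Pt n)) ≠ ⊤ := by
  intro h
  rcases F.eq_empty_or_nonempty with rfl | hne
  · simp at h
  have : Nonempty F := hne.to_subtype
  have h1 := finrank_vectorSpan_range_add_one_le ℝ (fun x : F => (x : Pt n))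
  have h2 : Set.range (fun x : F => (x : Pt n)) = (F : Set (Pt n)) := Subtype.range_coe
  rw [h2, ← direction_affineSpan, h, AffineSubspace.direction_top, finrank_top,
    finrank_euclideanSpace_fin, Fintype.card_coe] at h1
  omega

/-- Generic segments avoid the affine spans of sets of fewer than `n` points of a finite set. -/
lemma exists_generic_segment {n : ℕ} (𝒱 : Finset (Pt n)) {U₁ U₂ : Set (Pt n)} (hU₁ : IsOpen U₁)
    (hU₂ : IsOpen U₂) (hne₁ : U₁.Nonempty) (hne₂ : U₂.Nonempty) :
    ∃ a ∈ U₁, ∃ b ∈ U₂, ∀ F ⊆ 𝒱, F.card + 1 ≤ n → ∀ c ∈ segment ℝ a b,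
      c ∉ affineSpan ℝ (F : Set (Pt n)) := by
  classical
  have key : ∀ (U : Set (Pt n)), IsOpen U → U.Nonempty → ∀ g : Finset (Pt n) → Finset (Pt n),
      (∀ F ⊆ 𝒱, F.card + 1 ≤ n → (g F).card ≤ n) →
      ∃ a ∈ U, ∀ F ⊆ 𝒱, F.card + 1 ≤ n → a ∉ affineSpan ℝ (g F : Set (Pt n)) := by
    intro U hU hne g hg
    by_contra! hcon
    have h0 : volume (⋃ F ∈ ((𝒱.powerset.filter fun F => F.card + 1 ≤ n :
        Finset (Finset (Pt n))) : Set (Finset (Pt n))), (affineSpan ℝ (g F : Set (Pt n)) : Set (Pt n))) = 0 := by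
      rw [measure_biUnion_null_iff (Finset.countable_toSet _)]
      intro F hF
      rw [Finset.mem_coe, Finset.mem_filter, Finset.mem_powerset] at hF
      exact Measure.addHaar_affineSubspace _ _ (affineSpan_ne_top_of_card_le _ (hg F hF.1 hF.2))
    refine (hU.measure_pos volume hne).ne' (measure_mono_null (fun a ha => ?_) h0)
    obtain ⟨F, hF, hc, hm⟩ := hcon a ha
    simp only [Set.mem_iUnion]
    exact ⟨F, Finset.mem_coe.2 (Finset.mem_filter.2 ⟨Finset.mem_powerset.2 hF, hc⟩), hm⟩
  obtain ⟨a, ha, haF⟩ := key U₁ hU₁ hne₁ id fun F _ hF => by simp only [id]; omega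
  -- If the segment met the span of `F` at a point other than `a`, the line through `a` and that
  -- point would put `b` into the span of `insert a F`.
  obtain ⟨b, hb, hbF⟩ := key U₂ hU₂ hne₂ (fun F => insert a F) fun F _ hF =>
    (Finset.card_insert_le _ _).trans hF
  refine ⟨a, ha, b, hb, fun F hF hcard c hc hmem => ?_⟩
  rw [segment_eq_image_lineMap] at hc
  obtain ⟨t, -, rfl⟩ := hc
  rcases eq_or_ne t 0 with rfl | ht
  · rw [AffineMap.lineMap_apply_zero] at hmem
    exact haF F hF hcard hmem
  · refine hbF F hF hcard ?_
    have h1 : AffineMap.lineMap a b t ∈ affineSpan ℝ (insert a F : Finset (Pt n)) :=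
      affineSpan_mono ℝ (by simp) hmem
    have h2 : a ∈ affineSpan ℝ ((insert a F : Finset (Pt n)) : Set (Pt n)) :=
      subset_affineSpan ℝ _ (by simp)
    have h3 := AffineMap.lineMap_mem t⁻¹ h2 h1
    rwa [AffineMap.lineMap_lineMap_right, inv_mul_cancel₀ ht, AffineMap.lineMap_apply_one] at h3

namespace IsMesh

variable {n : ℕ} {c h : ℝ} {Ω : Set (Pt n)} {𝒯 : Finset (Finset (Pt n))} {T T' : Finset (Pt n)}

lemma mem_nbrs : T' ∈ nbrs 𝒯 T ↔ T' ∈ 𝒯 ∧ (elem T ∩ elem T').Nonempty := by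
  simp [nbrs]

lemma self_mem_nbrs (M : IsMesh c h Ω 𝒯) (hT : T ∈ 𝒯) : T ∈ nbrs 𝒯 T := by
  rw [mem_nbrs, Set.inter_self]
  exact ⟨hT, (M.simplex hT).interior_nonempty.mono interior_subset⟩

open Classical in
/-- Within the patch of an element, any proper set of elements containing it has a neighbour across
a facet. -/
lemma exists_facet_pair (M : IsMesh c h Ω 𝒯) (hT : T ∈ 𝒯) {A : Finset (Finset (Pt n))}
    (hTA : T ∈ A) (hA : A ⊂ nbrs 𝒯 T) :
    ∃ T₁ ∈ A, ∃ T₂ ∈ nbrs 𝒯 T, T₂ ∉ A ∧ (T₁ ∩ T₂).card = n := by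
  have hsub := hA.subset
  have h𝒯 : ∀ S ∈ nbrs 𝒯 T, S ∈ 𝒯 := fun S hS => (mem_nbrs.1 hS).1
  have hpatch : patch 𝒯 T = interior (⋃ S ∈ nbrs 𝒯 T, elem S) := by
    simp [patch, nbrs]
  have hcl : ∀ B : Finset (Finset (Pt n)), IsClosed (⋃ S ∈ B, elem S) := fun B =>
    isClosed_biUnion_finset fun S _ => isClosed_elem S
  have hcov : patch 𝒯 T ⊆ (⋃ S ∈ A, elem S) ∪ ⋃ S ∈ nbrs 𝒯 T \ A, elem S := by
    rw [hpatch]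
    refine interior_subset.trans fun x hx => ?_
    simp only [Set.mem_iUnion] at hx
    obtain ⟨S, hS, hx⟩ := hx
    by_cases hSA : S ∈ A
    · exact Or.inl (Set.mem_biUnion (t := elem) hSA hx)
    · exact Or.inr (Set.mem_biUnion (t := elem) (Finset.mem_sdiff.2 ⟨hS, hSA⟩) hx)
  have hInt : ∀ S ∈ nbrs 𝒯 T, interior (elem S) ⊆ patch 𝒯 T := fun S hS => by
    rw [hpatch]
    exact interior_mono (Set.subset_biUnion_of_mem (u := elem) (s := {S | S ∈ nbrs 𝒯 T}) hS)
  have hmeet : ∀ B ⊆ nbrs 𝒯 T, B.Nonempty → (patch 𝒯 T ∩ ⋃ S ∈ B, elem S).Nonempty := by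
    rintro B hB ⟨S, hS⟩
    obtain ⟨x, hx⟩ := (M.simplex (h𝒯 S (hB hS))).interior_nonempty
    exact ⟨x, hInt S (hB hS) hx, Set.mem_biUnion (t := elem) hS (interior_subset hx)⟩
  have hBne : (nbrs 𝒯 T \ A).Nonempty := Finset.sdiff_nonempty.2 hA.2
  -- The two closed unions cover the connected patch, so they meet inside it; a whole ball around a
  -- common point lies in the patch.
  obtain ⟨x, hxP, hxA, hxB⟩ := isPreconnected_closed_iff.1 (M.connected T hT).isPreconnected _ _
    (hcl A) (hcl _) hcov (hmeet A hsub ⟨T, hTA⟩) (hmeet _ Finset.sdiff_subset hBne)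
  obtain ⟨ε, hε, hball⟩ := Metric.isOpen_iff.1 (by rw [hpatch]; exact isOpen_interior) x hxP
  have hopen : ∀ S ∈ nbrs 𝒯 T, x ∈ elem S → (Metric.ball x ε ∩ interior (elem S)).Nonempty := by
    intro S hS hxS
    rw [← (M.simplex (h𝒯 S hS)).closure_interior] at hxS
    exact mem_closure_iff.1 hxS _ Metric.isOpen_ball (Metric.mem_ball_self hε)
  simp only [Set.mem_iUnion] at hxA hxB
  obtain ⟨S₁, hS₁, hxS₁⟩ := hxA
  obtain ⟨S₂, hS₂, hxS₂⟩ := hxB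
  -- Inside this ball a generic segment joins the interior of an element of `A` to that of an
  -- element outside `A`, avoiding all faces with fewer than `n` vertices. At a point where both
  -- unions meet the segment, two elements therefore share at least `n` vertices, and not all `n +
  -- 1` since they are distinct.
  obtain ⟨a, ha, b, hb, hgen⟩ := exists_generic_segment (𝒯.biUnion id)
    (Metric.isOpen_ball.inter isOpen_interior) (Metric.isOpen_ball.inter isOpen_interior)
    (hopen S₁ (hsub hS₁) hxS₁) (hopen S₂ (Finset.sdiff_subset hS₂) hxS₂)
  have hseg : segment ℝ a b ⊆ patch 𝒯 T :=
    ((convex_ball x ε).segment_subset ha.1 hb.1).trans hball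
  obtain ⟨z, hz, hzA, hzB⟩ := isPreconnected_closed_iff.1
    (convex_segment (𝕜 := ℝ) a b).isPreconnected _ _ (hcl A) (hcl _) (hseg.trans hcov)
    ⟨a, left_mem_segment ℝ a b, Set.mem_biUnion (t := elem) hS₁ (interior_subset ha.2)⟩
    ⟨b, right_mem_segment ℝ a b, Set.mem_biUnion (t := elem) hS₂ (interior_subset hb.2)⟩
  simp only [Set.mem_iUnion] at hzA hzB
  obtain ⟨T₁, hT₁, hzT₁⟩ := hzA
  obtain ⟨T₂, hT₂, hzT₂⟩ := hzB
  obtain ⟨hT₂n, hT₂A⟩ := Finset.mem_sdiff.1 hT₂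
  refine ⟨T₁, hT₁, T₂, hT₂n, hT₂A, ?_⟩
  have h1 := h𝒯 T₁ (hsub hT₁)
  have h2 := h𝒯 T₂ hT₂n
  have hlt : (T₁ ∩ T₂).card < n + 1 := by
    rw [← (M.simplex h1).1]
    refine Finset.card_lt_card ⟨Finset.inter_subset_left, fun hs => ?_⟩
    have : T₁ = T₂ := Finset.eq_of_subset_of_card_le (hs.trans Finset.inter_subset_right)
      (by rw [(M.simplex h1).1, (M.simplex h2).1])
    exact hT₂A (this ▸ hT₁)
  by_contra hne
  refine hgen (T₁ ∩ T₂) (fun v hv => Finset.mem_biUnion.2 ⟨T₁, h1, (Finset.mem_inter.1 hv).1⟩)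
    (by omega) z hz (convexHull_subset_affineSpan _ ?_)
  rw [← M.tri.inter_eq h1 h2]
  exact ⟨hzT₁, hzT₂⟩

open Classical in
/-- A vertex on the boundary belongs to a facet contained in the boundary. -/
lemma exists_boundary_facet (M : IsMesh c h Ω 𝒯) (hT : T ∈ 𝒯) {z : Pt n} (hz : z ∈ T)
    (hzΩ : z ∉ Ω) : ∃ T' ∈ 𝒯, ∃ a ∈ T', z ∈ T'.erase a ∧
      ∀ x ∈ convexHull ℝ ((T'.erase a : Finset (Pt n)) : Set (Pt n)), x ∉ Ω := by
  -- Near `z` only faces containing `z` are met. This is what places `z` on the facet found below.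
  have hnear : ∀ᶠ x in 𝓝 z, ∀ S ∈ 𝒯, ∀ F ∈ S.powerset,
      z ∉ convexHull ℝ (F : Set (Pt n)) → x ∉ convexHull ℝ (F : Set (Pt n)) := by
    rw [Filter.eventually_all_finset]
    intro S _
    rw [Filter.eventually_all_finset]
    intro F _
    by_cases hm : z ∈ convexHull ℝ (F : Set (Pt n))
    · simp [hm]
    · exact ((isClosed_elem F).isOpen_compl.mem_nhds hm : _ ∈ 𝓝 z) |> fun h =>
        Filter.mem_of_superset h fun x hx _ => hx
  obtain ⟨ε, hε, hball⟩ := Metric.eventually_nhds_iff_ball.1 hnear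
  have hzT : z ∈ elem T := subset_elem T hz
  have hne1 : (Metric.ball z ε ∩ interior (elem T)).Nonempty := by
    rw [← (M.simplex hT).closure_interior] at hzT
    exact mem_closure_iff.1 hzT _ Metric.isOpen_ball (Metric.mem_ball_self hε)
  have hne2 : (Metric.ball z ε ∩ (closure Ω)ᶜ).Nonempty := by
    rw [← M.interior_closure, mem_interior_iff_mem_nhds] at hzΩ
    by_contra hcon
    rw [Set.not_nonempty_iff_eq_empty, ← Set.sdiff_eq, Set.sdiff_eq_empty] at hcon
    exact hzΩ (Filter.mem_of_superset (Metric.ball_mem_nhds z hε) hcon)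
  -- A generic segment near `z` leads from an element to the exterior. It crosses the boundary at a
  -- point `y` which, by genericity, is in the relative interior of a facet.
  obtain ⟨a, ha, b, hb, hgen⟩ := exists_generic_segment (𝒯.biUnion id)
    (Metric.isOpen_ball.inter isOpen_interior) (Metric.isOpen_ball.inter isClosed_closure.isOpen_compl)
    hne1 hne2
  have hseg : segment ℝ a b ⊆ Metric.ball z ε := (convex_ball z ε).segment_subset ha.1 hb.1
  obtain ⟨y, hy, hyc, hyΩ⟩ := isPreconnected_closed_iff.1
    (convex_segment (𝕜 := ℝ) a b).isPreconnected (closure Ω) Ωᶜ isClosed_closure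
    M.isOpen.isClosed_compl (fun x _ => by
      by_cases hx : x ∈ Ω
      · exact Or.inl (subset_closure hx)
      · exact Or.inr hx)
    ⟨a, left_mem_segment ℝ a b, subset_closure (M.interior_elem_subset hT ha.2)⟩
    ⟨b, right_mem_segment ℝ a b, fun hbΩ => hb.2 (subset_closure hbΩ)⟩
  obtain ⟨T', hT', hyT'⟩ := M.tri.exists_mem hyc
  have hT's := M.simplex hT'
  have hnint : ¬ ∀ v ∈ T', 0 < bary T' v y := fun hcon =>
    hyΩ (M.interior_elem_subset hT' ((mem_interior_elem_iff hT's).2 hcon))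
  push Not at hnint
  obtain ⟨v, hv, hv0⟩ := hnint
  have hv0 : bary T' v y = 0 := le_antisymm hv0 ((mem_elem_iff hT's).1 hyT' v)
  have hyF : y ∈ convexHull ℝ ((T'.erase v : Finset (Pt n)) : Set (Pt n)) := by
    refine mem_face_of_bary_eq_zero hT's (Finset.erase_subset _ _) hyT' fun w hw hwn => ?_
    have : w = v := by by_contra hne; exact hwn (Finset.mem_erase.2 ⟨hne, hw⟩)
    rw [this, hv0]
  refine ⟨T', hT', v, hv, ?_, fun x hx hxΩ => ?_⟩
  · have hzF : z ∈ convexHull ℝ ((T'.erase v : Finset (Pt n)) : Set (Pt n)) := by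
      by_contra hcon
      exact hball y (hseg hy) T' hT' _ (Finset.mem_powerset.2 (Finset.erase_subset _ _)) hcon hyF
    have hzT' : z ∈ elem T' := convexHull_mono (by simp) hzF
    have h1 : bary T' z z = 1 := by
      rw [← M.tri.bary_congr hT hT' hzT hzT', bary_vertex (M.simplex hT) hz hz, if_pos rfl]
    by_contra hcon
    rw [bary_eq_zero_of_mem_face hT's (Finset.erase_subset _ _) hzF hcon] at h1
    exact zero_ne_one h1
  -- If a point of the facet were in `Ω`, then so would be `y`, none of whose coordinates belonging
  -- to the facet vanishes.
  · refine hyΩ (M.mem_of_support_subset hT' hyT' (convexHull_mono (by simp) hx) (fun w hw => ?_) hxΩ)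
    by_cases hwv : w ∈ T'.erase v
    · exfalso
      have hwT := Finset.mem_of_mem_erase hwv
      have hcard : ((T'.erase v).erase w).card + 1 ≤ n := by
        have h1 := Finset.card_erase_of_mem hv
        have h2 := Finset.card_erase_add_one hwv
        rw [hT's.1] at h1
        omega
      refine hgen ((T'.erase v).erase w) (fun u hu => Finset.mem_biUnion.2
        ⟨T', hT', Finset.mem_of_mem_erase (Finset.mem_of_mem_erase hu)⟩) hcard y hy
        (convexHull_subset_affineSpan _ ?_)
      refine mem_face_of_bary_eq_zero hT's
        ((Finset.erase_subset _ _).trans (Finset.erase_subset _ _)) hyT' fun u hu hun => ?_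
      by_cases huw : u = w
      · rw [huw, hw]
      · by_cases huv : u = v
        · rw [huv, hv0]
        · exact absurd (Finset.mem_erase.2 ⟨huw, Finset.mem_erase.2 ⟨huv, hu⟩⟩) hun
    · exact bary_eq_zero_of_mem_face hT's (Finset.erase_subset _ _) hx hwv

lemma abs_bary_linear_le (M : IsMesh c h Ω 𝒯) (hT : T ∈ 𝒯) (v d : Pt n) :
    |(bary T v).linear d| ≤ ‖d‖ / (c * h) := by
  obtain ⟨x₀, hx₀⟩ := M.ball T hT
  exact FEM.abs_bary_linear_le (M.simplex hT) (mul_pos M.c_pos M.h_pos) hx₀ v d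

lemma abs_bary_sub_le (M : IsMesh c h Ω 𝒯) (hT : T ∈ 𝒯) (v x y : Pt n) :
    |bary T v x - bary T v y| ≤ dist x y / (c * h) := by
  rw [bary_sub, dist_eq_norm]; exact M.abs_bary_linear_le hT v _

lemma closedBall_subset_elem (M : IsMesh c h Ω 𝒯) (hT : T ∈ 𝒯) {x : Pt n} {s : ℝ}
    (hx : ∀ v ∈ T, s / (c * h) ≤ bary T v x) : Metric.closedBall x s ⊆ elem T := by
  intro y hy
  have hch := mul_pos M.c_pos M.h_pos
  refine (mem_elem_iff (M.simplex hT)).2 fun v => ?_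
  by_cases hv : v ∈ T
  · have h1 := M.abs_bary_sub_le hT v y x
    have h2 : dist y x / (c * h) ≤ s / (c * h) :=
      div_le_div_of_nonneg_right (Metric.mem_closedBall.1 hy) hch.le
    have h3 := hx v hv
    have := (abs_le.1 h1).1
    linarith
  · rw [bary_of_notMem hv]

end IsMesh

lemma affine_eq_sum_bary {n : ℕ} {T : Finset (Pt n)} (hT : IsSimplex T) (f : Pt n →ᵃ[ℝ] ℝ)
    (x : Pt n) : f x = ∑ v ∈ T, bary T v x * f v := by
  have h1 : ∀ y, f y = f.linear y + f 0 := fun y => congrFun f.decomp y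
  have h2 : ∑ v ∈ T, bary T v x * f v = ∑ v ∈ T, (bary T v x * f.linear v + bary T v x * f 0) :=
    Finset.sum_congr rfl fun v _ => by rw [h1 v, mul_add]
  rw [h2, Finset.sum_add_distrib, ← Finset.sum_mul, sum_bary hT, one_mul, h1 x]
  congr 1
  conv_lhs => rw [← sum_bary_smul hT x]
  simp [map_sum]

/-- The centroid of a facet with vertex set `F` in `ℝⁿ`. -/
def facetCenter {n : ℕ} (F : Finset (Pt n)) : Pt n := ∑ v ∈ F, (n : ℝ)⁻¹ • v

open Classical in
lemma bary_facetCenter {n : ℕ} (hn : 1 ≤ n) {T F : Finset (Pt n)} (hT : IsSimplex T) (hF : F ⊆ T)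
    (hcard : F.card = n) (v : Pt n) :
    bary T v (facetCenter F) = if v ∈ F then (n : ℝ)⁻¹ else 0 := by
  have hn' : (n : ℝ) ≠ 0 := by positivity
  by_cases hv : v ∈ T
  · refine bary_unique hT (c := fun v => if v ∈ F then (n : ℝ)⁻¹ else 0) ?_ ?_ hv
    · rw [← Finset.sum_filter, Finset.filter_mem_eq_inter, Finset.inter_eq_right.2 hF]
      simp [hcard, hn']
    · simp only [ite_smul, zero_smul]
      rw [← Finset.sum_filter, Finset.filter_mem_eq_inter, Finset.inter_eq_right.2 hF]
      rfl
  · rw [bary_of_notMem hv, if_neg fun h => hv (hF h)]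

namespace IsMesh

variable {n : ℕ} {c h : ℝ} {Ω : Set (Pt n)} {𝒯 : Finset (Finset (Pt n))} {T T' : Finset (Pt n)}

lemma facetCenter_mem (M : IsMesh c h Ω 𝒯) (hn : 1 ≤ n) (hT : T ∈ 𝒯) {F : Finset (Pt n)}
    (hF : F ⊆ T) (hcard : F.card = n) : facetCenter F ∈ elem T := by
  refine (mem_elem_iff (M.simplex hT)).2 fun v => ?_
  rw [bary_facetCenter hn (M.simplex hT) hF hcard]
  split_ifs <;> positivity

/-- Near the centre of a facet, the element is a half space. -/
lemma mem_elem_of_near_facetCenter (M : IsMesh c h Ω 𝒯) (hn : 1 ≤ n) (hT : T ∈ 𝒯)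
    {F : Finset (Pt n)} (hF : F ⊆ T) (hcard : F.card = n) {a : Pt n}
    (ha : ∀ v ∈ T, v = a ∨ v ∈ F) {x : Pt n} (hx : dist x (facetCenter F) ≤ c / n * h)
    (hxa : 0 ≤ bary T a x) : x ∈ elem T := by
  have hn' : (0 : ℝ) < n := by exact_mod_cast hn
  have hch := mul_pos M.c_pos M.h_pos
  refine (mem_elem_iff (M.simplex hT)).2 fun v => ?_
  by_cases hv : v ∈ T
  · rcases ha v hv with rfl | hvF
    · exact hxa
    · have h1 := M.abs_bary_sub_le hT v x (facetCenter F)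
      rw [bary_facetCenter hn (M.simplex hT) hF hcard, if_pos hvF] at h1
      have h2 : dist x (facetCenter F) / (c * h) ≤ (n : ℝ)⁻¹ := by
        rw [div_le_iff₀ hch]
        calc _ ≤ c / n * h := hx
          _ = _ := by field_simp
      have := (abs_le.1 h1).1
      linarith
  · rw [bary_of_notMem hv]

/-- Near the centre of a facet, the element contains a ball. -/
lemma exists_ball_near_facetCenter (M : IsMesh c h Ω 𝒯) (hn : 1 ≤ n) (hT : T ∈ 𝒯)
    {F : Finset (Pt n)} (hF : F ⊆ T) (hcard : F.card = n) {a : Pt n} (haT : a ∈ T) (haF : a ∉ F)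
    (ha : ∀ v ∈ T, v = a ∨ v ∈ F) :
    ∃ x, 0 < bary T a x ∧ Metric.closedBall x (c ^ 2 / (2 * n) * h) ⊆ elem T ∧
      Metric.closedBall x (c ^ 2 / (2 * n) * h) ⊆ Metric.closedBall (facetCenter F) (c / n * h) := by
  have hn1 : (1 : ℝ) ≤ n := by exact_mod_cast hn
  have hn' : (0 : ℝ) < n := by positivity
  have hc := M.c_pos
  have hc1 := M.c_le
  have hh := M.h_pos
  have hch := mul_pos M.c_pos M.h_pos
  set b := facetCenter F with hb
  -- Moving from the centre of the facet towards `a` by the fraction `τ` makes every coordinate at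
  -- least `τ`, which leaves room for a ball of radius `τ * (c * h)`.
  set τ : ℝ := c / (2 * n) with hτ
  have hτ0 : 0 < τ := by positivity
  have hτn : τ * n = c / 2 := by rw [hτ]; field_simp
  have hτ1 : τ ≤ 1 / 2 := by nlinarith
  set x := AffineMap.lineMap b a τ with hx
  have hbary : ∀ v, bary T v x = (1 - τ) * bary T v b + τ * bary T v a := fun v => by
    rw [hx, AffineMap.apply_lineMap, AffineMap.lineMap_apply_ring]
  have hxa : bary T a x = τ := by
    rw [hbary, bary_facetCenter hn (M.simplex hT) hF hcard, if_neg haF,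
      bary_vertex (M.simplex hT) haT haT, if_pos rfl]
    ring
  refine ⟨x, by rw [hxa]; exact hτ0, M.closedBall_subset_elem hT fun v hv => ?_, ?_⟩
  · have hs : c ^ 2 / (2 * n) * h / (c * h) = τ := by rw [hτ]; field_simp
    rw [hs]
    rcases ha v hv with rfl | hvF
    · rw [hxa]
    · have hva : v ≠ a := fun h => haF (h ▸ hvF)
      rw [hbary, bary_facetCenter hn (M.simplex hT) hF hcard, if_pos hvF,
        bary_vertex (M.simplex hT) hv haT, if_neg hva, mul_zero, add_zero,
        ← div_eq_mul_inv, le_div_iff₀ hn', hτn]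
      linarith
  · refine Metric.closedBall_subset_closedBall' ?_
    have h1 : dist x b ≤ τ * h := by
      rw [hx, dist_lineMap_left, Real.norm_of_nonneg hτ0.le]
      exact mul_le_mul_of_nonneg_left (M.dist_le T hT b (M.facetCenter_mem hn hT hF hcard) a
        (subset_elem T haT)) hτ0.le
    have h2 : c ^ 2 / (2 * n) * h ≤ c / (2 * n) * h := by
      refine mul_le_mul_of_nonneg_right (div_le_div_of_nonneg_right ?_ (by positivity)) hh.le
      nlinarith
    calc _ ≤ c / (2 * n) * h + τ * h := add_le_add h2 h1
      _ = c / n * h := by rw [hτ]; field_simp; ring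

open Classical in
/-- Two elements sharing a facet contain a ball centred on it, in which both have a ball. -/
lemma exists_facet_ball (M : IsMesh c h Ω 𝒯) (hn : 1 ≤ n) (hT : T ∈ 𝒯) (hT' : T' ∈ 𝒯)
    (hcard : (T ∩ T').card = n) :
    ∃ b x x', Metric.closedBall b (c / n * h) ⊆ elem T ∪ elem T' ∧
      Metric.closedBall x (c ^ 2 / (2 * n) * h) ⊆ elem T ∧
      Metric.closedBall x (c ^ 2 / (2 * n) * h) ⊆ Metric.closedBall b (c / n * h) ∧
      Metric.closedBall x' (c ^ 2 / (2 * n) * h) ⊆ elem T' ∧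
      Metric.closedBall x' (c ^ 2 / (2 * n) * h) ⊆ Metric.closedBall b (c / n * h) := by
  have key : ∀ S : Finset (Pt n), IsSimplex S → T ∩ T' ⊆ S →
      ∃ a ∈ S, a ∉ T ∩ T' ∧ ∀ v ∈ S, v = a ∨ v ∈ T ∩ T' := by
    intro S hS hsub
    have h1 : (S \ (T ∩ T')).card = 1 := by
      rw [Finset.card_sdiff_of_subset hsub, hS.1, hcard]; omega
    obtain ⟨a, ha⟩ := Finset.card_eq_one.1 h1
    have h2 : ∀ v, v ∈ S \ (T ∩ T') ↔ v = a := fun v => by rw [ha, Finset.mem_singleton]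
    refine ⟨a, (Finset.mem_sdiff.1 ((h2 a).2 rfl)).1, (Finset.mem_sdiff.1 ((h2 a).2 rfl)).2,
      fun v hv => ?_⟩
    by_cases hvF : v ∈ T ∩ T'
    · exact Or.inr hvF
    · exact Or.inl ((h2 v).1 (Finset.mem_sdiff.2 ⟨hv, hvF⟩))
  have hs := M.simplex hT
  have hs' := M.simplex hT'
  obtain ⟨a, haT, haF, ha⟩ := key T hs Finset.inter_subset_left
  obtain ⟨a', haT', haF', ha'⟩ := key T' hs' Finset.inter_subset_right
  obtain ⟨x, hx0, hx1, hx2⟩ := M.exists_ball_near_facetCenter hn hT Finset.inter_subset_left hcard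
    haT haF ha
  obtain ⟨x', -, hx1', hx2'⟩ := M.exists_ball_near_facetCenter hn hT' Finset.inter_subset_right hcard
    haT' haF' ha'
  refine ⟨facetCenter (T ∩ T'), x, x', fun y hy => ?_, hx1, hx2, hx1', hx2'⟩
  -- `bary T' a'` vanishes at the common vertices, so it is a multiple of `bary T a`. The factor is
  -- nonpositive: otherwise a point of `T` off the facet would also lie in `T'`. Hence every point
  -- near the centre is on the right side of one of the two elements.
  have hprop : ∀ y, bary T' a' y = bary T a y * bary T' a' a := fun y => by
    rw [affine_eq_sum_bary hs (bary T' a') y]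
    refine Finset.sum_eq_single_of_mem a haT fun v hv hva => ?_
    have hvF : v ∈ T ∩ T' := (ha v hv).resolve_left hva
    have hne : a' ≠ v := fun h => haF' (h ▸ hvF)
    rw [bary_vertex hs' haT' (Finset.mem_inter.1 hvF).2, if_neg hne, mul_zero]
  have hneg : bary T' a' a ≤ 0 := by
    by_contra! hpos
    have hr : 0 ≤ c ^ 2 / (2 * n) * h :=
      mul_nonneg (div_nonneg (sq_nonneg _) (by positivity)) M.h_pos.le
    have hxm := hx2 (Metric.mem_closedBall_self hr)
    have hxT' : x ∈ elem T' := M.mem_elem_of_near_facetCenter hn hT' Finset.inter_subset_right hcard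
      ha' hxm (by rw [hprop]; positivity)
    rw [M.tri.bary_congr hT hT' (hx1 (Metric.mem_closedBall_self hr)) hxT',
      bary_of_notMem fun h => haF (Finset.mem_inter.2 ⟨haT, h⟩)] at hx0
    exact lt_irrefl _ hx0
  rcases le_or_gt 0 (bary T a y) with h0 | h0
  · exact Or.inl (M.mem_elem_of_near_facetCenter hn hT Finset.inter_subset_left hcard ha hy h0)
  · refine Or.inr (M.mem_elem_of_near_facetCenter hn hT' Finset.inter_subset_right hcard ha' hy ?_)
    rw [hprop]
    exact mul_nonneg_of_nonpos_of_nonpos h0.le hneg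

/-- The number of elements contained in a ball of radius `R * h` is bounded. -/
lemma card_le (M : IsMesh c h Ω 𝒯) {A : Finset (Finset (Pt n))} (hA : A ⊆ 𝒯) {y : Pt n} {R : ℝ}
    (hR : 0 ≤ R) (hAy : ∀ T ∈ A, elem T ⊆ Metric.closedBall y (R * h)) :
    (A.card : ℝ) ≤ (R / c) ^ n := by
  have hc := M.c_pos
  have hh := M.h_pos
  set vb := volume (Metric.ball (0 : Pt n) 1) with hvb
  have hv0 : vb ≠ 0 := (Metric.measure_ball_pos volume _ one_pos).ne'
  have hvt : vb ≠ ⊤ := measure_ball_lt_top.ne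
  have hd : (A : Set (Finset (Pt n))).Pairwise (Function.onFun (AEDisjoint volume) elem) :=
    fun S hS S' hS' hne => M.tri.volume_inter (hA hS) (hA hS') hne
  have h1 : ∑ T ∈ A, volume (elem T) ≤ volume (Metric.closedBall y (R * h)) := by
    rw [← measure_biUnion_finset₀ hd fun S _ => (measurableSet_elem S).nullMeasurableSet]
    exact measure_mono (Set.iUnion₂_subset hAy)
  have h2 : ∀ T ∈ A, ENNReal.ofReal ((c * h) ^ n) * vb ≤ volume (elem T) := fun T hT => by
    obtain ⟨x, hx⟩ := M.ball T (hA hT)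
    refine le_trans (le_of_eq ?_) (measure_mono hx)
    rw [Measure.addHaar_closedBall _ _ (by positivity), finrank_euclideanSpace_fin]
  have h3 := (Finset.card_nsmul_le_sum A _ _ h2).trans h1
  rw [Measure.addHaar_closedBall _ _ (by positivity), finrank_euclideanSpace_fin, nsmul_eq_mul,
    ← mul_assoc, ENNReal.mul_le_mul_iff_left hv0 hvt, ← ENNReal.ofReal_natCast,
    ← ENNReal.ofReal_mul (by positivity), ENNReal.ofReal_le_ofReal_iff (by positivity)] at h3
  rw [div_pow, le_div_iff₀ (by positivity)]
  rw [mul_pow, mul_pow, ← mul_assoc] at h3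
  exact le_of_mul_le_mul_right h3 (by positivity)

lemma dist_le_of_mem_nbrs (M : IsMesh c h Ω 𝒯) (hT : T ∈ 𝒯) (hT' : T' ∈ nbrs 𝒯 T) {x y : Pt n}
    (hx : x ∈ elem T) (hy : y ∈ elem T') : dist x y ≤ 2 * h := by
  obtain ⟨hT'm, z, hz, hz'⟩ := mem_nbrs.1 hT'
  have h1 := M.dist_le T hT x hx z hz
  have h2 := M.dist_le T' hT'm z hz' y hy
  linarith [dist_triangle x z y]

lemma card_nbrs_le (M : IsMesh c h Ω 𝒯) (hT : T ∈ 𝒯) :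
    ((nbrs 𝒯 T).card : ℝ) ≤ (2 / c) ^ n := by
  obtain ⟨x, hx⟩ := (M.simplex hT).interior_nonempty
  exact M.card_le (fun S hS => (mem_nbrs.1 hS).1) (y := x) zero_le_two fun S hS y hy => by
    rw [Metric.mem_closedBall, dist_comm]
    exact M.dist_le_of_mem_nbrs hT hS (interior_subset hx) hy

end IsMesh

/-! ### Poincaré inequalities -/

lemma lintegral_comp_smul_add {n : ℕ} (g : Pt n → ℝ≥0∞) {s : ℝ} (hs : s ≠ 0) (z : Pt n) :
    ∫⁻ x, g (s • x + z) = ENNReal.ofReal |(s ^ n)⁻¹| * ∫⁻ x, g x := by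
  have h1 := lintegral_map_equiv (μ := (volume : Measure (Pt n))) (fun x => g (x + z))
    (Homeomorph.smulOfNeZero s hs).toMeasurableEquiv
  have h2 := Measure.map_addHaar_smul (volume : Measure (Pt n)) hs
  rw [finrank_euclideanSpace_fin] at h2
  change ∫⁻ a, g (a + z) ∂(Measure.map (fun x => s • x) volume) = ∫⁻ a, g (s • a + z) at h1
  rw [← h1, h2, lintegral_smul_measure, smul_eq_mul, lintegral_add_right_eq_self]

lemma enorm_sub_le_lintegral_fderiv {n : ℕ} {f : Pt n → ℝ} (hf : ContDiff ℝ 1 f) (x y : Pt n) :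
    ‖f x - f y‖ₑ ≤ ‖y - x‖ₑ * ∫⁻ t in Set.Icc (0 : ℝ) 1, ‖fderiv ℝ f ((1 - t) • x + t • y)‖ₑ := by
  have hpath : ∀ t : ℝ, HasDerivAt (fun t : ℝ => (1 - t) • x + t • y) (y - x) t := fun t => by
    have h1 := (((hasDerivAt_const t (1 : ℝ)).sub (hasDerivAt_id t)).smul_const x).add
      ((hasDerivAt_id t).smul_const y)
    convert! h1 using 1
    simp [sub_eq_add_neg, add_comm]
  have hder : ∀ t : ℝ, HasDerivAt (fun t : ℝ => f ((1 - t) • x + t • y))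
      (fderiv ℝ f ((1 - t) • x + t • y) (y - x)) t := fun t =>
    ((hf.differentiable (by simp)) _).hasFDerivAt.comp_hasDerivAt t (hpath t)
  have hc : Continuous fun t : ℝ => fderiv ℝ f ((1 - t) • x + t • y) :=
    (hf.continuous_fderiv (by simp)).comp (by fun_prop)
  have h2 := intervalIntegral.integral_eq_sub_of_hasDerivAt (a := 0) (b := 1) (fun t _ => hder t)
    ((hc.clm_apply continuous_const).intervalIntegrable 0 1)
  simp only [sub_zero, one_smul, zero_smul, add_zero, sub_self, zero_add] at h2
  rw [enorm_sub_rev, ← h2, intervalIntegral.integral_of_le zero_le_one, ← integral_Icc_eq_integral_Ioc]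
  refine (enorm_integral_le_lintegral_enorm _).trans ?_
  rw [← lintegral_const_mul _ hc.enorm.measurable]
  refine lintegral_mono fun t => ?_
  rw [mul_comm]
  exact (fderiv ℝ f ((1 - t) • x + t • y)).le_opENorm (y - x)

/-- Poincaré inequality on convex sets, for differences. -/
lemma lintegral_lintegral_sub_le {n : ℕ} {K : Set (Pt n)} (hK : Convex ℝ K) (hKm : MeasurableSet K)
    {d : ℝ} (hd : ∀ x ∈ K, ∀ y ∈ K, dist x y ≤ d) {f : Pt n → ℝ} (hf : ContDiff ℝ 1 f) :
    ∫⁻ x in K, ∫⁻ y in K, ‖f x - f y‖ₑ ≤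
      2 ^ n * ENNReal.ofReal d * volume K * ∫⁻ x in K, ‖fderiv ℝ f x‖ₑ := by
  set g : Pt n → ℝ≥0∞ := K.indicator fun x => ‖fderiv ℝ f x‖ₑ with hg
  have hgm : Measurable g := (hf.continuous_fderiv (by simp)).enorm.measurable.indicator hKm
  have hgi : ∫⁻ x, g x = ∫⁻ x in K, ‖fderiv ℝ f x‖ₑ := lintegral_indicator hKm _
  rw [← hgi]
  have hj : Measurable fun q : (Pt n × Pt n) × ℝ => g ((1 - q.2) • q.1.1 + q.2 • q.1.2) :=
    hgm.comp (by fun_prop)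
  have hj' : Measurable fun q : Pt n × Pt n => ∫⁻ t in Set.Icc (0 : ℝ) 1,
      g ((1 - t) • q.1 + t • q.2) := hj.lintegral_prod_right' (ν := volume.restrict (Set.Icc 0 1))
  have h1 : ∀ x ∈ K, ∀ y ∈ K, ‖f x - f y‖ₑ ≤
      ENNReal.ofReal d * ∫⁻ t in Set.Icc (0 : ℝ) 1, g ((1 - t) • x + t • y) := by
    intro x hx y hy
    refine (enorm_sub_le_lintegral_fderiv hf x y).trans (mul_le_mul' ?_ ?_)
    · rw [← ofReal_norm]
      refine ENNReal.ofReal_le_ofReal ?_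
      rw [← dist_eq_norm]; exact hd y hy x hx
    · refine setLIntegral_mono' measurableSet_Icc fun t ht => ?_
      rw [hg, Set.indicator_of_mem]
      exact hK hx hy (by linarith [ht.2]) ht.1 (by ring)
  -- For fixed `t`, one of `t` and `1 - t` is at least 1/2; substitution in the corresponding
  -- variable costs a factor of at most `2 ^ n`.
  have h2 : ∀ t ∈ Set.Icc (0 : ℝ) 1, ∫⁻ x in K, ∫⁻ y in K, g ((1 - t) • x + t • y) ≤
      2 ^ n * volume K * ∫⁻ x, g x := by
    have hhalf : ∀ s : ℝ, 1 / 2 ≤ s → ∀ z : Pt n,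
        ∫⁻ x in K, g (s • x + z) ≤ 2 ^ n * ∫⁻ x, g x := by
      intro s hs z
      have hs0 : 0 < s := by linarith
      refine (setLIntegral_le_lintegral _ _).trans ?_
      rw [lintegral_comp_smul_add g hs0.ne']
      gcongr
      rw [abs_of_nonneg (by positivity), ← inv_pow]
      refine ENNReal.ofReal_le_of_le_toReal ?_
      simp only [ENNReal.toReal_pow, ENNReal.toReal_ofNat]
      refine pow_le_pow_left₀ (by positivity) ?_ n
      rw [inv_le_comm₀ hs0 two_pos]; linarith
    intro t ht
    have hm : Measurable fun q : Pt n × Pt n => g ((1 - t) • q.1 + t • q.2) :=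
      hgm.comp (by fun_prop)
    have hend : ∫⁻ _ in K, 2 ^ n * ∫⁻ x, g x = 2 ^ n * volume K * ∫⁻ x, g x := by
      rw [setLIntegral_const]; ring
    rw [← hend]
    rcases le_total (1 / 2) t with h | h
    · refine lintegral_mono fun x => ?_
      simp only [add_comm ((1 - t) • x)]
      exact hhalf t h _
    · rw [lintegral_lintegral_swap hm.aemeasurable]
      exact lintegral_mono fun y => hhalf (1 - t) (by linarith) _
  calc ∫⁻ x in K, ∫⁻ y in K, ‖f x - f y‖ₑ
      ≤ ∫⁻ x in K, ∫⁻ y in K, ENNReal.ofReal d *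
          ∫⁻ t in Set.Icc (0 : ℝ) 1, g ((1 - t) • x + t • y) :=
        setLIntegral_mono' hKm fun x hx => setLIntegral_mono' hKm fun y hy => h1 x hx y hy
    _ = ENNReal.ofReal d * ∫⁻ x in K, ∫⁻ y in K,
          ∫⁻ t in Set.Icc (0 : ℝ) 1, g ((1 - t) • x + t • y) := by
        rw [← lintegral_const_mul _ hj'.lintegral_prod_right']
        refine lintegral_congr fun x => ?_
        exact lintegral_const_mul _ (hj'.comp measurable_prodMk_left)
    _ = ENNReal.ofReal d * ∫⁻ t in Set.Icc (0 : ℝ) 1, ∫⁻ x in K, ∫⁻ y in K,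
          g ((1 - t) • x + t • y) := by
        congr 1
        have e1 : ∀ x, ∫⁻ y in K, ∫⁻ t in Set.Icc (0 : ℝ) 1, g ((1 - t) • x + t • y) =
            ∫⁻ t in Set.Icc (0 : ℝ) 1, ∫⁻ y in K, g ((1 - t) • x + t • y) := fun x =>
          lintegral_lintegral_swap (Measurable.aemeasurable (hgm.comp (by fun_prop)))
        simp only [e1]
        refine lintegral_lintegral_swap (Measurable.aemeasurable ?_)
        have hj2 : Measurable fun q : (Pt n × ℝ) × Pt n =>
            g ((1 - q.1.2) • q.1.1 + q.1.2 • q.2) := hgm.comp (by fun_prop)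
        exact hj2.lintegral_prod_right' (ν := volume.restrict K)
    _ ≤ ENNReal.ofReal d * ∫⁻ _ in Set.Icc (0 : ℝ) 1, 2 ^ n * volume K * ∫⁻ x, g x := by
        exact mul_le_mul' le_rfl (setLIntegral_mono' measurableSet_Icc h2)
    _ = 2 ^ n * ENNReal.ofReal d * volume K * ∫⁻ x, g x := by
        rw [setLIntegral_const, Real.volume_Icc]; simp; ring

/-- On a convex set, the mean of `|f|` is controlled by the mean over a subset and the gradient. -/
lemma volume_mul_lintegral_le {n : ℕ} {K B : Set (Pt n)} (hK : Convex ℝ K) (hKm : MeasurableSet K)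
    (hBK : B ⊆ K) {d : ℝ} (hd : ∀ x ∈ K, ∀ y ∈ K, dist x y ≤ d) {f : Pt n → ℝ}
    (hf : ContDiff ℝ 1 f) :
    volume B * ∫⁻ x in K, ‖f x‖ₑ ≤
      volume K * ((∫⁻ x in B, ‖f x‖ₑ) + 2 ^ n * ENNReal.ofReal d * ∫⁻ x in K, ‖fderiv ℝ f x‖ₑ) := by
  have hfc := hf.continuous
  have h1 : volume B * ∫⁻ x in K, ‖f x‖ₑ = ∫⁻ x in K, ∫⁻ _ in B, ‖f x‖ₑ := by
    simp only [setLIntegral_const]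
    rw [lintegral_mul_const _ hfc.enorm.measurable, mul_comm]
  rw [h1]
  calc ∫⁻ x in K, ∫⁻ _ in B, ‖f x‖ₑ
      ≤ ∫⁻ x in K, ((∫⁻ y in B, ‖f y‖ₑ) + ∫⁻ y in K, ‖f x - f y‖ₑ) := by
        refine lintegral_mono fun x => ?_
        refine le_trans ?_ (add_le_add le_rfl (lintegral_mono_set hBK))
        rw [← lintegral_add_left hfc.enorm.measurable]
        refine lintegral_mono fun y => ?_
        calc ‖f x‖ₑ = ‖f y + (f x - f y)‖ₑ := by rw [add_sub_cancel]
          _ ≤ _ := enorm_add_le _ _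
    _ ≤ volume K * (∫⁻ y in B, ‖f y‖ₑ) +
          2 ^ n * ENNReal.ofReal d * volume K * ∫⁻ x in K, ‖fderiv ℝ f x‖ₑ := by
        rw [lintegral_add_left measurable_const, setLIntegral_const, mul_comm (volume K)]
        gcongr
        exact lintegral_lintegral_sub_le hK hKm hd hf
    _ = _ := by ring

/-- `K` lies in a ball of radius `2 * h`, so its volume is comparable to that of the inscribed ball,
and the Poincaré inequality recovers the L¹ norm on `K` from the one on the ball. -/
lemma exists_convex_transfer (n : ℕ) (c : ℝ) (hc : 0 < c) :
    ∃ C : ℝ≥0, ∀ (h : ℝ), 0 < h → ∀ K : Set (Pt n), Convex ℝ K → MeasurableSet K →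
      (∀ x ∈ K, ∀ y ∈ K, dist x y ≤ 2 * h) → ∀ x₀, Metric.closedBall x₀ (c * h) ⊆ K →
      ∀ f : Pt n → ℝ, ContDiff ℝ 1 f → ∫⁻ x in K, ‖f x‖ₑ ≤
        C * ((∫⁻ x in Metric.closedBall x₀ (c * h), ‖f x‖ₑ) +
          ENNReal.ofReal h * ∫⁻ x in K, ‖fderiv ℝ f x‖ₑ) := by
  refine ⟨Real.toNNReal ((2 / c) ^ n) * 2 ^ (n + 1), fun h hh K hK hKm hd x₀ hB f hf => ?_⟩
  set vb := volume (Metric.ball (0 : Pt n) 1) with hvb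
  have hv0 : vb ≠ 0 := (Metric.measure_ball_pos volume _ one_pos).ne'
  have hvt : vb ≠ ⊤ := measure_ball_lt_top.ne
  have hch : 0 < c * h := by positivity
  have hvB : volume (Metric.closedBall x₀ (c * h)) = ENNReal.ofReal ((c * h) ^ n) * vb := by
    rw [Measure.addHaar_closedBall _ _ hch.le, finrank_euclideanSpace_fin]
  have hvK : volume K ≤ ENNReal.ofReal ((2 / c) ^ n) * volume (Metric.closedBall x₀ (c * h)) := by
    have hx₀ : x₀ ∈ K := hB (Metric.mem_closedBall_self hch.le)
    have h1 : K ⊆ Metric.closedBall x₀ (2 * h) := fun y hy => hd y hy x₀ hx₀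
    refine (measure_mono h1).trans (le_of_eq ?_)
    rw [hvB, Measure.addHaar_closedBall _ _ (by positivity), finrank_euclideanSpace_fin, ← mul_assoc,
      ← ENNReal.ofReal_mul (by positivity), ← mul_pow]
    congr 3
    field_simp
  set I := ∫⁻ x in Metric.closedBall x₀ (c * h), ‖f x‖ₑ
  set J := ∫⁻ x in K, ‖fderiv ℝ f x‖ₑ
  have h2 := volume_mul_lintegral_le hK hKm hB hd hf
  have hB0 : volume (Metric.closedBall x₀ (c * h)) ≠ 0 := by
    rw [hvB]; exact mul_ne_zero (by simpa using pow_pos hch n) hv0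
  have hBt : volume (Metric.closedBall x₀ (c * h)) ≠ ⊤ := by
    rw [hvB]; exact ENNReal.mul_ne_top ENNReal.ofReal_ne_top hvt
  rw [← ENNReal.mul_le_mul_iff_right hB0 hBt]
  refine h2.trans ?_
  have h3 : I + 2 ^ n * ENNReal.ofReal (2 * h) * J ≤ 2 ^ (n + 1) * (I + ENNReal.ofReal h * J) := by
    rw [ENNReal.ofReal_mul zero_le_two, mul_add]
    refine add_le_add ?_ (le_of_eq ?_)
    · exact le_mul_of_one_le_left' (one_le_pow₀ one_le_two)
    · rw [pow_succ]; simp; ring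
  calc _ ≤ ENNReal.ofReal ((2 / c) ^ n) * volume (Metric.closedBall x₀ (c * h)) *
        (2 ^ (n + 1) * (I + ENNReal.ofReal h * J)) := mul_le_mul' hvK h3
    _ = _ := by
      push_cast
      rw [ENNReal.ofReal]
      ring

/-! ### Estimates on patches -/

/-- The union of the elements touching `T`. -/
def starSet {n : ℕ} (𝒯 : Finset (Finset (Pt n))) (T : Finset (Pt n)) : Set (Pt n) :=
  ⋃ T' ∈ nbrs 𝒯 T, elem T'

lemma elem_subset_starSet {n : ℕ} {𝒯 : Finset (Finset (Pt n))} {T T' : Finset (Pt n)}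
    (h : T' ∈ nbrs 𝒯 T) : elem T' ⊆ starSet 𝒯 T :=
  Set.subset_biUnion_of_mem (u := elem) (s := {S | S ∈ nbrs 𝒯 T}) h

lemma exists_inverse_estimate_enorm (n r : ℕ) (hr : 1 ≤ r) (c : ℝ) (hc : 0 < c) :
    ∃ C : ℝ≥0, ∀ p : Pt n → ℝ, IsPoly r p → ∀ (x₀ : Pt n) (h : ℝ), 0 < h →
      ∀ x ∈ Metric.closedBall x₀ (2 * h), ENNReal.ofReal (h ^ n) * ‖p x‖ₑ ≤
        C * ∫⁻ y in Metric.closedBall x₀ (c * h), ‖p y‖ₑ := by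
  obtain ⟨C, hC, hest⟩ := exists_inverse_estimate n r hr c hc
  refine ⟨C.toNNReal, fun p hp x₀ h hh x hx => ?_⟩
  have h1 := (hest p hp x₀ h hh x hx).1
  have hInt : IntegrableOn p (Metric.closedBall x₀ (c * h)) :=
    hp.continuous.continuousOn.integrableOn_compact (isCompact_closedBall _ _)
  have h2 : ∫⁻ y in Metric.closedBall x₀ (c * h), ‖p y‖ₑ =
      ENNReal.ofReal (∫ y in Metric.closedBall x₀ (c * h), |p y|) :=
    (ofReal_integral_norm_eq_lintegral_enorm hInt).symm
  rw [h2, ← ofReal_norm, ← ENNReal.ofReal_mul (by positivity)]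
  change _ ≤ ENNReal.ofReal C * _
  rw [← ENNReal.ofReal_mul hC.le]
  refine ENNReal.ofReal_le_ofReal ?_
  rw [Real.norm_eq_abs]
  calc h ^ n * |p x| ≤ h ^ n * (C * (h ^ n)⁻¹ * ∫ y in Metric.closedBall x₀ (c * h), |p y|) :=
        mul_le_mul_of_nonneg_left h1 (by positivity)
    _ = _ := by field_simp

-- The union of two adjacent elements need not be convex. The ball centred on their common facet
-- bridges them: it is convex, lies in the union and contains a smaller ball from each element. The
-- convex estimate applies once from `T` to this ball and once more from there to `T'`, whence the
-- constant `C * C + C`.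
open Classical in
lemma exists_facet_transfer (n : ℕ) (hn : 1 ≤ n) (c : ℝ) (hc : 0 < c) :
    ∃ C : ℝ≥0, ∀ {h : ℝ} {Ω : Set (Pt n)} {𝒯 : Finset (Finset (Pt n))}, IsMesh c h Ω 𝒯 →
      ∀ T ∈ 𝒯, ∀ T' ∈ 𝒯, (T ∩ T').card = n → ∀ A : Set (Pt n), elem T ⊆ A → elem T' ⊆ A →
      ∀ f : Pt n → ℝ, ContDiff ℝ 1 f → ∫⁻ x in elem T', ‖f x‖ₑ ≤
        C * ((∫⁻ x in elem T, ‖f x‖ₑ) + ENNReal.ofReal h * ∫⁻ x in A, ‖fderiv ℝ f x‖ₑ) := by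
  have hn1 : (1 : ℝ) ≤ n := by exact_mod_cast hn
  have hn0 : (0 : ℝ) < n := by positivity
  obtain ⟨C, hC⟩ := exists_convex_transfer n (c ^ 2 / (2 * n)) (by positivity)
  refine ⟨C * C + C, fun {h Ω 𝒯} M T hT T' hT' hcard A hA hA' f hf => ?_⟩
  obtain ⟨b, x, x', hb, hx, hxb, hx', hxb'⟩ := M.exists_facet_ball hn hT hT' hcard
  have hh := M.h_pos
  have hcn : c / n ≤ 1 := by rw [div_le_one hn0]; exact M.c_le.trans hn1
  set D := ∫⁻ x in A, ‖fderiv ℝ f x‖ₑ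
  set I := ∫⁻ x in elem T, ‖f x‖ₑ
  have h1 := hC h hh (elem T') (convex_elem T') (measurableSet_elem T')
    (fun x hx y hy => (M.dist_le T' hT' x hx y hy).trans (by linarith)) x' hx' f hf
  have h2 := hC h hh (Metric.closedBall b (c / n * h)) (convex_closedBall _ _)
    measurableSet_closedBall (fun x hx y hy => by
      have := dist_triangle_right x y b
      have e1 := Metric.mem_closedBall.1 hx
      have e2 := Metric.mem_closedBall.1 hy
      nlinarith) x hxb f hf
  have h3 : ∫⁻ x in Metric.closedBall x (c ^ 2 / (2 * n) * h), ‖f x‖ₑ ≤ I := lintegral_mono_set hx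
  have h4 : ∫⁻ x in Metric.closedBall b (c / n * h), ‖fderiv ℝ f x‖ₑ ≤ D :=
    lintegral_mono_set (hb.trans (Set.union_subset hA hA'))
  have h5 : ∫⁻ x in elem T', ‖fderiv ℝ f x‖ₑ ≤ D := lintegral_mono_set hA'
  have h6 : ∫⁻ x in Metric.closedBall x' (c ^ 2 / (2 * n) * h), ‖f x‖ₑ ≤
      C * (I + ENNReal.ofReal h * D) := by
    refine (lintegral_mono_set hxb').trans (h2.trans ?_)
    gcongr
  calc _ ≤ C * (C * (I + ENNReal.ofReal h * D) + ENNReal.ofReal h * D) := by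
        refine h1.trans ?_
        gcongr
    _ ≤ C * (C * (I + ENNReal.ofReal h * D) + (I + ENNReal.ofReal h * D)) := by
        gcongr
        exact le_add_self
    _ = _ := by push_cast; ring

open Classical in
/-- A quantity that grows at most by the factor `L` across facets grows at most by `L ^ m` on a
patch with `m` elements. -/
lemma IsMesh.le_pow_mul_of_facet {n : ℕ} {c h : ℝ} {Ω : Set (Pt n)} {𝒯 : Finset (Finset (Pt n))}
    (M : IsMesh c h Ω 𝒯) {T : Finset (Pt n)} (hT : T ∈ 𝒯) (e : Finset (Pt n) → ℝ≥0∞) {L : ℝ≥0∞}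
    (hL : 1 ≤ L) (he : ∀ T₁ ∈ nbrs 𝒯 T, ∀ T₂ ∈ nbrs 𝒯 T, (T₁ ∩ T₂).card = n → e T₂ ≤ L * e T₁) :
    ∀ S ∈ nbrs 𝒯 T, e S ≤ L ^ (nbrs 𝒯 T).card * e T := by
  -- `A j` collects the elements reached with the factor `L ^ j`. As long as it is not the whole
  -- patch, some facet leads out of it, so each step gains an element and the patch is exhausted
  -- after as many steps as it has elements.
  set A : ℕ → Finset (Finset (Pt n)) := fun j => (nbrs 𝒯 T).filter fun S => e S ≤ L ^ j * e T with hA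
  have hTA : ∀ j, T ∈ A j := fun j => Finset.mem_filter.2
    ⟨M.self_mem_nbrs hT, le_mul_of_one_le_left' (one_le_pow₀ hL)⟩
  have hmono : ∀ j, A j ⊆ A (j + 1) := fun j S hS => by
    obtain ⟨h1, h2⟩ := Finset.mem_filter.1 hS
    refine Finset.mem_filter.2 ⟨h1, h2.trans ?_⟩
    gcongr
    omega
  have hcard : ∀ j, j + 1 ≤ (A j).card ∨ A j = nbrs 𝒯 T := by
    intro j
    induction j with
    | zero => exact Or.inl (Finset.card_pos.2 ⟨T, hTA 0⟩)
    | succ j ih =>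
      by_cases hj : A j = nbrs 𝒯 T
      · exact Or.inr (Finset.Subset.antisymm (Finset.filter_subset _ _) (hj ▸ hmono j))
      · obtain ⟨T₁, hT₁, T₂, hT₂, hT₂A, hf⟩ := M.exists_facet_pair hT (hTA j)
          (Finset.filter_subset _ _ |>.ssubset_of_ne hj)
        have h1 := ih.resolve_right hj
        obtain ⟨h2, h3⟩ := Finset.mem_filter.1 hT₁
        have h4 : T₂ ∈ A (j + 1) := Finset.mem_filter.2 ⟨hT₂, by
          calc e T₂ ≤ L * e T₁ := he T₁ h2 T₂ hT₂ hf
            _ ≤ L * (L ^ j * e T) := by gcongr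
            _ = L ^ (j + 1) * e T := by ring⟩
        refine Or.inl (Nat.succ_le_of_lt (lt_of_le_of_lt h1 (Finset.card_lt_card ⟨hmono j, fun hs => ?_⟩)))
        exact hT₂A (hs h4)
  intro S hS
  rcases hcard (nbrs 𝒯 T).card with h1 | h1
  · have := Finset.card_le_card (Finset.filter_subset (fun S => e S ≤ L ^ (nbrs 𝒯 T).card * e T) (nbrs 𝒯 T))
    simp only [hA] at h1
    omega
  · rw [← h1] at hS
    exact (Finset.mem_filter.1 hS).2

/-- Adding the gradient term to the transported quantity makes the facet estimate purely
multiplicative, ready for iteration through the connected patch. The number of elements of a patch,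
and with it the power, is bounded in terms of `c`. -/
lemma exists_patch_transfer (n : ℕ) (hn : 1 ≤ n) (c : ℝ) (hc : 0 < c) :
    ∃ C : ℝ≥0, ∀ {h : ℝ} {Ω : Set (Pt n)} {𝒯 : Finset (Finset (Pt n))}, IsMesh c h Ω 𝒯 →
      ∀ T ∈ 𝒯, ∀ S ∈ nbrs 𝒯 T, ∀ f : Pt n → ℝ, ContDiff ℝ 1 f → ∫⁻ x in elem S, ‖f x‖ₑ ≤
        C * ((∫⁻ x in elem T, ‖f x‖ₑ) +
          ENNReal.ofReal h * ∫⁻ x in starSet 𝒯 T, ‖fderiv ℝ f x‖ₑ) := by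
  classical
  obtain ⟨C, hC⟩ := exists_facet_transfer n hn c hc
  refine ⟨(C + 1) ^ ⌊(2 / c) ^ n⌋₊, fun {h Ω 𝒯} M T hT S hS f hf => ?_⟩
  set D := ENNReal.ofReal h * ∫⁻ x in starSet 𝒯 T, ‖fderiv ℝ f x‖ₑ
  have hL : (1 : ℝ≥0∞) ≤ C + 1 := le_add_self
  have h1 := M.le_pow_mul_of_facet hT (fun S => (∫⁻ x in elem S, ‖f x‖ₑ) + D) hL
    (fun T₁ h1 T₂ h2 hcard => ?_) S hS
  · refine le_self_add.trans (h1.trans ?_)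
    push_cast
    have hcard : (nbrs 𝒯 T).card ≤ ⌊(2 / c) ^ n⌋₊ := Nat.le_floor (M.card_nbrs_le hT)
    gcongr
  · have h3 := hC M T₁ (IsMesh.mem_nbrs.1 h1).1 T₂ (IsMesh.mem_nbrs.1 h2).1 hcard
      (starSet 𝒯 T) (elem_subset_starSet h1) (elem_subset_starSet h2) f hf
    calc (∫⁻ x in elem T₂, ‖f x‖ₑ) + D ≤ C * ((∫⁻ x in elem T₁, ‖f x‖ₑ) + D) + D := by gcongr
      _ ≤ C * ((∫⁻ x in elem T₁, ‖f x‖ₑ) + D) + ((∫⁻ x in elem T₁, ‖f x‖ₑ) + D) := by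
          gcongr
          exact le_add_self
      _ = _ := by ring

lemma enorm_sub_translate_le {n : ℕ} {f : Pt n → ℝ} (hf : ContDiff ℝ 1 f) (y d : Pt n) {l : ℝ}
    (hl : 0 ≤ l) :
    ‖f y - f (y - l • d)‖ₑ ≤ ‖d‖ₑ * ∫⁻ s in Set.Icc (0 : ℝ) l, ‖fderiv ℝ f (y - s • d)‖ₑ := by
  have hpath : ∀ t : ℝ, HasDerivAt (fun t : ℝ => y - t • d) (-d) t := fun t => by
    simpa using ((hasDerivAt_id t).smul_const d).const_sub y
  have hder : ∀ t : ℝ, HasDerivAt (fun t : ℝ => f (y - t • d)) (fderiv ℝ f (y - t • d) (-d)) t :=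
    fun t => ((hf.differentiable (by simp)) _).hasFDerivAt.comp_hasDerivAt t (hpath t)
  have hc : Continuous fun t : ℝ => fderiv ℝ f (y - t • d) :=
    (hf.continuous_fderiv (by simp)).comp (by fun_prop)
  have h2 := intervalIntegral.integral_eq_sub_of_hasDerivAt (a := 0) (b := l) (fun t _ => hder t)
    ((hc.clm_apply continuous_const).intervalIntegrable 0 l)
  simp only [zero_smul, sub_zero] at h2
  rw [enorm_sub_rev, ← h2, intervalIntegral.integral_of_le hl, ← integral_Icc_eq_integral_Ioc]
  refine (enorm_integral_le_lintegral_enorm _).trans ?_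
  rw [← lintegral_const_mul _ hc.enorm.measurable]
  refine lintegral_mono fun t => ?_
  rw [mul_comm, ← enorm_neg d]
  exact (fderiv ℝ f (y - t • d)).le_opENorm (-d)

open Classical in
/-- If `f` agrees on a facet with the affine function `-q`, the vertex values of `q` on this facet
are controlled by `f` on the element. -/
lemma exists_facet_trace (n : ℕ) (hn : 1 ≤ n) (c : ℝ) (hc : 0 < c) :
    ∃ C : ℝ≥0, ∀ {h : ℝ} {Ω : Set (Pt n)} {𝒯 : Finset (Finset (Pt n))}, IsMesh c h Ω 𝒯 →
      ∀ T ∈ 𝒯, ∀ a ∈ T, ∀ z ∈ T.erase a, ∀ f : Pt n → ℝ, ContDiff ℝ 1 f → ∀ q : Pt n →ᵃ[ℝ] ℝ,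
      (∀ x ∈ convexHull ℝ ((T.erase a : Finset (Pt n)) : Set (Pt n)), f x = -q x) →
      ENNReal.ofReal (h ^ n) * ‖q z‖ₑ ≤ C * ((∫⁻ x in elem T, ‖f x‖ₑ) +
        ENNReal.ofReal h * ∫⁻ x in elem T, ‖fderiv ℝ f x‖ₑ) := by
  have hn1 : (1 : ℝ) ≤ n := by exact_mod_cast hn
  have hn0 : (0 : ℝ) < n := by positivity
  obtain ⟨C, hC⟩ := exists_inverse_estimate_enorm n 1 le_rfl (c ^ 2 / (4 * n)) (by positivity)
  refine ⟨C, fun {h Ω 𝒯} M T hT a ha z hz f hf q hq => ?_⟩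
  have hh := M.h_pos
  have hc1 := M.c_le
  have hch := mul_pos hc hh
  have hs := M.simplex hT
  have hF : T.erase a ⊆ T := Finset.erase_subset _ _
  have hcard : (T.erase a).card = n := by rw [Finset.card_erase_of_mem ha, hs.1]; omega
  set b := facetCenter (T.erase a) with hb
  have hbT : b ∈ elem T := M.facetCenter_mem hn hT hF hcard
  have hbb : ∀ v, bary T v b = if v ∈ T.erase a then (n : ℝ)⁻¹ else 0 :=
    bary_facetCenter hn hs hF hcard
  -- `ℓ = bary T a` grows by 1 along `d`, so `y - ℓ y • d` is the projection of `y` along `d` onto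
  -- the plane of the facet.
  set d := a - b with hd
  have hdn : ‖d‖ ≤ h := by rw [hd, ← dist_eq_norm]; exact M.dist_le T hT a (subset_elem T ha) b hbT
  have hla : (bary T a).linear d = 1 := by
    rw [hd, ← bary_sub, bary_vertex hs ha ha, hbb]; simp
  have hlv : ∀ v ∈ T.erase a, (bary T v).linear d = -(n : ℝ)⁻¹ := fun v hv => by
    rw [hd, ← bary_sub, bary_vertex hs (hF hv) ha, hbb, if_pos hv,
      if_neg (Finset.ne_of_mem_erase hv), zero_sub]
  set ℓ := bary T a with hℓ
  -- At `y₀` the coordinate of `a` is `1 / 4` and the others are `3 / (4 n)`. On the ball of radius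
  -- `s` they change by at most `1 / (4 n)`, so `0 ≤ ℓ ≤ 1 / 2` there and the projection hits the
  -- facet itself.
  set y₀ := b + (1 / 4 : ℝ) • d with hy₀
  set s := c ^ 2 / (4 * n) * h with hsdef
  have hs0 : 0 < s := by positivity
  set B := Metric.closedBall y₀ s with hB
  have hscn : s / (c * h) * (4 * n) = c := by rw [hsdef]; field_simp
  have hs4 : s / (c * h) ≤ 1 / 4 := by
    have : 0 < s / (c * h) := by positivity
    nlinarith
  have hs4n : s / (c * h) ≤ (1 / 4) * (n : ℝ)⁻¹ := by
    rw [← div_eq_mul_inv, le_div_iff₀ hn0]; linarith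
  have hbary : ∀ y ∈ B, ∀ v, |bary T v y - (bary T v b + 1 / 4 * (bary T v).linear d)| ≤ s / (c * h) := by
    intro y hy v
    have h1 := M.abs_bary_sub_le hT v y y₀
    rw [hy₀, bary_add, map_smul, smul_eq_mul] at h1
    exact h1.trans (div_le_div_of_nonneg_right hy hch.le)
  have hℓy : ∀ y ∈ B, 0 ≤ ℓ y ∧ ℓ y ≤ 1 / 2 := by
    intro y hy
    have h1 := hbary y hy a
    rw [hla, hbb, if_neg (Finset.notMem_erase a T)] at h1
    have := abs_le.1 h1
    constructor <;> linarith
  have hvy : ∀ y ∈ B, ∀ v ∈ T.erase a, 1 / 2 * (n : ℝ)⁻¹ ≤ bary T v y := by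
    intro y hy v hv
    have h1 := hbary y hy v
    rw [hlv v hv, hbb, if_pos hv] at h1
    have := abs_le.1 h1
    linarith
  have hyT : ∀ y ∈ B, y ∈ elem T := fun y hy => (mem_elem_iff hs).2 fun v => by
    by_cases hv : v ∈ T
    · by_cases hva : v = a
      · rw [hva]; exact (hℓy y hy).1
      · have := hvy y hy v (Finset.mem_erase.2 ⟨hva, hv⟩)
        have : 0 < (n : ℝ)⁻¹ := by positivity
        linarith
    · rw [bary_of_notMem hv]
  have hproj : ∀ y ∈ B, y - ℓ y • d ∈ convexHull ℝ ((T.erase a : Finset (Pt n)) : Set (Pt n)) := by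
    intro y hy
    have hval : ∀ v, bary T v (y - ℓ y • d) = bary T v y - ℓ y * (bary T v).linear d := fun v => by
      rw [sub_eq_add_neg, bary_add, map_neg, map_smul, smul_eq_mul, sub_eq_add_neg]
    have h0 : bary T a (y - ℓ y • d) = 0 := by rw [hval, hla]; simp [hℓ]
    refine mem_face_of_bary_eq_zero hs hF ((mem_elem_iff hs).2 fun v => ?_) fun v hv hvn => ?_
    · by_cases hv : v ∈ T
      · by_cases hva : v = a
        · rw [hva, h0]
        · have hvF := Finset.mem_erase.2 ⟨hva, hv⟩
          have e1 := hvy y hy v hvF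
          have e2 := (hℓy y hy).1
          have e3 : 0 < (n : ℝ)⁻¹ := by positivity
          rw [hval, hlv v hvF]
          nlinarith
      · rw [bary_of_notMem hv]
    · have : v = a := by by_contra hne; exact hvn (Finset.mem_erase.2 ⟨hne, hv⟩)
      rw [this, h0]
  set g : Pt n → ℝ≥0∞ := (elem T).indicator fun x => ‖fderiv ℝ f x‖ₑ with hg
  have hgm : Measurable g :=
    (hf.continuous_fderiv (by simp)).enorm.measurable.indicator (measurableSet_elem T)
  have hgi : ∫⁻ x, g x = ∫⁻ x in elem T, ‖fderiv ℝ f x‖ₑ :=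
    lintegral_indicator (measurableSet_elem T) _
  have hpt : ∀ y ∈ B, ‖q (y - ℓ y • d)‖ₑ ≤
      ‖f y‖ₑ + ENNReal.ofReal h * ∫⁻ t in Set.Icc (0 : ℝ) 1, g (y - t • d) := by
    intro y hy
    have h1 : q (y - ℓ y • d) = -f y + (f y - f (y - ℓ y • d)) := by
      rw [hq _ (hproj y hy)]; ring
    rw [h1]
    refine (enorm_add_le _ _).trans ?_
    rw [enorm_neg]
    refine add_le_add le_rfl ((enorm_sub_translate_le hf y d (hℓy y hy).1).trans (mul_le_mul' ?_ ?_))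
    · rw [← ofReal_norm]; exact ENNReal.ofReal_le_ofReal hdn
    · calc _ ≤ ∫⁻ t in Set.Icc (0 : ℝ) (ℓ y), g (y - t • d) := by
            refine setLIntegral_mono' measurableSet_Icc fun t ht => ?_
            rw [hg, Set.indicator_of_mem]
            have hconv : y - t • d ∈ segment ℝ y (y - ℓ y • d) := by
              rcases (hℓy y hy).1.eq_or_lt with h0 | h0
              · have : t = 0 := le_antisymm (h0 ▸ ht.2) ht.1
                rw [this, zero_smul, sub_zero]; exact left_mem_segment ℝ _ _
              · refine ⟨1 - t / ℓ y, t / ℓ y, ?_, ?_, by ring, ?_⟩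
                · rw [sub_nonneg, div_le_one h0]; exact ht.2
                · exact div_nonneg ht.1 h0.le
                · rw [smul_sub, smul_smul, div_mul_cancel₀ _ h0.ne', sub_smul, one_smul]; abel
            exact (convex_elem T).segment_subset (hyT y hy)
              (convexHull_mono (by simp) (hproj y hy)) hconv
        _ ≤ _ := lintegral_mono_set (Set.Icc_subset_Icc le_rfl ((hℓy y hy).2.trans (by norm_num)))
  have hval : ∀ y, q (y - ℓ y • d) = q y - ℓ y * q.linear d := fun y => by
    have := q.map_vadd y (-(ℓ y • d))
    rw [vadd_eq_add, vadd_eq_add, map_neg, map_smul, smul_eq_mul, neg_add_eq_sub, neg_add_eq_sub] at this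
    exact this
  -- The composition of `q` with the projection is again affine and takes the value `q z` at `z`,
  -- where `ℓ` vanishes. The inverse estimate thus bounds `q z` by integrals over `B` of values of
  -- `q` on the facet, where `q = -f`.
  have hpoly : IsPoly 1 fun y => q (y - ℓ y • d) := by
    simp only [hval]
    refine (IsPoly.affine q).sub ?_
    simpa only [mul_comm] using (isPoly_bary T a).const_mul (q.linear d)
  have hzT : z ∈ elem T := subset_elem T (hF hz)
  have hy₀T : y₀ ∈ elem T := hyT y₀ (Metric.mem_closedBall_self hs0.le)
  have h1 := hC _ hpoly y₀ h hh z (by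
    rw [Metric.mem_closedBall]; linarith [M.dist_le T hT z hzT y₀ hy₀T])
  have hℓz : ℓ z = 0 := by
    rw [hℓ, bary_vertex hs ha (hF hz), if_neg (Finset.ne_of_mem_erase hz).symm]
  simp only [hℓz, zero_smul, sub_zero] at h1
  refine h1.trans ?_
  refine mul_le_mul' le_rfl ?_
  calc ∫⁻ y in B, ‖q (y - ℓ y • d)‖ₑ
      ≤ ∫⁻ y in B, (‖f y‖ₑ + ENNReal.ofReal h * ∫⁻ t in Set.Icc (0 : ℝ) 1, g (y - t • d)) :=
        setLIntegral_mono' measurableSet_closedBall hpt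
    _ ≤ (∫⁻ y in B, ‖f y‖ₑ) + ENNReal.ofReal h * ∫⁻ y, ∫⁻ t in Set.Icc (0 : ℝ) 1, g (y - t • d) := by
        have hm : Measurable fun q : Pt n × ℝ => g (q.1 - q.2 • d) := hgm.comp (by fun_prop)
        rw [lintegral_add_left hf.continuous.enorm.measurable, lintegral_const_mul _
          (hm.lintegral_prod_right' (ν := volume.restrict (Set.Icc (0 : ℝ) 1)))]
        gcongr
        exact Measure.restrict_le_self
    _ ≤ _ := by
        refine add_le_add (lintegral_mono_set hyT) ?_
        have hm : Measurable fun q : Pt n × ℝ => g (q.1 - q.2 • d) := hgm.comp (by fun_prop)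
        rw [lintegral_lintegral_swap hm.aemeasurable]
        simp only [lintegral_sub_right_eq_self, hgi]
        rw [setLIntegral_const, Real.volume_Icc]
        simp

/-! ### A quasi-interpolation operator -/

section Nodal

variable {n : ℕ}

/-- A functional on `L¹(T)` that takes the value `q z` at every affine function `q`. -/
def nodal (T : Finset (Pt n)) (z : Pt n) (v : Pt n → ℝ) : ℝ :=
  (volume.real (elem T))⁻¹ *
    (2 ^ (n + 1) * (∫ x in {x | (2 : ℝ) • x - z ∈ elem T}, v x) - ∫ x in elem T, v x)

lemma halfSet_subset {T : Finset (Pt n)} {z : Pt n} (hz : z ∈ elem T) :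
    {x | (2 : ℝ) • x - z ∈ elem T} ⊆ elem T := by
  intro x hx
  have h1 := convex_elem T hx hz (by norm_num : (0 : ℝ) ≤ 1 / 2) (by norm_num : (0 : ℝ) ≤ 1 / 2)
    (by norm_num)
  have h2 : (1 / 2 : ℝ) • ((2 : ℝ) • x - z) + (1 / 2 : ℝ) • z = x := by
    rw [smul_sub, smul_smul]; norm_num
  rwa [h2] at h1

lemma nodal_sub {T : Finset (Pt n)} {z : Pt n} (hz : z ∈ elem T) {v w : Pt n → ℝ}
    (hv : IntegrableOn v (elem T)) (hw : IntegrableOn w (elem T)) :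
    nodal T z (fun x => v x - w x) = nodal T z v - nodal T z w := by
  unfold nodal
  rw [integral_sub hv hw, integral_sub (hv.mono_set (halfSet_subset hz))
    (hw.mono_set (halfSet_subset hz))]
  ring

lemma setIntegral_halfSet (T : Finset (Pt n)) (z : Pt n) (v : Pt n → ℝ) :
    ∫ x in {x | (2 : ℝ) • x - z ∈ elem T}, v x =
      (2 ^ n)⁻¹ * ∫ x in elem T, v ((1 / 2 : ℝ) • (x + z)) := by
  have hm : MeasurableSet {x : Pt n | (2 : ℝ) • x - z ∈ elem T} :=
    (measurableSet_elem T).preimage (by fun_prop : Measurable fun x : Pt n => (2 : ℝ) • x - z)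
  rw [← integral_indicator hm, ← integral_indicator (measurableSet_elem T)]
  set F : Pt n → ℝ := (elem T).indicator fun x => v ((1 / 2 : ℝ) • (x + z)) with hF
  have h1 : (fun x => {x : Pt n | (2 : ℝ) • x - z ∈ elem T}.indicator v x) =
      fun x => F ((2 : ℝ) • x - z) := by
    ext x
    by_cases hx : (2 : ℝ) • x - z ∈ elem T
    · rw [Set.indicator_of_mem (by exact hx), hF, Set.indicator_of_mem hx]
      congr 1
      rw [sub_add_cancel, smul_smul]; norm_num
    · rw [Set.indicator_of_notMem (by exact hx), hF, Set.indicator_of_notMem hx]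
  rw [h1]
  have h2 := Measure.integral_comp_smul_of_nonneg (volume : Measure (Pt n)) (fun x => F (x - z)) 2
    (hR := zero_le_two)
  rw [h2, integral_sub_right_eq_self F z, finrank_euclideanSpace_fin, smul_eq_mul]

/-- The half set is the image of `T` under the contraction by 1/2 towards `z`, of volume `2 ^ (-n)`
times that of `T`. The mean of an affine `q` over it is the average of `q z` and the mean over `T`;
twice the former mean minus the latter is `q z`. -/
lemma nodal_affine {T : Finset (Pt n)} (hT : IsSimplex T) (z : Pt n) (q : Pt n →ᵃ[ℝ] ℝ) :
    nodal T z q = q z := by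
  have hc : Continuous q := q.continuous_of_finiteDimensional
  have hInt : ∀ f : Pt n → ℝ, Continuous f → IntegrableOn f (elem T) := fun f hf =>
    hf.continuousOn.integrableOn_compact (isCompact_elem T)
  have hv0 : volume.real (elem T) ≠ 0 := by
    refine (ENNReal.toReal_pos ?_ (isCompact_elem T).measure_lt_top.ne).ne'
    exact (Measure.measure_pos_of_nonempty_interior _ hT.interior_nonempty).ne'
  have hq : ∀ x, q ((1 / 2 : ℝ) • (x + z)) = (1 / 2) * q x + (1 / 2) * q z := fun x => by
    have h1 : ∀ y, q y = q.linear y + q 0 := fun y => congrFun q.decomp y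
    rw [h1, h1 x, h1 z, map_smul, map_add, smul_eq_mul]; ring
  rw [nodal, setIntegral_halfSet]
  simp only [hq]
  rw [integral_add ((hInt _ hc).const_mul _) (hInt _ continuous_const), integral_const_mul,
    setIntegral_const, smul_eq_mul]
  field_simp
  ring

/-- The gradient of a barycentric coordinate. -/
def baryGrad (T : Finset (Pt n)) (v : Pt n) : Pt n →L[ℝ] ℝ :=
  (bary T v).linear.toContinuousLinearMap

lemma hasFDerivAt_bary (T : Finset (Pt n)) (v x : Pt n) :
    HasFDerivAt (bary T v) (baryGrad T v) x := by
  have h1 : (bary T v : Pt n → ℝ) = fun y => baryGrad T v y + bary T v 0 :=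
    (bary T v).decomp
  rw [h1]
  exact (baryGrad T v).hasFDerivAt.add_const _

end Nodal

/-- The functional scales like a mean value, as the volume of an element is at least that of a ball
of radius `c * h`. -/
lemma exists_nodal_bound (n : ℕ) (c : ℝ) (hc : 0 < c) :
    ∃ C : ℝ≥0, ∀ {h : ℝ} {Ω : Set (Pt n)} {𝒯 : Finset (Finset (Pt n))}, IsMesh c h Ω 𝒯 →
      ∀ T ∈ 𝒯, ∀ z ∈ elem T, ∀ v : Pt n → ℝ,
      ENNReal.ofReal (h ^ n) * ‖nodal T z v‖ₑ ≤ C * ∫⁻ x in elem T, ‖v x‖ₑ := by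
  set vb := volume (Metric.ball (0 : Pt n) 1) with hvb
  have hv0 : vb ≠ 0 := (Metric.measure_ball_pos volume _ one_pos).ne'
  have hvt : vb ≠ ⊤ := measure_ball_lt_top.ne
  set C₁ : ℝ≥0∞ := (ENNReal.ofReal (c ^ n) * vb)⁻¹ with hC₁
  have hC₁' : ENNReal.ofReal (c ^ n) * vb ≠ 0 := mul_ne_zero (by simpa using pow_pos hc n) hv0
  have hC₁t : C₁ ≠ ⊤ := ENNReal.inv_ne_top.2 hC₁'
  refine ⟨C₁.toNNReal * (2 ^ (n + 1) + 1), fun {h Ω 𝒯} M T hT z hz v => ?_⟩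
  have hh := M.h_pos
  have hvol : ENNReal.ofReal (h ^ n) * (volume (elem T))⁻¹ ≤ C₁ := by
    obtain ⟨x, hx⟩ := M.ball T hT
    have h1 := measure_mono (μ := volume) hx
    rw [Measure.addHaar_closedBall _ _ (by positivity), finrank_euclideanSpace_fin, mul_pow,
      ENNReal.ofReal_mul (by positivity)] at h1
    rw [← div_eq_mul_inv]
    refine ENNReal.div_le_of_le_mul ?_
    have h2 : C₁ * (ENNReal.ofReal (c ^ n) * ENNReal.ofReal (h ^ n) * vb) = ENNReal.ofReal (h ^ n) := by
      calc _ = (C₁ * (ENNReal.ofReal (c ^ n) * vb)) * ENNReal.ofReal (h ^ n) := by ring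
        _ = _ := by
          rw [hC₁, ENNReal.inv_mul_cancel hC₁' (ENNReal.mul_ne_top ENNReal.ofReal_ne_top hvt), one_mul]
    rw [← h2]
    gcongr
  have hvol0 : volume.real (elem T) ≠ 0 := by
    refine (ENNReal.toReal_pos ?_ (isCompact_elem T).measure_lt_top.ne).ne'
    exact (Measure.measure_pos_of_nonempty_interior _ (M.simplex hT).interior_nonempty).ne'
  have hvt' : ‖(volume.real (elem T))⁻¹‖ₑ = (volume (elem T))⁻¹ := by
    rw [enorm_inv hvol0, Real.enorm_of_nonneg measureReal_nonneg,
      ofReal_measureReal (isCompact_elem T).measure_lt_top.ne]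
  set I := ∫⁻ x in elem T, ‖v x‖ₑ
  have h3 : ‖2 ^ (n + 1) * (∫ x in {x | (2 : ℝ) • x - z ∈ elem T}, v x) - ∫ x in elem T, v x‖ₑ ≤
      (2 ^ (n + 1) + 1) * I := by
    refine (enorm_sub_le).trans ?_
    rw [enorm_mul, add_mul, one_mul]
    refine add_le_add (mul_le_mul' ?_ ?_) (enorm_integral_le_lintegral_enorm _)
    · rw [enorm_pow]; gcongr
      rw [Real.enorm_eq_ofReal zero_le_two]; simp
    · exact (enorm_integral_le_lintegral_enorm _).trans (lintegral_mono_set (halfSet_subset hz))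
  rw [nodal, enorm_mul, hvt', ← mul_assoc]
  push_cast
  rw [ENNReal.coe_toNNReal hC₁t, mul_assoc C₁]
  exact mul_le_mul' hvol h3

section Interp

variable {n : ℕ}

open Classical in
/-- The vertices of a mesh. -/
def vertices (𝒯 : Finset (Finset (Pt n))) : Finset (Pt n) := 𝒯.biUnion id

open Classical in
/-- Some element with vertex `z`. -/
def elemAt (𝒯 : Finset (Finset (Pt n))) (z : Pt n) : Finset (Pt n) :=
  if h : ∃ T ∈ 𝒯, z ∈ T then h.choose else ∅

open Classical in
/-- The coefficients of the quasi-interpolant. -/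
def coef (Ω : Set (Pt n)) (𝒯 : Finset (Finset (Pt n))) (v : Pt n → ℝ) (z : Pt n) : ℝ :=
  if z ∈ Ω then nodal (elemAt 𝒯 z) z v else 0

/-- The quasi-interpolant, a continuous piecewise affine function vanishing on the boundary. -/
def interp (Ω : Set (Pt n)) (𝒯 : Finset (Finset (Pt n))) (v : Pt n → ℝ) (x : Pt n) : ℝ :=
  ∑ z ∈ vertices 𝒯, coef Ω 𝒯 v z * weight 𝒯 x z

/-- The gradient of the quasi-interpolant on `T`. -/
def interpGrad (Ω : Set (Pt n)) (𝒯 : Finset (Finset (Pt n))) (T : Finset (Pt n)) (v : Pt n → ℝ) :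
    Pt n →L[ℝ] ℝ := ∑ z ∈ T, coef Ω 𝒯 v z • baryGrad T z

variable {c h : ℝ} {Ω : Set (Pt n)} {𝒯 : Finset (Finset (Pt n))} {T : Finset (Pt n)}

lemma elemAt_spec (hT : T ∈ 𝒯) {z : Pt n} (hz : z ∈ T) : elemAt 𝒯 z ∈ 𝒯 ∧ z ∈ elemAt 𝒯 z := by
  have hex : ∃ T ∈ 𝒯, z ∈ T := ⟨T, hT, hz⟩
  rw [elemAt, dif_pos hex]
  exact hex.choose_spec

lemma elemAt_mem_nbrs (hT : T ∈ 𝒯) {z : Pt n} (hz : z ∈ T) : elemAt 𝒯 z ∈ nbrs 𝒯 T :=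
  IsMesh.mem_nbrs.2 ⟨(elemAt_spec hT hz).1, z, subset_elem T hz,
    subset_elem _ (elemAt_spec hT hz).2⟩

lemma interp_eq (M : IsMesh c h Ω 𝒯) (hT : T ∈ 𝒯) (v : Pt n → ℝ) {x : Pt n} (hx : x ∈ elem T) :
    interp Ω 𝒯 v x = ∑ z ∈ T, coef Ω 𝒯 v z * bary T z x := by
  classical
  rw [interp]
  simp only [M.tri.weight_eq hT hx]
  refine (Finset.sum_subset (fun z hz => Finset.mem_biUnion.2 ⟨T, hT, hz⟩) fun z _ hz => ?_).symm
  rw [bary_of_notMem (T := T) hz, mul_zero]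

/-- If a vertex with nonzero coordinate at `x` were in `Ω`, then `x` would be too, by
`mem_of_support_subset`. So at a point outside `Ω` only vertices with coefficient 0 contribute. -/
lemma interp_eq_zero (M : IsMesh c h Ω 𝒯) (v : Pt n → ℝ) {x : Pt n} (hx : x ∉ Ω) :
    interp Ω 𝒯 v x = 0 := by
  classical
  by_cases hcl : x ∈ closure Ω
  · obtain ⟨T, hT, hxT⟩ := M.tri.exists_mem hcl
    rw [interp_eq M hT v hxT]
    refine Finset.sum_eq_zero fun z hz => ?_
    by_contra hne
    have hb : bary T z x ≠ 0 := right_ne_zero_of_mul hne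
    have hzΩ : z ∈ Ω := by
      by_contra hzn
      exact left_ne_zero_of_mul hne (if_neg hzn)
    refine hx (M.mem_of_support_subset hT hxT (subset_elem T hz) (fun w hw => ?_) hzΩ)
    by_cases hwT : w ∈ T
    · have hwz : w ≠ z := fun h => hb (h ▸ hw)
      rw [bary_vertex (M.simplex hT) hwT hz, if_neg hwz]
    · exact bary_of_notMem hwT z
  · rw [interp]
    refine Finset.sum_eq_zero fun z _ => ?_
    rw [M.tri.weight_eq_zero hcl, mul_zero]

end Interp

lemma norm_baryGrad_le {n : ℕ} {c h : ℝ} {Ω : Set (Pt n)} {𝒯 : Finset (Finset (Pt n))}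
    {T : Finset (Pt n)} (M : IsMesh c h Ω 𝒯) (hT : T ∈ 𝒯) (v : Pt n) :
    ‖baryGrad T v‖ ≤ (c * h)⁻¹ := by
  have hch := mul_pos M.c_pos M.h_pos
  refine ContinuousLinearMap.opNorm_le_bound _ (by positivity) fun d => ?_
  have := M.abs_bary_linear_le hT v d
  rw [div_eq_inv_mul] at this
  exact this

/-- Oscillation of a smooth function around an affine function with prescribed gradient. -/
lemma exists_affine_approx {n : ℕ} {c h : ℝ} {Ω : Set (Pt n)} {𝒯 : Finset (Finset (Pt n))}
    {T : Finset (Pt n)} (M : IsMesh c h Ω 𝒯) (hT : T ∈ 𝒯) {φ : Pt n → ℝ} (hφ : ContDiff ℝ 1 φ)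
    (Q : Pt n →L[ℝ] ℝ) :
    ∃ q : Pt n →ᵃ[ℝ] ℝ, q.linear = Q.toLinearMap ∧ ∫⁻ x in elem T, ‖φ x - q x‖ₑ ≤
      2 ^ n * ENNReal.ofReal h * ∫⁻ x in elem T, ‖fderiv ℝ φ x - Q‖ₑ := by
  set f : Pt n → ℝ := fun x => φ x - Q x with hf
  have hfc : ContDiff ℝ 1 f := hφ.sub Q.contDiff
  have hfd : ∀ x, fderiv ℝ f x = fderiv ℝ φ x - Q := fun x =>
    ((hφ.differentiable (by simp) x).hasFDerivAt.sub Q.hasFDerivAt).fderiv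
  have hv0 : volume (elem T) ≠ 0 :=
    (Measure.measure_pos_of_nonempty_interior _ (M.simplex hT).interior_nonempty).ne'
  have hvt : volume (elem T) ≠ ⊤ := (isCompact_elem T).measure_lt_top.ne
  have h1 := lintegral_lintegral_sub_le (convex_elem T) (measurableSet_elem T)
    (M.dist_le T hT) hfc
  have hm : Measurable fun q : Pt n × Pt n => ‖f q.1 - f q.2‖ₑ :=
    ((hfc.continuous.comp continuous_fst).sub (hfc.continuous.comp continuous_snd)).enorm.measurable
  -- At some point `y` the inner integral is at most its average over `T`, so that the value `f y`
  -- can play the role of the mean of `f`.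
  obtain ⟨y, hy, hle⟩ := exists_le_setLAverage hv0 hvt
    (f := fun x => ∫⁻ y in elem T, ‖f x - f y‖ₑ)
    (hm.lintegral_prod_right' (ν := volume.restrict (elem T))).aemeasurable
  let q : Pt n →ᵃ[ℝ] ℝ := Q.toLinearMap.toAffineMap + AffineMap.const ℝ (Pt n) (f y)
  refine ⟨q, by simp [q], ?_⟩
  simp only [hfd] at h1
  have h2 : ∫⁻ x in elem T, ‖φ x - q x‖ₑ =
      ∫⁻ x in elem T, ‖f y - f x‖ₑ := by
    refine lintegral_congr fun x => ?_
    rw [enorm_sub_rev (f y)]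
    congr 1
    simp [hf, q]; ring
  rw [h2]
  refine hle.trans ?_
  rw [setLAverage_eq]
  refine ENNReal.div_le_of_le_mul (h1.trans (le_of_eq (by ring)))

/-- Let `q` be affine with gradient `Q` and close to `φ` on `T`, hence on the whole star by patch
transfer. It suffices to compare `q z` with the coefficient at each vertex `z` of `T`. For `z` in
`Ω` the functional `nodal` reproduces `q`, so the difference is `nodal` of `φ - q`. For `z` on the
boundary the coefficient is 0, and `φ - q = -q` on a boundary facet containing `z`, so the trace
estimate controls `q z`. -/
lemma exists_interp_estimate (n : ℕ) (hn : 1 ≤ n) (c : ℝ) (hc : 0 < c) :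
    ∃ C : ℝ≥0, ∀ {h : ℝ} {Ω : Set (Pt n)} {𝒯 : Finset (Finset (Pt n))}, IsMesh c h Ω 𝒯 →
      ∀ T ∈ 𝒯, ∀ φ : Pt n → ℝ, ContDiff ℝ 1 φ → (∀ x ∉ Ω, φ x = 0) → ∀ Q : Pt n →L[ℝ] ℝ,
      ∫⁻ x in elem T, ‖φ x - interp Ω 𝒯 φ x‖ₑ ≤
        C * (ENNReal.ofReal h * ∫⁻ x in starSet 𝒯 T, ‖fderiv ℝ φ x - Q‖ₑ) ∧
      ENNReal.ofReal (h ^ n) * ‖interpGrad Ω 𝒯 T φ - Q‖ₑ ≤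
        C * ∫⁻ x in starSet 𝒯 T, ‖fderiv ℝ φ x - Q‖ₑ := by
  classical
  obtain ⟨C₁, hC₁⟩ := exists_patch_transfer n hn c hc
  obtain ⟨C₂, hC₂⟩ := exists_facet_trace n hn c hc
  obtain ⟨C₃, hC₃⟩ := exists_nodal_bound n c hc
  set vb := volume (Metric.closedBall (0 : Pt n) 1) with hvb
  have hvt : vb ≠ ⊤ := measure_closedBall_lt_top.ne
  set K : ℝ≥0 := (C₂ + C₃) * (C₁ * (2 ^ n + 1) + 1) with hK
  refine ⟨2 ^ n + vb.toNNReal * (n + 1) * K + (n + 1) * (Real.toNNReal c⁻¹) * K,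
    fun {h Ω 𝒯} M T hT φ hφ hφ0 Q => ?_⟩
  have hh := M.h_pos
  have hs := M.simplex hT
  obtain ⟨q, hqQ, hq⟩ := exists_affine_approx M hT hφ Q
  set D := ∫⁻ x in starSet 𝒯 T, ‖fderiv ℝ φ x - Q‖ₑ with hD
  set f : Pt n → ℝ := fun x => φ x - q x with hf
  have hqd : ∀ x, HasFDerivAt q Q x := fun x => by
    have h1 : (q : Pt n → ℝ) = fun y => Q y + q 0 := by
      have h2 := q.decomp
      rw [hqQ] at h2
      exact h2
    rw [h1]; exact Q.hasFDerivAt.add_const _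
  have hqc : ContDiff ℝ 1 q := (IsPoly.affine q).contDiff
  have hfc : ContDiff ℝ 1 f := hφ.sub hqc
  have hfd : ∀ x, fderiv ℝ f x = fderiv ℝ φ x - Q := fun x =>
    ((hφ.differentiable (by simp) x).hasFDerivAt.sub (hqd x)).fderiv
  have hTs : elem T ⊆ starSet 𝒯 T := elem_subset_starSet (M.self_mem_nbrs hT)
  have hfT : ∫⁻ x in elem T, ‖f x‖ₑ ≤ 2 ^ n * (ENNReal.ofReal h * D) := by
    refine hq.trans ?_
    rw [mul_assoc]
    gcongr
    exact lintegral_mono_set hTs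
  have hfS : ∀ S ∈ nbrs 𝒯 T, ∫⁻ x in elem S, ‖f x‖ₑ ≤
      C₁ * (2 ^ n + 1) * (ENNReal.ofReal h * D) := by
    intro S hS
    have h1 := hC₁ M T hT S hS f hfc
    simp only [hfd] at h1
    refine h1.trans ?_
    rw [mul_assoc, add_mul, one_mul]
    gcongr
  have he : ∀ z ∈ T, ENNReal.ofReal (h ^ n) * ‖q z - coef Ω 𝒯 φ z‖ₑ ≤ K * (ENNReal.ofReal h * D) := by
    intro z hz
    rw [hK]
    push_cast
    by_cases hzΩ : z ∈ Ω
    · obtain ⟨hS, hzS⟩ := elemAt_spec hT hz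
      have hInt : ∀ g : Pt n → ℝ, Continuous g → IntegrableOn g (elem (elemAt 𝒯 z)) := fun g hg =>
        hg.continuousOn.integrableOn_compact (isCompact_elem _)
      have h1 : coef Ω 𝒯 φ z - q z = nodal (elemAt 𝒯 z) z f := by
        rw [coef, if_pos hzΩ, hf, nodal_sub (subset_elem _ hzS) (hInt _ hφ.continuous)
          (hInt _ hqc.continuous), nodal_affine (M.simplex hS)]
      rw [enorm_sub_rev, h1]
      refine (hC₃ M _ hS z (subset_elem _ hzS) f).trans ?_
      refine (mul_le_mul' le_rfl (hfS _ (elemAt_mem_nbrs hT hz))).trans ?_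
      rw [← mul_assoc]
      gcongr
      · exact le_add_self
      · exact le_self_add
    · rw [coef, if_neg hzΩ, sub_zero]
      obtain ⟨S, hS, a, ha, hza, hSΩ⟩ := M.exists_boundary_facet hT hz hzΩ
      have hSn : S ∈ nbrs 𝒯 T := IsMesh.mem_nbrs.2 ⟨hS, z, subset_elem T hz,
        subset_elem S (Finset.mem_of_mem_erase hza)⟩
      have h1 := hC₂ M S hS a ha z hza f hfc q (fun x hx => by
        simp only [hf]; rw [hφ0 x (hSΩ x hx), zero_sub])
      simp only [hfd] at h1
      refine h1.trans ?_
      have h2 : ∫⁻ x in elem S, ‖fderiv ℝ φ x - Q‖ₑ ≤ D :=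
        lintegral_mono_set (elem_subset_starSet hSn)
      calc _ ≤ (C₂ : ℝ≥0∞) * (C₁ * (2 ^ n + 1) * (ENNReal.ofReal h * D) + ENNReal.ofReal h * D) := by
            gcongr
            exact hfS S hSn
        _ = C₂ * (C₁ * (2 ^ n + 1) + 1) * (ENNReal.ofReal h * D) := by ring
        _ ≤ _ := by
            gcongr
            exact le_self_add
  have hsum : ENNReal.ofReal (h ^ n) * ∑ z ∈ T, ‖q z - coef Ω 𝒯 φ z‖ₑ ≤
      (n + 1) * K * (ENNReal.ofReal h * D) := by
    rw [Finset.mul_sum]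
    refine (Finset.sum_le_card_nsmul T _ _ he).trans (le_of_eq ?_)
    rw [hs.1, nsmul_eq_mul]; push_cast; ring
  constructor
  · have hpt : ∀ x ∈ elem T, ‖φ x - interp Ω 𝒯 φ x‖ₑ ≤ ‖f x‖ₑ + ∑ z ∈ T, ‖q z - coef Ω 𝒯 φ z‖ₑ := by
      intro x hx
      have h1 : φ x - interp Ω 𝒯 φ x = f x + ∑ z ∈ T, (q z - coef Ω 𝒯 φ z) * bary T z x := by
        rw [interp_eq M hT φ hx]
        simp only [hf, sub_mul, Finset.sum_sub_distrib]
        have h2 := affine_eq_sum_bary hs q x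
        simp only [mul_comm (bary T _ x)] at h2
        rw [← h2]; ring
      rw [h1]
      refine (enorm_add_le _ _).trans (add_le_add le_rfl ((enorm_sum_le _ _).trans ?_))
      refine Finset.sum_le_sum fun z _ => ?_
      rw [enorm_mul]
      refine mul_le_of_le_one_right' ?_
      rw [Real.enorm_of_nonneg ((mem_elem_iff hs).1 hx z)]
      exact ENNReal.ofReal_le_one.2 (bary_le_one hs hx z)
    have hvol : volume (elem T) ≤ ENNReal.ofReal (h ^ n) * vb := by
      obtain ⟨x, hx⟩ := hs.interior_nonempty
      have h1 : elem T ⊆ Metric.closedBall x h := fun y hy =>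
        M.dist_le T hT y hy x (interior_subset hx)
      refine (measure_mono h1).trans (le_of_eq ?_)
      rw [Measure.addHaar_closedBall' _ _ hh.le, finrank_euclideanSpace_fin]
    calc _ ≤ ∫⁻ x in elem T, (‖f x‖ₑ + ∑ z ∈ T, ‖q z - coef Ω 𝒯 φ z‖ₑ) :=
          setLIntegral_mono' (measurableSet_elem T) hpt
      _ = (∫⁻ x in elem T, ‖f x‖ₑ) + (∑ z ∈ T, ‖q z - coef Ω 𝒯 φ z‖ₑ) * volume (elem T) := by
          rw [lintegral_add_right _ measurable_const, setLIntegral_const]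
      _ ≤ 2 ^ n * (ENNReal.ofReal h * D) +
            (∑ z ∈ T, ‖q z - coef Ω 𝒯 φ z‖ₑ) * (ENNReal.ofReal (h ^ n) * vb) := by gcongr
      _ = 2 ^ n * (ENNReal.ofReal h * D) +
            vb * (ENNReal.ofReal (h ^ n) * ∑ z ∈ T, ‖q z - coef Ω 𝒯 φ z‖ₑ) := by ring
      _ ≤ 2 ^ n * (ENNReal.ofReal h * D) + vb * ((n + 1) * K * (ENNReal.ofReal h * D)) := by gcongr
      _ = (2 ^ n + vb * (n + 1) * K) * (ENNReal.ofReal h * D) := by ring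
      _ ≤ _ := by
          push_cast
          rw [ENNReal.coe_toNNReal hvt]
          exact mul_le_mul' le_self_add le_rfl
  -- `Q` is the combination of the `baryGrad T z` with the vertex values of `q`. Each of these
  -- gradients costs a factor `h⁻¹`, which cancels the `h` in the bound for the coefficients.
  · have hQ : Q = ∑ z ∈ T, q z • baryGrad T z := by
      have h1 : HasFDerivAt q (∑ z ∈ T, q z • baryGrad T z) 0 := by
        have h2 : (q : Pt n → ℝ) = fun x => ∑ z ∈ T, q z * bary T z x := by
          ext x; rw [affine_eq_sum_bary hs q x]; simp only [mul_comm]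
        have h3 : HasFDerivAt (fun x => ∑ z ∈ T, q z * bary T z x)
            (∑ z ∈ T, q z • baryGrad T z) 0 :=
          HasFDerivAt.fun_sum fun z _ => (hasFDerivAt_bary T z 0).const_mul _
        rwa [← h2] at h3
      exact (hqd 0).unique h1
    have h3 : interpGrad Ω 𝒯 T φ - Q = -∑ z ∈ T, (q z - coef Ω 𝒯 φ z) • baryGrad T z := by
      rw [interpGrad]
      conv_lhs => rw [hQ]
      rw [← Finset.sum_sub_distrib, ← Finset.sum_neg_distrib]
      refine Finset.sum_congr rfl fun z _ => ?_
      ext d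
      simp; ring
    have h4 : ∀ z, ‖baryGrad T z‖ₑ ≤ ENNReal.ofReal c⁻¹ * ENNReal.ofReal h⁻¹ := fun z => by
      rw [← ofReal_norm, ← ENNReal.ofReal_mul (by positivity), ← mul_inv]
      exact ENNReal.ofReal_le_ofReal (norm_baryGrad_le M hT z)
    have h5 : ‖interpGrad Ω 𝒯 T φ - Q‖ₑ ≤
        (∑ z ∈ T, ‖q z - coef Ω 𝒯 φ z‖ₑ) * (ENNReal.ofReal c⁻¹ * ENNReal.ofReal h⁻¹) := by
      rw [h3, enorm_neg, Finset.sum_mul]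
      have h6 := enorm_sum_le T fun z => (q z - coef Ω 𝒯 φ z) • baryGrad T z
      refine h6.trans (Finset.sum_le_sum fun z _ => ?_)
      rw [enorm_smul]
      gcongr
      exact h4 z
    have h6 : ENNReal.ofReal h⁻¹ * ENNReal.ofReal h = 1 := by
      rw [← ENNReal.ofReal_mul (by positivity), inv_mul_cancel₀ hh.ne', ENNReal.ofReal_one]
    calc _ ≤ ENNReal.ofReal (h ^ n) * ((∑ z ∈ T, ‖q z - coef Ω 𝒯 φ z‖ₑ) *
            (ENNReal.ofReal c⁻¹ * ENNReal.ofReal h⁻¹)) := by gcongr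
      _ = (ENNReal.ofReal (h ^ n) * ∑ z ∈ T, ‖q z - coef Ω 𝒯 φ z‖ₑ) *
            (ENNReal.ofReal c⁻¹ * ENNReal.ofReal h⁻¹) := by ring
      _ ≤ (n + 1) * K * (ENNReal.ofReal h * D) * (ENNReal.ofReal c⁻¹ * ENNReal.ofReal h⁻¹) := by gcongr
      _ = (n + 1) * ENNReal.ofReal c⁻¹ * K * D * (ENNReal.ofReal h⁻¹ * ENNReal.ofReal h) := by ring
      _ ≤ _ := by
          rw [h6, mul_one]
          push_cast
          gcongr
          exact le_add_self

/-! ### Integrals over the domain as sums over the elements -/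

namespace IsMesh

variable {n : ℕ} {c h : ℝ} {Ω : Set (Pt n)} {𝒯 : Finset (Finset (Pt n))} {T T' : Finset (Pt n)}

lemma isCompact_closure (M : IsMesh c h Ω 𝒯) : IsCompact (closure Ω) := by
  rw [← M.tri.cover]
  exact 𝒯.finite_toSet.isCompact_biUnion fun T _ => isCompact_elem T

/-- The boundary is a null set. -/
lemma volume_closure_diff (M : IsMesh c h Ω 𝒯) : volume (closure Ω \ Ω) = 0 := by
  refine measure_mono_null (t := ⋃ T ∈ (𝒯 : Set (Finset (Pt n))), frontier (elem T)) ?_ ?_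
  · rintro x ⟨hx, hxΩ⟩
    obtain ⟨T, hT, hxT⟩ := M.tri.exists_mem hx
    refine Set.mem_biUnion (t := fun T => frontier (elem T)) hT ?_
    rw [(isClosed_elem T).frontier_eq]
    exact ⟨hxT, fun hi => hxΩ (M.interior_elem_subset hT hi)⟩
  · rw [measure_biUnion_null_iff 𝒯.countable_toSet]
    exact fun T _ => volume_frontier_elem T

lemma restrict_closure (M : IsMesh c h Ω 𝒯) :
    volume.restrict (closure Ω) = volume.restrict Ω := by
  refine Measure.restrict_congr_set ?_
  refine (ae_eq_set).2 ⟨M.volume_closure_diff, ?_⟩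
  rw [Set.sdiff_eq_empty.2 subset_closure, measure_empty]

lemma restrict_biUnion (M : IsMesh c h Ω 𝒯) {A : Finset (Finset (Pt n))} (hA : A ⊆ 𝒯) :
    volume.restrict (⋃ T ∈ A, elem T) = ∑ T ∈ A, volume.restrict (elem T) := by
  classical
  induction A using Finset.induction_on with
  | empty => simp
  | insert S A hS ih =>
    have hA' : A ⊆ 𝒯 := (Finset.subset_insert _ _).trans hA
    rw [Finset.set_biUnion_insert, Measure.restrict_union₀, ih hA', Finset.sum_insert hS]
    · have h0 : volume (⋃ T ∈ (A : Set (Finset (Pt n))), elem S ∩ elem T) = 0 := by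
        rw [measure_biUnion_null_iff A.countable_toSet]
        exact fun T hT => M.tri.volume_inter (hA (Finset.mem_insert_self _ _)) (hA' hT)
          fun hST => hS (hST ▸ hT)
      refine measure_mono_null (fun x hx => ?_) h0
      obtain ⟨T, hT, hxT⟩ := Set.mem_iUnion₂.1 hx.2
      exact Set.mem_iUnion₂.2 ⟨T, hT, hx.1, hxT⟩
    · exact (A.measurableSet_biUnion fun T _ => measurableSet_elem T).nullMeasurableSet

lemma restrict_eq_sum (M : IsMesh c h Ω 𝒯) :
    volume.restrict Ω = ∑ T ∈ 𝒯, volume.restrict (elem T) := by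
  rw [← M.restrict_closure, ← M.tri.cover, M.restrict_biUnion (Finset.Subset.refl _)]

lemma lintegral_eq_sum (M : IsMesh c h Ω 𝒯) (f : Pt n → ℝ≥0∞) :
    ∫⁻ x in Ω, f x = ∑ T ∈ 𝒯, ∫⁻ x in elem T, f x := by
  rw [M.restrict_eq_sum, lintegral_finsetSum_measure]

lemma integrableOn_elem (M : IsMesh c h Ω 𝒯) (hT : T ∈ 𝒯) {f : Pt n → ℝ} (hf : IntegrableOn f Ω) :
    IntegrableOn f (elem T) := by
  have h1 : IntegrableOn f (closure Ω) := by rwa [IntegrableOn, M.restrict_closure]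
  exact h1.mono_set (M.tri.elem_subset_closure hT)

lemma integral_eq_sum (M : IsMesh c h Ω 𝒯) {f : Pt n → ℝ} (hf : IntegrableOn f Ω) :
    ∫ x in Ω, f x = ∑ T ∈ 𝒯, ∫ x in elem T, f x := by
  rw [M.restrict_eq_sum, integral_finsetSum_measure]
  exact fun T hT => M.integrableOn_elem hT hf

lemma starSet_subset_closure (M : IsMesh c h Ω 𝒯) : starSet 𝒯 T ⊆ closure Ω :=
  Set.iUnion₂_subset fun _ hS => M.tri.elem_subset_closure (mem_nbrs.1 hS).1

lemma setLIntegral_le (M : IsMesh c h Ω 𝒯) {A : Set (Pt n)} (hA : A ⊆ closure Ω)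
    (f : Pt n → ℝ≥0∞) : ∫⁻ x in A, f x ≤ ∫⁻ x in Ω, f x := by
  rw [← M.restrict_closure]; exact lintegral_mono_set hA

end IsMesh

/-! ### The quasi-interpolant of Sobolev functions -/

/-- `v` and `G` are limits in `L¹(Ω)` of smooth functions vanishing outside `Ω` and of their
gradients. -/
structure IsW0Limit {n : ℕ} (Ω : Set (Pt n)) (v : Pt n → ℝ) (G : Pt n → Pt n →L[ℝ] ℝ)
    (φ : ℕ → Pt n → ℝ) : Prop where
  contDiff : ∀ k, ContDiff ℝ 1 (φ k)
  eq_zero : ∀ k, ∀ x ∉ Ω, φ k x = 0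
  integrableOn : IntegrableOn v Ω
  aemeasurable : AEStronglyMeasurable G (volume.restrict Ω)
  tendsto : Tendsto (fun k => ∫⁻ x in Ω, ‖φ k x - v x‖ₑ) atTop (𝓝 0)
  tendsto_grad : Tendsto (fun k => ∫⁻ x in Ω, ‖fderiv ℝ (φ k) x - G x‖ₑ) atTop (𝓝 0)

lemma IsW0Limit.tendsto_coef {n : ℕ} {c h : ℝ} {Ω : Set (Pt n)} {𝒯 : Finset (Finset (Pt n))}
    (M : IsMesh c h Ω 𝒯) {v : Pt n → ℝ} {G : Pt n → Pt n →L[ℝ] ℝ} {φ : ℕ → Pt n → ℝ}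
    (H : IsW0Limit Ω v G φ) {T : Finset (Pt n)} (hT : T ∈ 𝒯) {z : Pt n} (hz : z ∈ T) :
    Tendsto (fun k => ‖coef Ω 𝒯 (φ k) z - coef Ω 𝒯 v z‖ₑ) atTop (𝓝 0) := by
  by_cases hzΩ : z ∈ Ω
  · obtain ⟨C, hC⟩ := exists_nodal_bound n c M.c_pos
    obtain ⟨hS, hzS⟩ := elemAt_spec hT hz
    have hhn : ENNReal.ofReal (h ^ n) ≠ 0 := by simpa using pow_pos M.h_pos n
    have h1 : ∀ k, ‖coef Ω 𝒯 (φ k) z - coef Ω 𝒯 v z‖ₑ ≤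
        (ENNReal.ofReal (h ^ n))⁻¹ * (C * ∫⁻ x in Ω, ‖φ k x - v x‖ₑ) := by
      intro k
      have h2 : coef Ω 𝒯 (φ k) z - coef Ω 𝒯 v z =
          nodal (elemAt 𝒯 z) z fun x => φ k x - v x := by
        rw [coef, coef, if_pos hzΩ, if_pos hzΩ, nodal_sub (subset_elem _ hzS)
          ((H.contDiff k).continuous.continuousOn.integrableOn_compact (isCompact_elem _))
          (M.integrableOn_elem hS H.integrableOn)]
      rw [h2, ← ENNReal.mul_le_iff_le_inv hhn ENNReal.ofReal_ne_top]
      exact (hC M _ hS z (subset_elem _ hzS) _).trans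
        (mul_le_mul' le_rfl (M.setLIntegral_le (M.tri.elem_subset_closure hS) _))
    refine tendsto_of_tendsto_of_tendsto_of_le_of_le tendsto_const_nhds ?_ (fun _ => zero_le) h1
    have h3 := ENNReal.Tendsto.const_mul (a := (ENNReal.ofReal (h ^ n))⁻¹ * C) H.tendsto
      (Or.inr (ENNReal.mul_ne_top (ENNReal.inv_ne_top.2 hhn) ENNReal.coe_ne_top))
    simpa [mul_assoc] using h3
  · simp [coef, hzΩ]

/-- The coefficients of the quasi-interpolant depend continuously on the function in L¹, so both
estimates pass to the limit with the constant for smooth functions. -/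
lemma exists_interp_estimate_of_limit (n : ℕ) (hn : 1 ≤ n) (c : ℝ) (hc : 0 < c) :
    ∃ C : ℝ≥0, ∀ {h : ℝ} {Ω : Set (Pt n)} {𝒯 : Finset (Finset (Pt n))}, IsMesh c h Ω 𝒯 →
      ∀ T ∈ 𝒯, ∀ (v : Pt n → ℝ) (G : Pt n → Pt n →L[ℝ] ℝ) (φ : ℕ → Pt n → ℝ),
      IsW0Limit Ω v G φ → ∀ Q : Pt n →L[ℝ] ℝ,
      ∫⁻ x in elem T, ‖v x - interp Ω 𝒯 v x‖ₑ ≤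
        C * (ENNReal.ofReal h * ∫⁻ x in starSet 𝒯 T, ‖G x - Q‖ₑ) ∧
      ENNReal.ofReal (h ^ n) * ‖interpGrad Ω 𝒯 T v - Q‖ₑ ≤
        C * ∫⁻ x in starSet 𝒯 T, ‖G x - Q‖ₑ := by
  obtain ⟨C, hC⟩ := exists_interp_estimate n hn c hc
  refine ⟨C, fun {h Ω 𝒯} M T hT v G φ H Q => ?_⟩
  have hs := M.simplex hT
  set D := ∫⁻ x in starSet 𝒯 T, ‖G x - Q‖ₑ with hD
  set ε : ℕ → ℝ≥0∞ := fun k => ∫⁻ x in Ω, ‖φ k x - v x‖ₑ with hε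
  set δ : ℕ → ℝ≥0∞ := fun k => ∫⁻ x in Ω, ‖fderiv ℝ (φ k) x - G x‖ₑ with hδ
  set η : ℕ → ℝ≥0∞ := fun k => ∑ z ∈ T, ‖coef Ω 𝒯 (φ k) z - coef Ω 𝒯 v z‖ₑ with hη
  have hη0 : Tendsto η atTop (𝓝 0) := by
    have := tendsto_finsetSum T fun z hz => H.tendsto_coef M hT hz
    simpa using this
  have hDk : ∀ k, ∫⁻ x in starSet 𝒯 T, ‖fderiv ℝ (φ k) x - Q‖ₑ ≤ δ k + D := by
    intro k
    have hm : AEMeasurable (fun x => ‖fderiv ℝ (φ k) x - G x‖ₑ) (volume.restrict (starSet 𝒯 T)) := by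
      have h1 : AEStronglyMeasurable G (volume.restrict (closure Ω)) := by
        rw [M.restrict_closure]; exact H.aemeasurable
      have h2 := h1.mono_measure (Measure.restrict_mono (M.starSet_subset_closure (T := T)) le_rfl)
      exact (((H.contDiff k).continuous_fderiv (by simp)).aestronglyMeasurable.sub h2).enorm
    calc _ ≤ ∫⁻ x in starSet 𝒯 T, (‖fderiv ℝ (φ k) x - G x‖ₑ + ‖G x - Q‖ₑ) := by
          refine lintegral_mono fun x => ?_
          have h3 := enorm_add_le (fderiv ℝ (φ k) x - G x) (G x - Q)
          rwa [sub_add_sub_cancel] at h3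
      _ = (∫⁻ x in starSet 𝒯 T, ‖fderiv ℝ (φ k) x - G x‖ₑ) + D := lintegral_add_left' hm _
      _ ≤ δ k + D := add_le_add (M.setLIntegral_le M.starSet_subset_closure _) le_rfl
  have hvt : volume (elem T) ≠ ⊤ := (isCompact_elem T).measure_lt_top.ne
  have hCt : (C : ℝ≥0∞) ≠ ⊤ := ENNReal.coe_ne_top
  constructor
  · have hdiff : ∀ k, ∀ x ∈ elem T, ‖interp Ω 𝒯 (φ k) x - interp Ω 𝒯 v x‖ₑ ≤ η k := by
      intro k x hx
      rw [interp_eq M hT _ hx, interp_eq M hT _ hx, ← Finset.sum_sub_distrib]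
      refine (enorm_sum_le _ _).trans (Finset.sum_le_sum fun z _ => ?_)
      rw [← sub_mul, enorm_mul]
      refine mul_le_of_le_one_right' ?_
      rw [Real.enorm_of_nonneg ((mem_elem_iff hs).1 hx z)]
      exact ENNReal.ofReal_le_one.2 (bary_le_one hs hx z)
    have hle : ∀ k, ∫⁻ x in elem T, ‖v x - interp Ω 𝒯 v x‖ₑ ≤
        ε k + C * (ENNReal.ofReal h * (δ k + D)) + η k * volume (elem T) := by
      intro k
      have hmv : AEMeasurable (fun x => ‖φ k x - v x‖ₑ) (volume.restrict (elem T)) :=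
        ((H.contDiff k).continuous.aestronglyMeasurable.sub
          (M.integrableOn_elem hT H.integrableOn).aestronglyMeasurable).enorm
      calc _ ≤ ∫⁻ x in elem T, (‖φ k x - v x‖ₑ + ‖φ k x - interp Ω 𝒯 (φ k) x‖ₑ + η k) := by
            refine setLIntegral_mono' (measurableSet_elem T) fun x hx => ?_
            have h1 : v x - interp Ω 𝒯 v x = -(φ k x - v x) + (φ k x - interp Ω 𝒯 (φ k) x) +
              (interp Ω 𝒯 (φ k) x - interp Ω 𝒯 v x) := by ring
            rw [h1]
            refine (enorm_add_le _ _).trans (add_le_add ((enorm_add_le _ _).trans ?_) (hdiff k x hx))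
            rw [enorm_neg]
        _ = (∫⁻ x in elem T, ‖φ k x - v x‖ₑ) +
              (∫⁻ x in elem T, ‖φ k x - interp Ω 𝒯 (φ k) x‖ₑ) + η k * volume (elem T) := by
            rw [lintegral_add_right _ measurable_const, setLIntegral_const, lintegral_add_left' hmv]
        _ ≤ _ := by
            refine add_le_add (add_le_add ?_ ?_) le_rfl
            · exact M.setLIntegral_le (M.tri.elem_subset_closure hT) _
            · refine (hC M T hT (φ k) (H.contDiff k) (H.eq_zero k) Q).1.trans ?_
              gcongr
              exact hDk k
    have hlim : Tendsto (fun k => ε k + C * (ENNReal.ofReal h * (δ k + D)) + η k * volume (elem T))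
        atTop (𝓝 (0 + C * (ENNReal.ofReal h * (0 + D)) + 0 * volume (elem T))) := by
      refine (H.tendsto.add ?_).add (ENNReal.Tendsto.mul_const hη0 (Or.inr hvt))
      exact ENNReal.Tendsto.const_mul (ENNReal.Tendsto.const_mul
        (H.tendsto_grad.add tendsto_const_nhds) (Or.inr ENNReal.ofReal_ne_top)) (Or.inr hCt)
    simpa using ge_of_tendsto' hlim hle
  · have hlim1 : Tendsto (fun k => interpGrad Ω 𝒯 T (φ k)) atTop (𝓝 (interpGrad Ω 𝒯 T v)) := by
      refine tendsto_finsetSum T fun z hz => Tendsto.smul_const ?_ _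
      rw [tendsto_iff_edist_tendsto_0]
      simpa [edist_eq_enorm_sub] using H.tendsto_coef M hT hz
    have hlim2 : Tendsto (fun k => ENNReal.ofReal (h ^ n) * ‖interpGrad Ω 𝒯 T (φ k) - Q‖ₑ) atTop
        (𝓝 (ENNReal.ofReal (h ^ n) * ‖interpGrad Ω 𝒯 T v - Q‖ₑ)) :=
      ENNReal.Tendsto.const_mul ((continuous_enorm.tendsto _).comp (hlim1.sub_const Q))
        (Or.inr ENNReal.ofReal_ne_top)
    have hlim3 : Tendsto (fun k => (C : ℝ≥0∞) * (δ k + D)) atTop (𝓝 (C * (0 + D))) :=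
      ENNReal.Tendsto.const_mul (H.tendsto_grad.add tendsto_const_nhds) (Or.inr hCt)
    rw [zero_add] at hlim3
    refine le_of_tendsto_of_tendsto' hlim2 hlim3 fun k => ?_
    refine (hC M T hT (φ k) (H.contDiff k) (H.eq_zero k) Q).2.trans ?_
    gcongr
    exact hDk k

/-! ### Continuous finite element functions -/

/-- A function that is Lipschitz on each set of a finite closed cover of a normed space is
Lipschitz. -/
lemma lipschitzWith_of_finite_closed_cover {E ι : Type*} [NormedAddCommGroup E] [NormedSpace ℝ E]
    {f : E → ℝ} {K : ℝ≥0} (S : Finset ι) (A : ι → Set E) (hA : ∀ i ∈ S, IsClosed (A i))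
    (hcov : ∀ x, ∃ i ∈ S, x ∈ A i) (hf : ∀ i ∈ S, LipschitzOnWith K f (A i)) :
    LipschitzWith K f := by
  have hcont : Continuous f := by
    have hlf : LocallyFinite fun i : S => A i := locallyFinite_of_finite _
    refine hlf.continuous (Set.eq_univ_of_forall fun x => ?_) (fun i => hA i i.2)
      fun i => (hf i i.2).continuousOn
    obtain ⟨i, hi, hx⟩ := hcov x
    exact Set.mem_iUnion.2 ⟨⟨i, hi⟩, hx⟩
  have key : ∀ x y, f y ≤ f x + K * ‖y - x‖ := by
    intro x y
    let l : ℝ → E := fun t => x + t • (y - x)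
    have hl : Continuous l := by fun_prop
    -- Along the segment the lower right derivative of `f` is at most `K * ‖y - x‖`: some closed
    -- piece is visited at parameters arbitrarily close to `t` from the right, and it then contains
    -- the point at `t` as well.
    have h := image_le_of_liminf_slope_right_le_deriv_boundary (f := fun t => f (l t)) (a := 0)
      (b := 1) (B := fun t => f x + K * ‖y - x‖ * t) (B' := fun _ => K * ‖y - x‖)
      (hcont.comp hl).continuousOn (by simp [l]) (by fun_prop)
      (fun t _ => by
        simpa using (((hasDerivAt_id t).const_mul (K * ‖y - x‖)).const_add (f x)).hasDerivWithinAt)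
      (fun t _ r hr => ?_) (Set.right_mem_Icc.2 zero_le_one)
    · simpa [l] using h
    · have h1 : ∃ i ∈ S, ∃ᶠ z in 𝓝[>] t, l z ∈ A i := by
        by_contra hcon
        push Not at hcon
        have h2 : ∀ᶠ z in 𝓝[>] t, ∀ i ∈ S, l z ∉ A i := by
          rw [Filter.eventually_all_finset]
          exact fun i hi => hcon i hi
        obtain ⟨z, hz⟩ := h2.exists
        obtain ⟨i, hi, hx⟩ := hcov (l z)
        exact hz i hi hx
      obtain ⟨i, hi, hfr⟩ := h1
      have ht : l t ∈ A i := by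
        rw [← (hA i hi).closure_eq, mem_closure_iff_frequently]
        exact (hl.tendsto t).frequently (hfr.filter_mono nhdsWithin_le_nhds)
      refine (hfr.and_eventually self_mem_nhdsWithin).mono fun z ⟨hz, hzt⟩ => ?_
      have hzt : t < z := hzt
      refine lt_of_le_of_lt ?_ hr
      rw [slope_def_field, div_le_iff₀ (sub_pos.2 hzt)]
      have h3 := (hf i hi).dist_le_mul _ hz _ ht
      rw [Real.dist_eq, dist_eq_norm] at h3
      have h4 : l z - l t = (z - t) • (y - x) := by simp only [l]; module
      rw [h4, norm_smul, Real.norm_of_nonneg (sub_pos.2 hzt).le] at h3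
      calc _ ≤ _ := le_abs_self _
        _ ≤ _ := h3
        _ = _ := by ring
  refine LipschitzWith.of_dist_le_mul fun x y => ?_
  rw [Real.dist_eq, dist_eq_norm, abs_le]
  have h1 := key x y
  have h2 := key y x
  rw [norm_sub_rev] at h1
  constructor <;> linarith

lemma IsPoly.exists_lipschitzOnWith {n r : ℕ} {p : Pt n → ℝ} (hp : IsPoly r p) {K : Set (Pt n)}
    (hK : IsCompact K) (hc : Convex ℝ K) : ∃ L : ℝ≥0, LipschitzOnWith L p K := by
  have h1 : Continuous fun x => fderiv ℝ p x :=
    hp.contDiff.continuous_fderiv (n := ⊤) (by simp)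
  obtain ⟨C, hC⟩ := hK.exists_bound_of_continuousOn h1.continuousOn
  refine ⟨C.toNNReal, hc.lipschitzOnWith_of_nnnorm_fderiv_le
    (fun x _ => hp.differentiable x) fun x hx => ?_⟩
  rw [← NNReal.coe_le_coe, coe_nnnorm]
  exact (hC x hx).trans (Real.le_coe_toNNReal C)

/-- Continuous piecewise polynomials of degree at most `r` vanishing outside of `Ω`. -/
def IsFE {n : ℕ} (r : ℕ) (Ω : Set (Pt n)) (𝒯 : Finset (Finset (Pt n))) (f : Pt n → ℝ) : Prop :=
  (∀ x, x ∉ Ω → f x = 0) ∧ ∀ T ∈ 𝒯, ∃ p, IsPoly r p ∧ ∀ x ∈ elem T, f x = p x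

/-- The space of all `f` with `IsFE r Ω 𝒯 f`. -/
def feSpace {n : ℕ} (r : ℕ) (Ω : Set (Pt n)) (𝒯 : Finset (Finset (Pt n))) :
    Submodule ℝ (Pt n → ℝ) where
  carrier := {f | IsFE r Ω 𝒯 f}
  zero_mem' := ⟨fun _ _ => rfl, fun _ _ => ⟨_, IsPoly.const 0, fun _ _ => rfl⟩⟩
  add_mem' := by
    rintro f g ⟨hf0, hf⟩ ⟨hg0, hg⟩
    refine ⟨fun x hx => by simp [hf0 x hx, hg0 x hx], fun T hT => ?_⟩
    obtain ⟨p, hp, hfp⟩ := hf T hT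
    obtain ⟨q, hq, hgq⟩ := hg T hT
    exact ⟨_, hp.add hq, fun x hx => by simp [hfp x hx, hgq x hx]⟩
  smul_mem' := by
    rintro c f ⟨hf0, hf⟩
    refine ⟨fun x hx => by simp [hf0 x hx], fun T hT => ?_⟩
    obtain ⟨p, hp, hfp⟩ := hf T hT
    exact ⟨_, hp.const_mul c, fun x hx => by simp [hfp x hx]⟩

section
variable {n r : ℕ} {c h : ℝ} {Ω : Set (Pt n)} {𝒯 : Finset (Finset (Pt n))} {T : Finset (Pt n)}
  {f g : Pt n → ℝ}

/-- The elements, together with the complement of `Ω` where `f` is 0, form a finite closed cover of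
the whole space. The complement is encoded as `none`. -/
lemma IsFE.exists_lipschitz (M : IsMesh c h Ω 𝒯) (hf : IsFE r Ω 𝒯 f) :
    ∃ L : ℝ≥0, LipschitzWith L f := by
  classical
  choose! p hp hfp using hf.2
  have h1 : ∀ T ∈ 𝒯, ∃ L : ℝ≥0, LipschitzOnWith L f (elem T) := fun T hT => by
    obtain ⟨L, hL⟩ := (hp T hT).exists_lipschitzOnWith (isCompact_elem T) (convex_elem T)
    refine ⟨L, fun x hx y hy => ?_⟩
    rw [hfp T hT x hx, hfp T hT y hy]
    exact hL hx hy
  choose! L hL using h1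
  refine ⟨𝒯.sup L, lipschitzWith_of_finite_closed_cover (Finset.insertNone 𝒯)
    (fun o : Option (Finset (Pt n)) => o.elim Ωᶜ elem) ?_ ?_ ?_⟩
  · intro o ho
    cases o with
    | none => exact M.isOpen.isClosed_compl
    | some T => exact isClosed_elem T
  · intro x
    by_cases hx : x ∈ closure Ω
    · obtain ⟨T, hT, hxT⟩ := M.tri.exists_mem hx
      exact ⟨some T, by simpa using hT, hxT⟩
    · exact ⟨none, by simp, fun h => hx (subset_closure h)⟩
  · intro o ho
    cases o with
    | none =>
      intro x hx y hy
      rw [hf.1 x hx, hf.1 y hy]; simp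
    | some T =>
      have hT : T ∈ 𝒯 := by simpa using ho
      exact (hL T hT).weaken (Finset.le_sup (f := L) hT)

lemma IsFE.continuous (M : IsMesh c h Ω 𝒯) (hf : IsFE r Ω 𝒯 f) : Continuous f :=
  (hf.exists_lipschitz M).choose_spec.continuous

lemma IsFE.hasCompactSupport (M : IsMesh c h Ω 𝒯) (hf : IsFE r Ω 𝒯 f) : HasCompactSupport f :=
  HasCompactSupport.intro M.isCompact_closure fun x hx => hf.1 x fun h => hx (subset_closure h)

lemma IsFE.exists_bound (M : IsMesh c h Ω 𝒯) (hf : IsFE r Ω 𝒯 f) : ∃ B, ∀ x, ‖f x‖ ≤ B :=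
  (hf.hasCompactSupport M).exists_bound_of_continuous (hf.continuous M)

lemma IsFE.integrable_mul (M : IsMesh c h Ω 𝒯) (hf : IsFE r Ω 𝒯 f) (hg : IntegrableOn g Ω) :
    IntegrableOn (fun x => g x * f x) Ω := by
  obtain ⟨B, hB⟩ := hf.exists_bound M
  exact Integrable.mul_bdd hg (hf.continuous M).aestronglyMeasurable (ae_of_all _ hB)

lemma IsFE.integrableOn (M : IsMesh c h Ω 𝒯) (hf : IsFE r Ω 𝒯 f) : IntegrableOn f Ω :=
  ((hf.continuous M).integrable_of_hasCompactSupport (hf.hasCompactSupport M)).integrableOn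

lemma IsFE.eq_zero_of_integral_sq (M : IsMesh c h Ω 𝒯) (hf : IsFE r Ω 𝒯 f)
    (h0 : ∫ x in Ω, f x * f x = 0) : f = 0 := by
  have h1 := (setIntegral_eq_zero_iff_of_nonneg_ae (ae_of_all _ fun x => mul_self_nonneg (f x))
    (hf.integrable_mul M (hf.integrableOn M))).1 h0
  have hset : ∀ x ∈ Ω, f x * f x = 0 := by
    have := Measure.eqOn_open_of_ae_eq h1 M.isOpen
      ((hf.continuous M).mul (hf.continuous M)).continuousOn continuousOn_const
    exact this
  ext x
  by_cases hx : x ∈ Ω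
  · exact mul_self_eq_zero.1 (hset x hx)
  · exact hf.1 x hx

/-- With a fixed choice `τ` of an element at each point of `Ω`, the function is determined by one
polynomial per element. -/
lemma finiteDimensional_feSpace (M : IsMesh c h Ω 𝒯) : FiniteDimensional ℝ (feSpace r Ω 𝒯) := by
  classical
  have hex : ∀ x : Pt n, ∃ T, x ∈ Ω → T ∈ 𝒯 ∧ x ∈ elem T := fun x => by
    by_cases hx : x ∈ Ω
    · obtain ⟨T, hT, hxT⟩ := M.tri.exists_mem (subset_closure hx)
      exact ⟨T, fun _ => ⟨hT, hxT⟩⟩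
    · exact ⟨∅, fun h => absurd h hx⟩
  choose τ hτ using hex
  let Φ : (𝒯 → MvPolynomial.restrictTotalDegree (Fin n) ℝ r) →ₗ[ℝ] (Pt n → ℝ) :=
    { toFun := fun P x => if hx : x ∈ Ω then
        (P ⟨τ x, (hτ x hx).1⟩ : MvPolynomial (Fin n) ℝ).eval (fun j => x j) else 0
      map_add' := fun P Q => by
        ext x; by_cases hx : x ∈ Ω <;> simp [hx]
      map_smul' := fun c P => by
        ext x; by_cases hx : x ∈ Ω <;> simp [hx] }
  have hle : feSpace r Ω 𝒯 ≤ LinearMap.range Φ := by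
    intro f hf
    choose! p hp hfp using hf.2
    choose! P hP hPp using hp
    refine ⟨fun T => ⟨P T, (MvPolynomial.mem_restrictTotalDegree _ _ _).2 (hP T T.2)⟩, ?_⟩
    ext x
    by_cases hx : x ∈ Ω
    · simp only [Φ, LinearMap.coe_mk, AddHom.coe_mk, dif_pos hx]
      rw [hfp _ (hτ x hx).1 x (hτ x hx).2, hPp _ (hτ x hx).1]
    · simp only [Φ, LinearMap.coe_mk, AddHom.coe_mk, dif_neg hx]
      exact (hf.1 x hx).symm
  exact Submodule.finiteDimensional_of_le hle

/-- The `L²`-projection of an integrable function onto the finite element space. -/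
lemma exists_fe_proj (M : IsMesh c h Ω 𝒯) (r : ℕ) (hg : IntegrableOn g Ω) :
    ∃ w, IsFE r Ω 𝒯 w ∧ ∀ ξ, IsFE r Ω 𝒯 ξ → ∫ x in Ω, w x * ξ x = ∫ x in Ω, g x * ξ x := by
  have := finiteDimensional_feSpace (r := r) M
  let A (g : Pt n → ℝ) (hg : IntegrableOn g Ω) : Module.Dual ℝ (feSpace r Ω 𝒯) :=
    { toFun := fun ξ => ∫ x in Ω, g x * (ξ : Pt n → ℝ) x
      map_add' := fun ξ η => by
        rw [← integral_add (IsFE.integrable_mul M ξ.2 hg) (IsFE.integrable_mul M η.2 hg)]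
        simp [mul_add]
      map_smul' := fun c ξ => by
        rw [RingHom.id_apply, smul_eq_mul, ← integral_const_mul]
        congr 1; ext x; simp; ring }
  let B : feSpace r Ω 𝒯 →ₗ[ℝ] Module.Dual ℝ (feSpace r Ω 𝒯) :=
    { toFun := fun w => A w (IsFE.integrableOn M w.2)
      map_add' := fun v w => by
        ext ξ
        simp only [A, LinearMap.coe_mk, AddHom.coe_mk, LinearMap.add_apply]
        rw [← integral_add (IsFE.integrable_mul M ξ.2 (IsFE.integrableOn M v.2))
          (IsFE.integrable_mul M ξ.2 (IsFE.integrableOn M w.2))]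
        simp [add_mul]
      map_smul' := fun c w => by
        ext ξ
        simp only [A, LinearMap.coe_mk, AddHom.coe_mk, LinearMap.smul_apply, RingHom.id_apply]
        rw [smul_eq_mul, ← integral_const_mul]
        congr 1; ext x; simp; ring }
  -- The Gram map is injective because the L² product is definite on continuous functions vanishing
  -- outside `Ω`. Equality of dimensions makes it onto, so the functional of a merely integrable `g`
  -- is represented.
  have hinj : Function.Injective B := by
    rw [injective_iff_map_eq_zero]
    intro w hw
    have h1 : B w w = 0 := by rw [hw]; rfl
    exact Subtype.ext (IsFE.eq_zero_of_integral_sq M w.2 h1)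
  have hsurj := (LinearMap.injective_iff_surjective_of_finrank_eq_finrank
    (Subspace.dual_finrank_eq (K := ℝ) (V := feSpace r Ω 𝒯)).symm).1 hinj
  obtain ⟨w, hw⟩ := hsurj (A g hg)
  exact ⟨w, w.2, fun ξ hξ => LinearMap.congr_fun hw ⟨ξ, hξ⟩⟩

lemma isFE_interp (M : IsMesh c h Ω 𝒯) (hr : 1 ≤ r) (v : Pt n → ℝ) :
    IsFE r Ω 𝒯 (interp Ω 𝒯 v) :=
  ⟨fun _ hx => interp_eq_zero M v hx, fun T hT =>
    ⟨_, IsPoly.sum T _ fun z _ => ((isPoly_bary T z).mono hr).const_mul (coef Ω 𝒯 v z),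
      fun _ hx => interp_eq M hT v hx⟩⟩

/-! ### Truncation of finite element functions -/

/-- The total weight at `x` of the vertices satisfying `J`. -/
def partMass (𝒯 : Finset (Finset (Pt n))) (J : Pt n → Prop) (x : Pt n) : ℝ :=
  open Classical in ∑ z ∈ vertices 𝒯 with J z, weight 𝒯 x z

/-- The sum of the vertices satisfying `J`, with weights. -/
def partPoint (𝒯 : Finset (Finset (Pt n))) (J : Pt n → Prop) (x : Pt n) : Pt n :=
  open Classical in ∑ z ∈ vertices 𝒯 with J z, weight 𝒯 x z • z

/-- A modification of `f` that vanishes on elements all of whose vertices satisfy `J` and equals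
`f` on elements none of whose vertices satisfies `J`. -/
def trunc (r : ℕ) (𝒯 : Finset (Finset (Pt n))) (J : Pt n → Prop) (f : Pt n → ℝ) (x : Pt n) : ℝ :=
  f x - partMass 𝒯 J x ^ r * f ((partMass 𝒯 J x)⁻¹ • partPoint 𝒯 J x)

open Classical in
lemma partMass_eq (M : IsMesh c h Ω 𝒯) (hT : T ∈ 𝒯) (J : Pt n → Prop) {x : Pt n}
    (hx : x ∈ elem T) : partMass 𝒯 J x = ∑ z ∈ T with J z, bary T z x := by
  rw [partMass]
  simp only [M.tri.weight_eq hT hx]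
  refine (Finset.sum_subset (Finset.filter_subset_filter _ fun z hz =>
    Finset.mem_biUnion.2 ⟨T, hT, hz⟩) fun z hz hz' => bary_of_notMem (fun h => hz' ?_) x).symm
  exact Finset.mem_filter.2 ⟨h, (Finset.mem_filter.1 hz).2⟩

open Classical in
lemma partPoint_eq (M : IsMesh c h Ω 𝒯) (hT : T ∈ 𝒯) (J : Pt n → Prop) {x : Pt n}
    (hx : x ∈ elem T) : partPoint 𝒯 J x = ∑ z ∈ T with J z, bary T z x • z := by
  rw [partPoint]
  simp only [M.tri.weight_eq hT hx]
  refine (Finset.sum_subset (Finset.filter_subset_filter _ fun z hz =>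
    Finset.mem_biUnion.2 ⟨T, hT, hz⟩) fun z hz hz' => ?_).symm
  rw [bary_of_notMem (T := T) (fun h => hz' (Finset.mem_filter.2 ⟨h, (Finset.mem_filter.1 hz).2⟩)) x,
    zero_smul]

lemma partPoint_eq_zero (M : IsMesh c h Ω 𝒯) (hT : T ∈ 𝒯) (J : Pt n → Prop) {x : Pt n}
    (hx : x ∈ elem T) (h0 : partMass 𝒯 J x = 0) : partPoint 𝒯 J x = 0 := by
  classical
  rw [partMass_eq M hT J hx,
    Finset.sum_eq_zero_iff_of_nonneg fun z _ => (mem_elem_iff (M.simplex hT)).1 hx z] at h0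
  rw [partPoint_eq M hT J hx]
  exact Finset.sum_eq_zero fun z hz => by rw [h0 z hz, zero_smul]

lemma partMass_nonneg (M : IsMesh c h Ω 𝒯) (hT : T ∈ 𝒯) (J : Pt n → Prop) {x : Pt n}
    (hx : x ∈ elem T) : 0 ≤ partMass 𝒯 J x := by
  classical
  rw [partMass_eq M hT J hx]
  exact Finset.sum_nonneg fun z _ => (mem_elem_iff (M.simplex hT)).1 hx z

lemma partMass_le_one (M : IsMesh c h Ω 𝒯) (hT : T ∈ 𝒯) (J : Pt n → Prop) {x : Pt n}
    (hx : x ∈ elem T) : partMass 𝒯 J x ≤ 1 := by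
  classical
  rw [partMass_eq M hT J hx, ← sum_bary (M.simplex hT) x]
  exact Finset.sum_le_sum_of_subset_of_nonneg (Finset.filter_subset _ _)
    fun z _ _ => (mem_elem_iff (M.simplex hT)).1 hx z

open Classical in
lemma bary_part (M : IsMesh c h Ω 𝒯) (hT : T ∈ 𝒯) (J : Pt n → Prop) {x : Pt n}
    (hx : x ∈ elem T) (h0 : partMass 𝒯 J x ≠ 0) {z : Pt n} (hz : z ∈ T) :
    bary T z ((partMass 𝒯 J x)⁻¹ • partPoint 𝒯 J x) =
      if J z then (partMass 𝒯 J x)⁻¹ * bary T z x else 0 := by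
  refine bary_unique (M.simplex hT)
    (c := fun z => if J z then (partMass 𝒯 J x)⁻¹ * bary T z x else 0) ?_ ?_ hz
  · rw [← Finset.sum_filter, ← Finset.mul_sum, ← partMass_eq M hT J hx, inv_mul_cancel₀ h0]
  · simp only [ite_smul, zero_smul]
    rw [← Finset.sum_filter, partPoint_eq M hT J hx, Finset.smul_sum]
    simp only [mul_smul]

lemma part_mem (M : IsMesh c h Ω 𝒯) (hT : T ∈ 𝒯) (J : Pt n → Prop) {x : Pt n}
    (hx : x ∈ elem T) (h0 : partMass 𝒯 J x ≠ 0) :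
    (partMass 𝒯 J x)⁻¹ • partPoint 𝒯 J x ∈ elem T := by
  classical
  rw [mem_elem_iff (M.simplex hT)]
  intro z
  by_cases hz : z ∈ T
  · rw [bary_part M hT J hx h0 hz]
    split_ifs
    · exact mul_nonneg (inv_nonneg.2 (partMass_nonneg M hT J hx))
        ((mem_elem_iff (M.simplex hT)).1 hx z)
    · exact le_rfl
  · rw [bary_of_notMem hz]

/-- On an element, `partPoint / partMass` is the projection of `x` onto the face spanned by the
vertices satisfying `J`. The factor `partMass ^ r` clears the denominators, leaving a polynomial of
degree at most `r`. Continuity across elements is automatic since the weights are globally defined.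
Outside `Ω` the value is 0: if the projected point were in `Ω`, so would be `x`. -/
lemma isFE_trunc (M : IsMesh c h Ω 𝒯) (hr : 1 ≤ r) (J : Pt n → Prop) (hf : IsFE r Ω 𝒯 f) :
    IsFE r Ω 𝒯 (trunc r 𝒯 J f) := by
  classical
  have hr0 : r ≠ 0 := by omega
  refine ⟨fun x hx => ?_, fun T hT => ?_⟩
  · rw [trunc, hf.1 x hx, zero_sub, neg_eq_zero]
    by_cases h0 : partMass 𝒯 J x = 0
    · rw [h0, zero_pow hr0, zero_mul]
    by_cases hcl : x ∈ closure Ω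
    · obtain ⟨T, hT, hxT⟩ := M.tri.exists_mem hcl
      rw [hf.1 _ fun hΩ => hx ?_, mul_zero]
      refine M.mem_of_support_subset hT hxT (part_mem M hT J hxT h0) (fun z hz => ?_) hΩ
      by_cases hzT : z ∈ T
      · rw [bary_part M hT J hxT h0 hzT, hz, mul_zero, ite_self]
      · exact bary_of_notMem hzT _
    · refine absurd ?_ h0
      rw [partMass]
      exact Finset.sum_eq_zero fun z _ => M.tri.weight_eq_zero hcl z
  · obtain ⟨p, hp, hfp⟩ := hf.2 T hT
    obtain ⟨R, hR, hR1, hR0⟩ := hp.exists_homogenize hr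
      (σ := fun x => ∑ z ∈ T with J z, bary T z x) (y := fun x => ∑ z ∈ T with J z, bary T z x • z)
      (IsPoly.sum _ _ fun z _ => isPoly_bary T z) (fun j => by
        have := IsPoly.sum (r := 1) (T.filter J) (fun z x => z j * bary T z x)
          fun z _ => (isPoly_bary T z).const_mul (z j)
        convert this using 2 with x
        simp [mul_comm])
    refine ⟨_, hp.sub hR, fun x hx => ?_⟩
    rw [trunc, hfp x hx]
    have hm := partMass_eq M hT J hx
    have hq := partPoint_eq M hT J hx
    by_cases h0 : partMass 𝒯 J x = 0
    · rw [h0, zero_pow hr0, zero_mul,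
        hR0 x (hm ▸ h0) (hq ▸ partPoint_eq_zero M hT J hx h0)]
    · rw [hR1 x (hm ▸ h0), hfp _ (part_mem M hT J hx h0), hm, hq]

lemma trunc_eq_self (M : IsMesh c h Ω 𝒯) (hr : 1 ≤ r) (hT : T ∈ 𝒯) {J : Pt n → Prop}
    (hJ : ∀ z ∈ T, ¬ J z) (f : Pt n → ℝ) {x : Pt n} (hx : x ∈ elem T) :
    trunc r 𝒯 J f x = f x := by
  classical
  have hr0 : r ≠ 0 := by omega
  rw [trunc, partMass_eq M hT J hx, Finset.filter_false_of_mem hJ]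
  simp [hr0]

lemma trunc_eq_zero (M : IsMesh c h Ω 𝒯) (hT : T ∈ 𝒯) {J : Pt n → Prop}
    (hJ : ∀ z ∈ T, J z) (f : Pt n → ℝ) {x : Pt n} (hx : x ∈ elem T) :
    trunc r 𝒯 J f x = 0 := by
  classical
  rw [trunc, partMass_eq M hT J hx, partPoint_eq M hT J hx, Finset.filter_true_of_mem hJ,
    sum_bary (M.simplex hT), sum_bary_smul (M.simplex hT)]
  simp

lemma exists_abs_trunc_le (M : IsMesh c h Ω 𝒯) (hr : 1 ≤ r) (hT : T ∈ 𝒯) (J : Pt n → Prop)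
    (f : Pt n → ℝ) {x : Pt n} (hx : x ∈ elem T) :
    ∃ y ∈ elem T, |trunc r 𝒯 J f x| ≤ |f x| + |f y| := by
  have hr0 : r ≠ 0 := by omega
  by_cases h0 : partMass 𝒯 J x = 0
  · refine ⟨x, hx, ?_⟩
    rw [trunc, h0, zero_pow hr0, zero_mul, sub_zero]
    linarith [abs_nonneg (f x)]
  · refine ⟨_, part_mem M hT J hx h0, ?_⟩
    rw [trunc]
    refine (abs_sub _ _).trans (add_le_add le_rfl ?_)
    rw [abs_mul, abs_pow, abs_of_nonneg (partMass_nonneg M hT J hx)]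
    exact mul_le_of_le_one_left (abs_nonneg _)
      (pow_le_one₀ (partMass_nonneg M hT J hx) (partMass_le_one M hT J hx))

end

/-! ### Exponential decay of the `L²`-projection -/

section
variable {n r : ℕ} {c h : ℝ} {Ω : Set (Pt n)} {𝒯 : Finset (Finset (Pt n))} {T : Finset (Pt n)}

lemma IsMesh.volume_real_elem_le (M : IsMesh c h Ω 𝒯) (hT : T ∈ 𝒯) :
    volume.real (elem T) ≤ volume.real (Metric.ball (0 : Pt n) 1) * h ^ n := by
  obtain ⟨x, hx⟩ := (M.simplex hT).interior_nonempty
  have hsub : elem T ⊆ Metric.closedBall x h := fun y hy =>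
    M.dist_le T hT y hy x (interior_subset hx)
  calc volume.real (elem T) ≤ volume.real (Metric.closedBall x h) :=
        measureReal_mono hsub measure_closedBall_lt_top.ne
    _ = _ := by
        rw [measureReal_def, Measure.addHaar_closedBall _ _ M.h_pos.le, ENNReal.toReal_mul,
          ENNReal.toReal_ofReal (by have := M.h_pos; positivity), measureReal_def, mul_comm]
        simp

/-- The Cauchy–Schwarz inequality, from integrating `2 λ |p| ≤ λ² + p²` with `λ = A / v`. -/
lemma sq_setIntegral_abs_le {K : Set (Pt n)} (hK : IsCompact K) {p : Pt n → ℝ}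
    (hp : Continuous p) {v : ℝ} (hv : volume.real K ≤ v) (hv0 : 0 < v) :
    (∫ x in K, |p x|) ^ 2 ≤ v * ∫ x in K, p x ^ 2 := by
  set A := ∫ x in K, |p x| with hA
  have h1 : ∫ x in K, (2 * (A / v) * |p x|) ≤ ∫ x in K, ((A / v) ^ 2 + p x ^ 2) := by
    refine integral_mono ?_ ?_ fun x => ?_
    · exact (continuous_const.mul hp.abs).continuousOn.integrableOn_compact hK
    · exact (continuous_const.add (hp.pow 2)).continuousOn.integrableOn_compact hK
    · have := two_mul_le_add_sq (A / v) |p x|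
      simpa [sq_abs] using this
  have hi : IntegrableOn (fun _ : Pt n => (A / v) ^ 2) K :=
    continuous_const.continuousOn.integrableOn_compact hK
  have hi2 : IntegrableOn (fun x => p x ^ 2) K := (hp.pow 2).continuousOn.integrableOn_compact hK
  rw [integral_const_mul, integral_add hi hi2,
    setIntegral_const, smul_eq_mul, ← hA] at h1
  have h2 : volume.real K * (A / v) ^ 2 ≤ v * (A / v) ^ 2 :=
    mul_le_mul_of_nonneg_right hv (sq_nonneg _)
  have h3 : v * (A / v) ^ 2 = A ^ 2 / v := by field_simp
  have h4 : 2 * (A / v) * A = 2 * (A ^ 2 / v) := by ring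
  have h5 : A ^ 2 / v ≤ ∫ x in K, p x ^ 2 := by linarith
  rwa [div_le_iff₀ hv0, mul_comm] at h5

end

lemma exists_inverse_estimate_sq (n r : ℕ) (hr : 1 ≤ r) (c : ℝ) (hc : 0 < c) :
    ∃ C : ℝ, 0 < C ∧ ∀ {h : ℝ} {Ω : Set (Pt n)} {𝒯 : Finset (Finset (Pt n))}, IsMesh c h Ω 𝒯 →
      ∀ T ∈ 𝒯, ∀ p : Pt n → ℝ, IsPoly r p → ∀ x ∈ elem T,
      p x ^ 2 ≤ C * (h ^ n)⁻¹ * ∫ y in elem T, p y ^ 2 ∧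
      ‖fderiv ℝ p x‖ ^ 2 ≤ C * (h ^ (n + 2))⁻¹ * ∫ y in elem T, p y ^ 2 := by
  obtain ⟨C, hC, hb⟩ := exists_inverse_estimate n r hr c hc
  set ω₁ := volume.real (Metric.ball (0 : Pt n) 1) with hω
  have hω0 : 0 < ω₁ := by
    rw [hω, measureReal_def]
    exact ENNReal.toReal_pos (Metric.measure_ball_pos volume _ one_pos).ne' measure_ball_lt_top.ne
  refine ⟨C ^ 2 * ω₁, by positivity, fun {h Ω 𝒯} M T hT p hp x hx => ?_⟩
  have hh := M.h_pos
  obtain ⟨x₀, hx₀⟩ := M.ball T hT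
  have hx₀T : x₀ ∈ elem T := hx₀ (Metric.mem_closedBall_self (by positivity))
  have hx2 : x ∈ Metric.closedBall x₀ (2 * h) := by
    have := M.dist_le T hT x hx x₀ hx₀T
    rw [Metric.mem_closedBall]; linarith
  obtain ⟨h1, h2⟩ := hb p hp x₀ h hh x hx2
  have hpc := hp.continuous
  have hI : ∫ y in Metric.closedBall x₀ (c * h), |p y| ≤ ∫ y in elem T, |p y| :=
    setIntegral_mono_set (hpc.abs.continuousOn.integrableOn_compact (isCompact_elem T))
      (ae_of_all _ fun y => abs_nonneg _) hx₀.eventuallyLE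
  have hI0 : 0 ≤ ∫ y in Metric.closedBall x₀ (c * h), |p y| :=
    integral_nonneg fun y => abs_nonneg _
  have hsq : (∫ y in Metric.closedBall x₀ (c * h), |p y|) ^ 2 ≤
      ω₁ * h ^ n * ∫ y in elem T, p y ^ 2 :=
    (pow_le_pow_left₀ hI0 hI 2).trans
      (sq_setIntegral_abs_le (isCompact_elem T) hpc (M.volume_real_elem_le hT) (by positivity))
  constructor
  · calc p x ^ 2 = |p x| ^ 2 := (sq_abs _).symm
      _ ≤ (C * (h ^ n)⁻¹ * ∫ y in Metric.closedBall x₀ (c * h), |p y|) ^ 2 :=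
        pow_le_pow_left₀ (abs_nonneg _) h1 2
      _ = (C * (h ^ n)⁻¹) ^ 2 * (∫ y in Metric.closedBall x₀ (c * h), |p y|) ^ 2 := by ring
      _ ≤ (C * (h ^ n)⁻¹) ^ 2 * (ω₁ * h ^ n * ∫ y in elem T, p y ^ 2) :=
        mul_le_mul_of_nonneg_left hsq (sq_nonneg _)
      _ = _ := by field_simp
  · calc ‖fderiv ℝ p x‖ ^ 2 ≤ (C * (h ^ (n + 1))⁻¹ *
          ∫ y in Metric.closedBall x₀ (c * h), |p y|) ^ 2 :=
        pow_le_pow_left₀ (norm_nonneg _) h2 2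
      _ = (C * (h ^ (n + 1))⁻¹) ^ 2 * (∫ y in Metric.closedBall x₀ (c * h), |p y|) ^ 2 := by ring
      _ ≤ (C * (h ^ (n + 1))⁻¹) ^ 2 * (ω₁ * h ^ n * ∫ y in elem T, p y ^ 2) :=
        mul_le_mul_of_nonneg_left hsq (sq_nonneg _)
      _ = _ := by field_simp; ring

/-- The elements reaching out to distance `k * h` from `x₀`. -/
def farElems {n : ℕ} (𝒯 : Finset (Finset (Pt n))) (h : ℝ) (x₀ : Pt n) (k : ℕ) :
    Finset (Finset (Pt n)) :=
  open Classical in 𝒯.filter fun T => ∃ x ∈ elem T, k * h ≤ dist x x₀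

section
variable {n r : ℕ} {c h : ℝ} {Ω : Set (Pt n)} {𝒯 : Finset (Finset (Pt n))} {T : Finset (Pt n)}

lemma mem_farElems {x₀ : Pt n} {k : ℕ} :
    T ∈ farElems 𝒯 h x₀ k ↔ T ∈ 𝒯 ∧ ∃ x ∈ elem T, k * h ≤ dist x x₀ := by
  classical
  simp [farElems]

lemma farElems_subset {x₀ : Pt n} {k : ℕ} : farElems 𝒯 h x₀ k ⊆ 𝒯 := fun _ hT =>
  (mem_farElems.1 hT).1

lemma farElems_succ_subset (hh : 0 ≤ h) {x₀ : Pt n} {k : ℕ} :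
    farElems 𝒯 h x₀ (k + 1) ⊆ farElems 𝒯 h x₀ k := fun T hT => by
  obtain ⟨h1, x, hx, hd⟩ := mem_farElems.1 hT
  refine mem_farElems.2 ⟨h1, x, hx, le_trans ?_ hd⟩
  push_cast
  nlinarith

/-- Decay of the energy of a finite element function with local data. -/
lemma sum_farElems_le {C : ℝ} (M : IsMesh c h Ω 𝒯) (hr : 1 ≤ r)
    (hC : ∀ T ∈ 𝒯, ∀ p : Pt n → ℝ, IsPoly r p → ∀ x ∈ elem T,
      p x ^ 2 ≤ C * (h ^ n)⁻¹ * ∫ y in elem T, p y ^ 2)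
    {w g : Pt n → ℝ} (hw : IsFE r Ω 𝒯 w) {T₀ : Finset (Pt n)} (hT₀ : T₀ ∈ 𝒯)
    (hwg : ∀ ξ, IsFE r Ω 𝒯 ξ → ∫ x in Ω, w x * ξ x = ∫ x in elem T₀, g x * ξ x)
    {x₀ : Pt n} (hx₀ : x₀ ∈ elem T₀) {k : ℕ} (hk : 2 ≤ k) :
    ∑ T ∈ farElems 𝒯 h x₀ (k + 1), ∫ x in elem T, w x ^ 2 ≤
      2 * C * volume.real (Metric.ball (0 : Pt n) 1) *
        (∑ T ∈ farElems 𝒯 h x₀ k, (∫ x in elem T, w x ^ 2) -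
          ∑ T ∈ farElems 𝒯 h x₀ (k + 1), ∫ x in elem T, w x ^ 2) := by
  classical
  have hh := M.h_pos
  have hwc := hw.continuous M
  -- With this `J` the truncation `χ` of `w` equals `w` on the elements of the set with index `k +
  -- 1` and vanishes on all elements outside the set with index `k`: an element touching one that
  -- reaches distance `(k + 1) * h` at a common vertex reaches distance `k * h` itself.
  set J : Pt n → Prop := fun z => ∀ T ∈ farElems 𝒯 h x₀ (k + 1), z ∉ T with hJ
  set χ := trunc r 𝒯 J w with hχ
  have hχFE : IsFE r Ω 𝒯 χ := isFE_trunc M hr J hw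
  have hχc := hχFE.continuous M
  have hzero : ∀ T ∈ 𝒯, T ∉ farElems 𝒯 h x₀ k → ∀ x ∈ elem T, χ x = 0 := by
    intro T hT hTk x hx
    refine trunc_eq_zero M hT (fun z hz T' hT' hz' => hTk ?_) w hx
    obtain ⟨h1, y, hy, hd⟩ := mem_farElems.1 hT'
    refine mem_farElems.2 ⟨hT, z, subset_elem T hz, ?_⟩
    have h2 := M.dist_le T' h1 y hy z (subset_elem T' hz')
    have h3 := dist_triangle y z x₀
    push_cast at hd
    linarith
  have hT₀k : T₀ ∉ farElems 𝒯 h x₀ k := fun hmem => by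
    obtain ⟨h1, y, hy, hd⟩ := mem_farElems.1 hmem
    have h2 := M.dist_le T₀ h1 y hy x₀ hx₀
    have hk' : (2 : ℝ) ≤ k := by exact_mod_cast hk
    nlinarith
  -- The data live on `T₀`, where `χ` vanishes because `k ≥ 2`. So the energy on the set `k + 1`
  -- equals minus the integral of `w * χ` over the layer between the two sets.
  have h0 : ∫ x in Ω, w x * χ x = 0 := by
    rw [hwg χ hχFE]
    refine (setIntegral_congr_fun (measurableSet_elem T₀) fun x hx => ?_).trans (integral_zero _ _)
    simp [hzero T₀ hT₀ hT₀k x hx]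
  have hself : ∀ T ∈ farElems 𝒯 h x₀ (k + 1), ∫ x in elem T, w x * χ x = ∫ x in elem T, w x ^ 2 :=
    fun T hT => setIntegral_congr_fun (measurableSet_elem T) fun x hx => by
      have h1 : χ x = w x :=
        trunc_eq_self M hr (farElems_subset hT) (fun z hz hz' => hz' T hT hz) w hx
      simp only [h1]; ring
  rw [M.integral_eq_sum (hχFE.integrable_mul M (hw.integrableOn M)),
    ← Finset.sum_subset (farElems_subset (𝒯 := 𝒯) (h := h) (x₀ := x₀) (k := k)) fun T hT hTk => by
      refine (setIntegral_congr_fun (measurableSet_elem T) fun x hx => ?_).trans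
        (integral_zero _ _)
      simp [hzero T hT hTk x hx],
    ← Finset.sum_sdiff (farElems_succ_subset (𝒯 := 𝒯) hh.le (x₀ := x₀) (k := k)),
    Finset.sum_congr rfl hself] at h0
  rw [← Finset.sum_sdiff (farElems_succ_subset (𝒯 := 𝒯) hh.le (x₀ := x₀) (k := k)),
    add_sub_cancel_right, Finset.mul_sum]
  -- `χ` is bounded by values of `w` in the same element, and the inverse estimate turns these into
  -- the L² norm of `w` on that element.
  have key : ∀ T ∈ 𝒯, -∫ x in elem T, w x * χ x ≤
      2 * C * volume.real (Metric.ball (0 : Pt n) 1) * ∫ x in elem T, w x ^ 2 := by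
    intro T hT
    obtain ⟨p, hp, hwp⟩ := hw.2 T hT
    have he : ∫ y in elem T, p y ^ 2 = ∫ y in elem T, w y ^ 2 :=
      setIntegral_congr_fun (measurableSet_elem T) fun x hx => by simp only [hwp x hx]
    have hsup : ∀ x ∈ elem T, w x ^ 2 ≤ C * (h ^ n)⁻¹ * ∫ y in elem T, w y ^ 2 := fun x hx => by
      rw [← he, hwp x hx]; exact hC T hT p hp x hx
    set e := C * (h ^ n)⁻¹ * ∫ y in elem T, w y ^ 2 with hedef
    have he0 : 0 ≤ e := by
      obtain ⟨x, hx⟩ := (M.simplex hT).interior_nonempty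
      exact (sq_nonneg _).trans (hsup x (interior_subset hx))
    have hpt : ∀ x ∈ elem T, ‖w x * χ x‖ ≤ 2 * e := by
      intro x hx
      obtain ⟨y, hy, hxy⟩ := exists_abs_trunc_le M hr hT J w hx
      have h1 := hsup x hx
      have h2 := hsup y hy
      rw [Real.norm_eq_abs, abs_mul]
      have h3 : |w x| * |χ x| ≤ |w x| * (|w x| + |w y|) :=
        mul_le_mul_of_nonneg_left hxy (abs_nonneg _)
      have h4 := two_mul_le_add_sq |w x| |w y|
      rw [sq_abs, sq_abs] at h4
      nlinarith [sq_abs (w x)]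
    have hInt := norm_setIntegral_le_of_norm_le_const (μ := volume) (isCompact_elem T).measure_lt_top hpt
    calc -∫ x in elem T, w x * χ x ≤ ‖∫ x in elem T, w x * χ x‖ := by
          rw [Real.norm_eq_abs]; exact neg_le_abs _
      _ ≤ 2 * e * volume.real (elem T) := hInt
      _ ≤ 2 * e * (volume.real (Metric.ball (0 : Pt n) 1) * h ^ n) :=
        mul_le_mul_of_nonneg_left (M.volume_real_elem_le hT) (by positivity)
      _ = _ := by rw [hedef]; field_simp
  have hsum : ∑ T ∈ farElems 𝒯 h x₀ k \ farElems 𝒯 h x₀ (k + 1), -∫ x in elem T, w x * χ x ≤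
      ∑ T ∈ farElems 𝒯 h x₀ k \ farElems 𝒯 h x₀ (k + 1),
        2 * C * volume.real (Metric.ball (0 : Pt n) 1) * ∫ x in elem T, w x ^ 2 :=
    Finset.sum_le_sum fun T hT => key T (farElems_subset (Finset.mem_sdiff.1 hT).1)
  rw [Finset.sum_neg_distrib] at hsum
  linarith

/-- Global energy bound for a finite element function with local data. -/
lemma integral_sq_le {C : ℝ} (M : IsMesh c h Ω 𝒯) (hC0 : 0 < C)
    (hC : ∀ T ∈ 𝒯, ∀ p : Pt n → ℝ, IsPoly r p → ∀ x ∈ elem T,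
      p x ^ 2 ≤ C * (h ^ n)⁻¹ * ∫ y in elem T, p y ^ 2)
    {w g : Pt n → ℝ} (hw : IsFE r Ω 𝒯 w) {T₀ : Finset (Pt n)} (hT₀ : T₀ ∈ 𝒯)
    (hg : IntegrableOn g (elem T₀))
    (hwg : ∀ ξ, IsFE r Ω 𝒯 ξ → ∫ x in Ω, w x * ξ x = ∫ x in elem T₀, g x * ξ x) :
    ∑ T ∈ 𝒯, ∫ x in elem T, w x ^ 2 ≤ C * (h ^ n)⁻¹ * (∫ x in elem T₀, |g x|) ^ 2 := by
  have hh := M.h_pos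
  have hwc := hw.continuous M
  have hE : ∫ x in Ω, w x * w x = ∑ T ∈ 𝒯, ∫ x in elem T, w x ^ 2 := by
    rw [M.integral_eq_sum (hw.integrable_mul M (hw.integrableOn M))]
    simp only [sq]
  set E := ∑ T ∈ 𝒯, ∫ x in elem T, w x ^ 2 with hEdef
  have hE0 : 0 ≤ E := Finset.sum_nonneg fun T _ => integral_nonneg fun x => sq_nonneg _
  obtain ⟨p, hp, hwp⟩ := hw.2 T₀ hT₀
  have hsup : ∀ x ∈ elem T₀, w x ^ 2 ≤ C * (h ^ n)⁻¹ * E := fun x hx => by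
    have he : ∫ y in elem T₀, p y ^ 2 = ∫ y in elem T₀, w y ^ 2 :=
      setIntegral_congr_fun (measurableSet_elem T₀) fun x hx => by simp only [hwp x hx]
    rw [hwp x hx]
    refine (hC T₀ hT₀ p hp x hx).trans (mul_le_mul_of_nonneg_left ?_ (by positivity))
    rw [he, hEdef]
    exact Finset.single_le_sum (f := fun T => ∫ x in elem T, w x ^ 2)
      (fun T _ => integral_nonneg fun x => sq_nonneg _) hT₀
  set s := √(C * (h ^ n)⁻¹ * E) with hs
  set m := ∫ x in elem T₀, |g x| with hm
  have hm0 : 0 ≤ m := integral_nonneg fun x => abs_nonneg _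
  -- Testing with `w` itself, the energy is `∫ g w` over `T₀`, where `|w| ≤ s`. Since `s ^ 2` is
  -- proportional to `E`, one factor `E` cancels after squaring.
  have h1 : E ≤ s * m := by
    rw [← hE, hwg w hw]
    calc _ ≤ ∫ x in elem T₀, s * |g x| := by
          refine setIntegral_mono_on ?_ (hg.abs.const_mul s) (measurableSet_elem T₀) fun x hx => ?_
          · obtain ⟨B, hB⟩ := hw.exists_bound M
            exact Integrable.mul_bdd hg hwc.aestronglyMeasurable (ae_of_all _ hB)
          · have h2 : |w x| ≤ s := Real.abs_le_sqrt (hsup x hx)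
            calc g x * w x ≤ |g x * w x| := le_abs_self _
              _ = |w x| * |g x| := by rw [abs_mul, mul_comm]
              _ ≤ s * |g x| := mul_le_mul_of_nonneg_right h2 (abs_nonneg _)
      _ = s * m := integral_const_mul _ _
  have h2 : E ^ 2 ≤ (C * (h ^ n)⁻¹ * E) * m ^ 2 := by
    calc E ^ 2 ≤ (s * m) ^ 2 := pow_le_pow_left₀ hE0 h1 2
      _ = s ^ 2 * m ^ 2 := by ring
      _ = _ := by rw [hs, Real.sq_sqrt (by positivity)]
  rcases hE0.eq_or_lt with h3 | h3
  · rw [← h3]; positivity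
  · have h4 : E * E ≤ E * (C * (h ^ n)⁻¹ * m ^ 2) := by nlinarith
    exact le_of_mul_le_mul_left h4 h3

end

lemma exists_pow_mul_pow_le (m : ℕ) {θ : ℝ} (h0 : 0 ≤ θ) (h1 : θ < 1) :
    ∃ B : ℝ, 0 < B ∧ ∀ k : ℕ, ((k : ℝ) + 2) ^ m * θ ^ k ≤ B := by
  have ht := tendsto_pow_const_mul_const_pow_of_abs_lt_one m (r := θ) (by rwa [abs_of_nonneg h0])
  obtain ⟨B, hB⟩ := ht.bddAbove_range
  have hle : ∀ k : ℕ, (k : ℝ) ^ m * θ ^ k ≤ |B| := fun k =>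
    (hB ⟨k, rfl⟩).trans (le_abs_self B)
  -- `2 ^ m` takes care of `k = 0`; for `k ≥ 1` one has `k + 2 ≤ 3 * k`.
  refine ⟨3 ^ m * (|B| + 1) + 2 ^ m, by positivity, fun k => ?_⟩
  rcases Nat.eq_zero_or_pos k with rfl | hk
  · simp; positivity
  · have hk' : (1 : ℝ) ≤ k := by exact_mod_cast hk
    calc ((k : ℝ) + 2) ^ m * θ ^ k ≤ (3 * k) ^ m * θ ^ k := by
          refine mul_le_mul_of_nonneg_right (pow_le_pow_left₀ (by positivity) (by linarith) m)
            (by positivity)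
      _ = 3 ^ m * ((k : ℝ) ^ m * θ ^ k) := by rw [mul_pow]; ring
      _ ≤ 3 ^ m * |B| := mul_le_mul_of_nonneg_left (hle k) (by positivity)
      _ ≤ _ := by
        have : (0 : ℝ) < 3 ^ m := by positivity
        have : (0 : ℝ) < 2 ^ m := by positivity
        nlinarith

/-- Pointwise decay of the gradient of a finite element function with local data. -/
lemma exists_fe_decay (n r m : ℕ) (hr : 1 ≤ r) (c : ℝ) (hc : 0 < c) :
    ∃ C : ℝ, 0 < C ∧ ∀ {h : ℝ} {Ω : Set (Pt n)} {𝒯 : Finset (Finset (Pt n))}, IsMesh c h Ω 𝒯 →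
      ∀ T₀ ∈ 𝒯, ∀ g w : Pt n → ℝ, IntegrableOn g (elem T₀) → IsFE r Ω 𝒯 w →
      (∀ ξ, IsFE r Ω 𝒯 ξ → ∫ x in Ω, w x * ξ x = ∫ x in elem T₀, g x * ξ x) →
      ∀ T ∈ 𝒯, ∀ p, IsPoly r p → (∀ x ∈ elem T, w x = p x) → ∀ x ∈ elem T, ∀ x₀ ∈ elem T₀,
      ‖fderiv ℝ p x‖ ≤
        C * (h ^ (n + 1))⁻¹ * ((1 + dist x x₀ / h) ^ m)⁻¹ * ∫ y in elem T₀, |g y| := by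
  obtain ⟨C, hC, hinv⟩ := exists_inverse_estimate_sq n r hr c hc
  set C' := 2 * C * volume.real (Metric.ball (0 : Pt n) 1) with hC'
  have hC'0 : 0 ≤ C' := by positivity
  -- The sum of `E (k + 1) ≤ C' * (E k - E (k + 1))` and `E (k + 1) ≤ E k` reads `E (k + 1) ≤ θ * E
  -- k`.
  set θ := (C' + 1) / (C' + 2) with hθ
  have hθ0 : 0 < θ := by positivity
  have hθ1 : θ < 1 := by rw [hθ, div_lt_one (by positivity)]; linarith
  -- The power is `2 * m` because the energies bound the square of the gradient.
  obtain ⟨B, hB, hBk⟩ := exists_pow_mul_pow_le (2 * m) hθ0.le hθ1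
  refine ⟨√(C * C * (θ ^ 2)⁻¹ * B), by positivity,
    fun {h Ω 𝒯} M T₀ hT₀ g w hg hw hwg T hT p hp hwp x hx x₀ hx₀ => ?_⟩
  have hh := M.h_pos
  set E : ℕ → ℝ := fun k => ∑ T ∈ farElems 𝒯 h x₀ k, ∫ x in elem T, w x ^ 2 with hE
  set μ := ∫ y in elem T₀, |g y| with hμ
  have hμ0 : 0 ≤ μ := integral_nonneg fun x => abs_nonneg _
  have hE0 : ∀ k, 0 ≤ E k := fun k =>
    Finset.sum_nonneg fun T _ => integral_nonneg fun x => sq_nonneg _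
  have htot : ∀ k, E k ≤ C * (h ^ n)⁻¹ * μ ^ 2 := fun k =>
    (Finset.sum_le_sum_of_subset_of_nonneg farElems_subset
      fun T _ _ => integral_nonneg fun x => sq_nonneg _).trans
      (integral_sq_le M hC (fun T hT p hp x hx => (hinv M T hT p hp x hx).1) hw hT₀ hg hwg)
  have hstep : ∀ k, 2 ≤ k → E (k + 1) ≤ θ * E k := fun k hk => by
    have h1 : E (k + 1) ≤ C' * (E k - E (k + 1)) := sum_farElems_le M hr
      (fun T hT p hp x hx => (hinv M T hT p hp x hx).1) hw hT₀ hwg hx₀ hk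
    rw [hθ, div_mul_eq_mul_div, le_div_iff₀ (by positivity)]
    have h2 : E (k + 1) ≤ E k := by
      refine Finset.sum_le_sum_of_subset_of_nonneg (farElems_succ_subset hh.le)
        fun T _ _ => integral_nonneg fun x => sq_nonneg _
    nlinarith
  -- The geometric decay starts at index 2; the factor `(θ ^ 2)⁻¹` makes the bound valid from index
  -- 0.
  have hdec : ∀ k, E k ≤ C * (h ^ n)⁻¹ * μ ^ 2 * (θ ^ 2)⁻¹ * θ ^ k := by
    have hA : 0 ≤ C * (h ^ n)⁻¹ * μ ^ 2 := by positivity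
    have h2 : ∀ j, E (j + 2) ≤ C * (h ^ n)⁻¹ * μ ^ 2 * θ ^ j := by
      intro j
      induction j with
      | zero => simpa using htot 2
      | succ j ih =>
        calc E (j + 1 + 2) ≤ θ * E (j + 2) := hstep (j + 2) (by omega)
          _ ≤ θ * (C * (h ^ n)⁻¹ * μ ^ 2 * θ ^ j) := mul_le_mul_of_nonneg_left ih hθ0.le
          _ = _ := by ring
    intro k
    rcases le_or_gt 2 k with hk | hk
    · obtain ⟨j, rfl⟩ := Nat.exists_eq_add_of_le' hk
      refine (h2 j).trans (le_of_eq ?_)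
      rw [pow_add]; field_simp
    · refine (htot k).trans ?_
      rw [mul_assoc _ (θ ^ 2)⁻¹]
      refine le_mul_of_one_le_right hA ?_
      rw [inv_mul_eq_div, one_le_div (by positivity)]
      exact pow_le_pow_of_le_one hθ0.le hθ1.le hk.le
  set k := ⌊dist x x₀ / h⌋₊ with hk
  have hkle : (k : ℝ) ≤ dist x x₀ / h := Nat.floor_le (by positivity)
  have hklt : dist x x₀ / h < k + 1 := Nat.lt_floor_add_one _
  have hTk : T ∈ farElems 𝒯 h x₀ k :=
    mem_farElems.2 ⟨hT, x, hx, by rwa [le_div_iff₀ hh] at hkle⟩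
  have h1 := (hinv M T hT p hp x hx).2
  have he : ∫ y in elem T, p y ^ 2 ≤ E k := by
    rw [show ∫ y in elem T, p y ^ 2 = ∫ y in elem T, w y ^ 2 from
      setIntegral_congr_fun (measurableSet_elem T) fun x hx => by simp only [hwp x hx]]
    exact Finset.single_le_sum (f := fun T => ∫ x in elem T, w x ^ 2)
      (fun T _ => integral_nonneg fun x => sq_nonneg _) hTk
  have hD : 0 < (1 + dist x x₀ / h) := by positivity
  have h3 : ‖fderiv ℝ p x‖ ^ 2 ≤
      (√(C * C * (θ ^ 2)⁻¹ * B) * (h ^ (n + 1))⁻¹ * ((1 + dist x x₀ / h) ^ m)⁻¹ * μ) ^ 2 := by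
    have h4 : θ ^ k ≤ B * (((1 + dist x x₀ / h) ^ m)⁻¹) ^ 2 := by
      rw [inv_pow, ← pow_mul, mul_comm m, ← div_eq_mul_inv, le_div_iff₀ (by positivity), mul_comm]
      refine le_trans (mul_le_mul_of_nonneg_right ?_ (by positivity)) (hBk k)
      exact pow_le_pow_left₀ hD.le (by linarith) _
    calc ‖fderiv ℝ p x‖ ^ 2 ≤ C * (h ^ (n + 2))⁻¹ * (C * (h ^ n)⁻¹ * μ ^ 2 * (θ ^ 2)⁻¹ * θ ^ k) :=
          h1.trans (mul_le_mul_of_nonneg_left (he.trans (hdec k)) (by positivity))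
      _ ≤ C * (h ^ (n + 2))⁻¹ * (C * (h ^ n)⁻¹ * μ ^ 2 * (θ ^ 2)⁻¹ *
          (B * (((1 + dist x x₀ / h) ^ m)⁻¹) ^ 2)) := by gcongr
      _ = _ := by
        rw [mul_pow, mul_pow, mul_pow, Real.sq_sqrt (by positivity)]
        rw [inv_pow (h ^ (n + 1)), ← pow_mul, show (n + 1) * 2 = (n + 2) + n by ring,
          pow_add h (n + 2) n, mul_inv]
        ring
  exact (pow_le_pow_iff_left₀ (norm_nonneg _) (by positivity) two_ne_zero).1 h3

/-! ### The weighted pointwise estimate for the gradient of the projection -/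

lemma IsPoly.eq_of_eqOn_elem {n r : ℕ} {p q : Pt n → ℝ} (hp : IsPoly r p) (hq : IsPoly r q)
    {T : Finset (Pt n)} (hT : IsSimplex T) (h : ∀ x ∈ elem T, p x = q x) : p = q := by
  obtain ⟨P, -, hP⟩ := hp
  obtain ⟨Q, -, hQ⟩ := hq
  obtain ⟨x₀, hx₀⟩ := hT.interior_nonempty
  have h0 : P - Q = 0 := by
    refine mvPolynomial_eq_zero_of_eventually _ x₀ ?_
    filter_upwards [isOpen_interior.mem_nhds hx₀] with x hx
    rw [map_sub, ← hP, ← hQ, h x (interior_subset hx), sub_self]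
  ext x
  rw [hP, hQ, sub_eq_zero.1 h0]

/-- The decay kernel `(1 + |x - y| / h)⁻ᵐ`. -/
def kern {n : ℕ} (m : ℕ) (h : ℝ) (x y : Pt n) : ℝ≥0∞ :=
  ENNReal.ofReal (((1 + dist x y / h) ^ m)⁻¹)

lemma kern_le {n : ℕ} (m : ℕ) {h : ℝ} (hh : 0 < h) (x : Pt n) {y z : Pt n}
    (hyz : dist y z ≤ 2 * h) : kern m h x y ≤ 3 ^ m * kern m h x z := by
  have h3 : (3 : ℝ≥0∞) ^ m = ENNReal.ofReal (3 ^ m) := by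
    rw [ENNReal.ofReal_pow (by norm_num)]; norm_num
  rw [kern, kern, h3, ← ENNReal.ofReal_mul (by positivity)]
  refine ENNReal.ofReal_le_ofReal ?_
  rw [← div_eq_mul_inv, inv_eq_one_div, div_le_div_iff₀ (by positivity) (by positivity), one_mul,
    ← mul_pow]
  refine pow_le_pow_left₀ (by positivity) ?_ m
  have h1 : dist x z ≤ dist x y + 2 * h := (dist_triangle x y z).trans (by linarith)
  have h2 : dist x z / h ≤ dist x y / h + 2 := by
    rw [div_le_iff₀ hh, add_mul, div_mul_cancel₀ _ hh.ne']; exact h1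
  have h4 : 0 ≤ dist x y / h := by positivity
  linarith

/-- Touching is symmetric, so each element occurs in as many stars as it has neighbours, which is at
most `(2 / c) ^ n`. -/
lemma IsMesh.sum_lintegral_starSet_le {n : ℕ} {c h : ℝ} {Ω : Set (Pt n)}
    {𝒯 : Finset (Finset (Pt n))} (M : IsMesh c h Ω 𝒯) (F : Pt n → ℝ≥0∞) :
    ∑ T ∈ 𝒯, ∫⁻ x in starSet 𝒯 T, F x ≤ ENNReal.ofReal ((2 / c) ^ n) * ∫⁻ x in Ω, F x := by
  have h1 : ∀ T ∈ 𝒯, ∫⁻ x in starSet 𝒯 T, F x = ∑ T' ∈ nbrs 𝒯 T, ∫⁻ x in elem T', F x :=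
    fun T hT => by
      rw [starSet, M.restrict_biUnion fun S hS => (IsMesh.mem_nbrs.1 hS).1,
        lintegral_finsetSum_measure]
  rw [Finset.sum_congr rfl h1, M.lintegral_eq_sum, Finset.mul_sum,
    Finset.sum_comm' (t' := 𝒯) (s' := fun T' => nbrs 𝒯 T')]
  · refine Finset.sum_le_sum fun T hT => ?_
    rw [Finset.sum_const, nsmul_eq_mul]
    refine mul_le_mul' ?_ le_rfl
    rw [← ENNReal.ofReal_natCast]
    exact ENNReal.ofReal_le_ofReal (M.card_nbrs_le hT)
  · intro T T'
    rw [IsMesh.mem_nbrs, IsMesh.mem_nbrs, Set.inter_comm (elem T)]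
    tauto

lemma fderiv_interp_poly {n : ℕ} (Ω : Set (Pt n)) (𝒯 : Finset (Finset (Pt n)))
    (T : Finset (Pt n)) (v : Pt n → ℝ) (x : Pt n) :
    fderiv ℝ (fun x => ∑ z ∈ T, coef Ω 𝒯 v z * bary T z x) x = interpGrad Ω 𝒯 T v := by
  refine HasFDerivAt.fderiv ?_
  have h1 : ∀ z ∈ T, HasFDerivAt (fun x => coef Ω 𝒯 v z * bary T z x)
      (coef Ω 𝒯 v z • baryGrad T z) x := fun z _ => (hasFDerivAt_bary T z x).const_mul _
  exact HasFDerivAt.fun_sum h1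

/-- Let `u` be the quasi-interpolant of `v`. Then `w - u` is the projection of `v - u`, which is
split into pieces supported on single elements `T'`. The L¹ norm of such a piece is at most `C * h`
times the integral of `|G - Q|` over the star of `T'`, with the same `Q` for every `T'`. The decay
estimate supplies the kernel at the distance from `T'` to `x`, and the stars overlap boundedly. The
gradient of `u` itself is compared with `Q` on the star of `T`. -/
lemma exists_gradient_estimate (n r m : ℕ) (hn : 1 ≤ n) (hr : 1 ≤ r) (c : ℝ) (hc : 0 < c) :
    ∃ C : ℝ≥0, ∀ {h : ℝ} {Ω : Set (Pt n)} {𝒯 : Finset (Finset (Pt n))}, IsMesh c h Ω 𝒯 →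
      ∀ (v w : Pt n → ℝ) (G : Pt n → Pt n →L[ℝ] ℝ) (φ : ℕ → Pt n → ℝ),
      IsW0Limit Ω v G φ → IsFE r Ω 𝒯 w →
      (∀ ξ, IsFE r Ω 𝒯 ξ → ∫ x in Ω, w x * ξ x = ∫ x in Ω, v x * ξ x) →
      ∀ T ∈ 𝒯, ∀ p, IsPoly r p → (∀ x ∈ elem T, w x = p x) → ∀ x ∈ elem T,
      ∀ Q : Pt n →L[ℝ] ℝ, ENNReal.ofReal (h ^ n) * ‖fderiv ℝ p x - Q‖ₑ ≤
        C * ∫⁻ y in Ω, kern m h x y * ‖G y - Q‖ₑ := by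
  obtain ⟨C₁, hC₁, hdecay⟩ := exists_fe_decay n r m hr c hc
  obtain ⟨C₂, hInt⟩ := exists_interp_estimate_of_limit n hn c hc
  refine ⟨C₂ * 3 ^ m + C₁.toNNReal * C₂ * 3 ^ m * ((2 / c) ^ n).toNNReal,
    fun {h Ω 𝒯} M v w G φ H hw hwv T hT p hp hwp x hx Q => ?_⟩
  have hh := M.h_pos
  set u := interp Ω 𝒯 v with hu
  have huFE : IsFE r Ω 𝒯 u := isFE_interp M hr v
  have hvu : IntegrableOn (fun y => v y - u y) Ω := H.integrableOn.sub (huFE.integrableOn M)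
  have hproj : ∀ T' ∈ 𝒯, ∃ w', IsFE r Ω 𝒯 w' ∧ ∀ ξ, IsFE r Ω 𝒯 ξ →
      ∫ y in Ω, w' y * ξ y = ∫ y in elem T', (v y - u y) * ξ y := by
    intro T' hT'
    have hi : IntegrableOn ((elem T').indicator fun y => v y - u y) Ω :=
      Integrable.indicator hvu (measurableSet_elem T')
    obtain ⟨w', hw', hw'2⟩ := exists_fe_proj M r hi
    refine ⟨w', hw', fun ξ hξ => ?_⟩
    have h1 : ∀ y, (elem T').indicator (fun y => v y - u y) y * ξ y =
        (elem T').indicator (fun y => (v y - u y) * ξ y) y := fun y => by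
      by_cases hy : y ∈ elem T' <;> simp [hy]
    rw [hw'2 ξ hξ]
    simp only [h1]
    rw [← M.restrict_closure, setIntegral_indicator (measurableSet_elem T'),
      Set.inter_eq_right.2 (M.tri.elem_subset_closure hT')]
  choose! W hWFE hW using hproj
  -- The difference belongs to the finite element space and is orthogonal to it, in particular to
  -- itself.
  have hdiff : (fun y => w y - u y - ∑ T' ∈ 𝒯, W T' y) = 0 := by
    have hFE : IsFE r Ω 𝒯 (fun y => w y - u y - ∑ T' ∈ 𝒯, W T' y) := by
      have h1 := (feSpace r Ω 𝒯).sub_mem ((feSpace r Ω 𝒯).sub_mem hw huFE)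
        ((feSpace r Ω 𝒯).sum_mem hWFE)
      have h2 : (fun y => w y - u y - ∑ T' ∈ 𝒯, W T' y) = w - u - ∑ T' ∈ 𝒯, W T' := by
        ext y; simp
      rw [h2]; exact h1
    refine hFE.eq_zero_of_integral_sq M ?_
    set d := fun y => w y - u y - ∑ T' ∈ 𝒯, W T' y with hd
    have h1 : ∀ y, d y * d y = w y * d y - u y * d y - ∑ T' ∈ 𝒯, W T' y * d y := fun y => by
      rw [← Finset.sum_mul]; simp only [hd]; ring
    refine (integral_congr_ae (ae_of_all _ h1)).trans ?_
    have i1 := hFE.integrable_mul M (hw.integrableOn M)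
    have i2 := hFE.integrable_mul M (huFE.integrableOn M)
    have i3 : ∀ T' ∈ 𝒯, IntegrableOn (fun y => W T' y * d y) Ω := fun T' hT' =>
      hFE.integrable_mul M ((hWFE T' hT').integrableOn M)
    have i12 : IntegrableOn (fun y => w y * d y - u y * d y) Ω := i1.sub i2
    rw [integral_sub i12 (integrable_finsetSum _ i3), integral_sub i1 i2,
      integral_finsetSum _ i3, hwv d hFE, Finset.sum_congr rfl fun T' hT' => hW T' hT' d hFE,
      ← M.integral_eq_sum (hFE.integrable_mul M hvu),
      ← integral_sub (hFE.integrable_mul M H.integrableOn) i2]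
    simp [sub_mul]
  choose! P hPpoly hP using fun T' (hT' : T' ∈ 𝒯) => (hWFE T' hT').2 T hT
  have hpeq : p = fun y => (∑ z ∈ T, coef Ω 𝒯 v z * bary T z y) + ∑ T' ∈ 𝒯, P T' y := by
    refine hp.eq_of_eqOn_elem (IsPoly.add (IsPoly.sum T _ fun z _ =>
      ((isPoly_bary T z).mono hr).const_mul (coef Ω 𝒯 v z)) (IsPoly.sum 𝒯 _ hPpoly))
      (M.simplex hT) fun y hy => ?_
    have h1 := congrFun hdiff y
    simp only [Pi.zero_apply] at h1
    rw [← hwp y hy, ← interp_eq M hT v hy, ← hu,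
      ← Finset.sum_congr rfl fun T' hT' => hP T' hT' y hy]
    linarith
  have hfd : fderiv ℝ p x = interpGrad Ω 𝒯 T v + ∑ T' ∈ 𝒯, fderiv ℝ (P T') x := by
    have d1 : DifferentiableAt ℝ (fun y => ∑ z ∈ T, coef Ω 𝒯 v z * bary T z y) x :=
      (IsPoly.sum T _ fun z _ => (isPoly_bary T z).const_mul (coef Ω 𝒯 v z)).differentiable x
    have d2 : ∀ T' ∈ 𝒯, DifferentiableAt ℝ (P T') x :=
      fun T' hT' => (hPpoly T' hT').differentiable x
    have d3 : DifferentiableAt ℝ (fun y => ∑ T' ∈ 𝒯, P T' y) x :=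
      (IsPoly.sum 𝒯 _ hPpoly).differentiable x
    rw [hpeq, fderiv_fun_add d1 d3, fderiv_interp_poly, fderiv_fun_sum d2]
  set F : Pt n → ℝ≥0∞ := fun y => kern m h x y * ‖G y - Q‖ₑ with hF
  -- Points of the star are at distance at most `2 * h` from `x'`, so the kernel can be moved under
  -- the integral at the cost of `3 ^ m`.
  have hstar : ∀ T' ∈ 𝒯, ∀ x' ∈ elem T',
      kern m h x x' * ∫⁻ y in starSet 𝒯 T', ‖G y - Q‖ₑ ≤ 3 ^ m * ∫⁻ y in starSet 𝒯 T', F y := by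
    intro T' hT' x' hx'
    rw [← lintegral_const_mul' (kern m h x x') _ ENNReal.ofReal_ne_top,
      ← lintegral_const_mul' _ _ (by simp)]
    refine setLIntegral_mono_ae' ?_ (ae_of_all _ fun y hy => ?_)
    · exact Finset.measurableSet_biUnion _ fun S _ => measurableSet_elem S
    · obtain ⟨S, hS, hyS⟩ := Set.mem_iUnion₂.1 hy
      rw [hF, ← mul_assoc]
      exact mul_le_mul' (kern_le m hh x (M.dist_le_of_mem_nbrs hT' hS hx' hyS)) le_rfl
  have hfirst : ENNReal.ofReal (h ^ n) * ‖interpGrad Ω 𝒯 T v - Q‖ₑ ≤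
      C₂ * 3 ^ m * ∫⁻ y in Ω, F y := by
    refine (hInt M T hT v G φ H Q).2.trans ?_
    rw [mul_assoc]
    refine mul_le_mul' le_rfl ?_
    have h1 := hstar T hT x hx
    have h2 : kern m h x x = 1 := by simp [kern]
    rw [h2, one_mul] at h1
    exact h1.trans (mul_le_mul' le_rfl (M.setLIntegral_le M.starSet_subset_closure _))
  -- The factor `h` in the interpolation error cancels the extra `h⁻¹` in the gradient bound.
  have hsecond : ∀ T' ∈ 𝒯, ENNReal.ofReal (h ^ n) * ‖fderiv ℝ (P T') x‖ₑ ≤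
      C₁.toNNReal * C₂ * 3 ^ m * ∫⁻ y in starSet 𝒯 T', F y := by
    intro T' hT'
    obtain ⟨x', hx'⟩ := (M.simplex hT').interior_nonempty
    replace hx' := interior_subset hx'
    have hiT := M.integrableOn_elem hT' hvu
    have h1 := hdecay M T' hT' _ _ hiT (hWFE T' hT') (hW T' hT') T hT (P T')
      (hPpoly T' hT') (hP T' hT') x hx x' hx'
    have h2 : ENNReal.ofReal (∫ y in elem T', |v y - u y|) = ∫⁻ y in elem T', ‖v y - u y‖ₑ :=
      ofReal_integral_norm_eq_lintegral_enorm hiT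
    calc ENNReal.ofReal (h ^ n) * ‖fderiv ℝ (P T') x‖ₑ
        ≤ ENNReal.ofReal (h ^ n) * ENNReal.ofReal (C₁ * (h ^ (n + 1))⁻¹ *
            ((1 + dist x x' / h) ^ m)⁻¹ * ∫ y in elem T', |v y - u y|) := by
          refine mul_le_mul' le_rfl ?_
          rw [← ofReal_norm]; exact ENNReal.ofReal_le_ofReal h1
      _ = ENNReal.ofReal C₁ * ENNReal.ofReal h⁻¹ * kern m h x x' *
          ∫⁻ y in elem T', ‖v y - u y‖ₑ := by
          rw [kern, ← h2, ← ENNReal.ofReal_mul (by positivity), ← ENNReal.ofReal_mul hC₁.le,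
            ← ENNReal.ofReal_mul (by positivity), ← ENNReal.ofReal_mul (by positivity)]
          congr 1
          rw [pow_succ, mul_inv]
          generalize ∫ y in elem T', |v y - u y| = I
          generalize ((1 + dist x x' / h) ^ m)⁻¹ = k
          field_simp
      _ ≤ ENNReal.ofReal C₁ * ENNReal.ofReal h⁻¹ * kern m h x x' *
          (C₂ * (ENNReal.ofReal h * ∫⁻ y in starSet 𝒯 T', ‖G y - Q‖ₑ)) :=
          mul_le_mul' le_rfl (hInt M T' hT' v G φ H Q).1
      _ = ENNReal.ofReal C₁ * (ENNReal.ofReal h⁻¹ * ENNReal.ofReal h) * C₂ *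
          (kern m h x x' * ∫⁻ y in starSet 𝒯 T', ‖G y - Q‖ₑ) := by ring
      _ ≤ ENNReal.ofReal C₁ * 1 * C₂ * (3 ^ m * ∫⁻ y in starSet 𝒯 T', F y) := by
          refine mul_le_mul' (mul_le_mul' (mul_le_mul' le_rfl ?_) le_rfl) (hstar T' hT' x' hx')
          rw [← ENNReal.ofReal_mul (by positivity), inv_mul_cancel₀ hh.ne', ENNReal.ofReal_one]
      _ = _ := by rw [ENNReal.ofReal]; ring
  have htri : ‖fderiv ℝ p x - Q‖ₑ ≤
      ‖interpGrad Ω 𝒯 T v - Q‖ₑ + ∑ T' ∈ 𝒯, ‖fderiv ℝ (P T') x‖ₑ := by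
    have h1 := enorm_add_le (interpGrad Ω 𝒯 T v - Q) (∑ T' ∈ 𝒯, fderiv ℝ (P T') x)
    have h2 := enorm_sum_le 𝒯 fun T' => fderiv ℝ (P T') x
    have h3 : fderiv ℝ p x - Q = interpGrad Ω 𝒯 T v - Q + ∑ T' ∈ 𝒯, fderiv ℝ (P T') x := by
      rw [hfd]; abel
    rw [h3]
    exact h1.trans (add_le_add le_rfl h2)
  calc ENNReal.ofReal (h ^ n) * ‖fderiv ℝ p x - Q‖ₑ
      ≤ ENNReal.ofReal (h ^ n) * ‖interpGrad Ω 𝒯 T v - Q‖ₑ +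
        ∑ T' ∈ 𝒯, ENNReal.ofReal (h ^ n) * ‖fderiv ℝ (P T') x‖ₑ := by
        rw [← Finset.mul_sum, ← mul_add]; exact mul_le_mul' le_rfl htri
    _ ≤ C₂ * 3 ^ m * (∫⁻ y in Ω, F y) +
        ∑ T' ∈ 𝒯, C₁.toNNReal * C₂ * 3 ^ m * ∫⁻ y in starSet 𝒯 T', F y :=
        add_le_add hfirst (Finset.sum_le_sum hsecond)
    _ ≤ C₂ * 3 ^ m * (∫⁻ y in Ω, F y) +
        C₁.toNNReal * C₂ * 3 ^ m * (ENNReal.ofReal ((2 / c) ^ n) * ∫⁻ y in Ω, F y) := by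
        rw [← Finset.mul_sum]
        exact add_le_add le_rfl (mul_le_mul' le_rfl (M.sum_lintegral_starSet_le F))
    _ = _ := by
        push_cast
        rw [add_mul, ENNReal.ofReal]
        ring

/-! ### Approximation of finite element functions by test functions -/

/-- The mollification at scale `δ` averages over the `δ`-ball, so it inherits closeness to a
constant `a` and, for difference quotients, closeness to a linear form `ℓ`. The last property is
used with `ℓ = 0` for a global gradient bound and with the derivative of `f` for convergence. -/
lemma exists_mollify {n : ℕ} {f : Pt n → ℝ} (hf : Continuous f) {δ : ℝ} (hδ : 0 < δ) :
    ∃ ψ : Pt n → ℝ, ContDiff ℝ ∞ ψ ∧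
      (∀ (x : Pt n) (a ε : ℝ), (∀ y ∈ Metric.ball x δ, |f y - a| ≤ ε) → |ψ x - a| ≤ ε) ∧
      ∀ (x : Pt n) (ℓ : Pt n →L[ℝ] ℝ) (η s : ℝ), δ < s → 0 ≤ η →
        (∀ y ∈ Metric.ball x s, ∀ z ∈ Metric.ball x s, |f y - f z - ℓ (y - z)| ≤ η * ‖y - z‖) →
        ‖fderiv ℝ ψ x - ℓ‖ ≤ η := by
  let b : ContDiffBump (0 : Pt n) := ⟨δ / 2, δ, by positivity, by linarith⟩
  set ρ := b.normed volume with hρ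
  have hρc : Continuous ρ := b.continuous_normed
  have hρs : HasCompactSupport ρ := b.hasCompactSupport_normed
  have hρ0 : ∀ t ∉ Metric.ball (0 : Pt n) δ, ρ t = 0 := fun t ht => by
    have h1 : Function.support ρ = Metric.ball (0 : Pt n) δ := b.support_normed_eq
    by_contra hne
    exact ht (h1 ▸ hne)
  have hρi : Integrable ρ volume := b.integrable_normed
  have hbd : ∀ (g : Pt n → ℝ) (ε : ℝ), (∀ t ∈ Metric.ball (0 : Pt n) δ, |g t| ≤ ε) →
      |∫ t, ρ t * g t| ≤ ε := by
    intro g ε hg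
    have h1 : ‖∫ t, ρ t * g t‖ ≤ ∫ t, ρ t * ε := by
      refine norm_integral_le_of_norm_le (hρi.mul_const ε) (ae_of_all _ fun t => ?_)
      by_cases ht : t ∈ Metric.ball (0 : Pt n) δ
      · rw [norm_mul, Real.norm_of_nonneg (b.nonneg_normed t)]
        exact mul_le_mul_of_nonneg_left (hg t ht) (b.nonneg_normed t)
      · simp [hρ0 t ht]
    rwa [integral_mul_const, b.integral_normed, one_mul] at h1
  let ψ : Pt n → ℝ := fun x => ∫ t, ρ t * f (x - t)
  have hψ : ψ = convolution ρ f (ContinuousLinearMap.lsmul ℝ ℝ) volume := by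
    ext x; simp [ψ, convolution_def]
  have hsmooth : ContDiff ℝ ∞ ψ := by
    rw [hψ]
    exact hρs.contDiff_convolution_left _ b.contDiff_normed hf.locallyIntegrable
  have hInt : ∀ x, Integrable fun t => ρ t * f (x - t) := fun x =>
    (hρc.mul (hf.comp (continuous_const.sub continuous_id))).integrable_of_hasCompactSupport
      hρs.mul_right
  have hconst : ∀ a : ℝ, ∫ t, ρ t * a = a := fun a => by
    rw [integral_mul_const, b.integral_normed, one_mul]
  refine ⟨ψ, hsmooth, fun x a ε h => ?_, fun x ℓ η s hs hη h => ?_⟩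
  · have h1 : ψ x - a = ∫ t, ρ t * (f (x - t) - a) := by
      simp only [mul_sub]
      rw [integral_sub (hInt x) (hρi.mul_const a), hconst]
    rw [h1]
    refine hbd _ _ fun t ht => h _ ?_
    simpa [dist_eq_norm] using ht
  · have hd : HasFDerivAt (fun y => ψ y - ℓ y) (fderiv ℝ ψ x - ℓ) x :=
      ((hsmooth.differentiable (by simp)) x).hasFDerivAt.sub ℓ.hasFDerivAt
    refine hd.le_of_lip' hη ?_
    have hball : Metric.ball x (s - δ) ∈ 𝓝 x := Metric.ball_mem_nhds x (by linarith)
    filter_upwards [hball] with y hy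
    have h1 : ψ y - ℓ y - (ψ x - ℓ x) = ∫ t, ρ t * (f (y - t) - f (x - t) - ℓ (y - x)) := by
      have h2 : Integrable fun t => ρ t * f (y - t) - ρ t * f (x - t) := (hInt y).sub (hInt x)
      simp only [mul_sub]
      rw [integral_sub h2 (hρi.mul_const _), integral_sub (hInt y) (hInt x),
        hconst, map_sub]
      ring
    rw [Real.norm_eq_abs, h1]
    refine hbd _ _ fun t ht => ?_
    have ht' : ‖t‖ < δ := by simpa using ht
    have hy' : ‖y - x‖ < s - δ := by simpa [dist_eq_norm] using hy
    have h2 := h (y - t) ?_ (x - t) ?_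
    · simpa using h2
    · rw [Metric.mem_ball, dist_eq_norm]
      calc ‖y - t - x‖ = ‖(y - x) - t‖ := by congr 1; abel
        _ ≤ ‖y - x‖ + ‖t‖ := norm_sub_le _ _
        _ < s := by linarith
    · rw [Metric.mem_ball, dist_eq_norm]
      calc ‖x - t - x‖ = ‖t‖ := by rw [sub_sub_cancel_left, norm_neg]
        _ < s := by linarith

/-- Near a point of the interior of an element a finite element function is a polynomial. -/
lemma eventually_eq_of_mem_interior {n : ℕ} {T : Finset (Pt n)} {f p : Pt n → ℝ}
    (hfp : ∀ x ∈ elem T, f x = p x) {x : Pt n} (hx : x ∈ interior (elem T)) : f =ᶠ[𝓝 x] p := by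
  filter_upwards [isOpen_interior.mem_nhds hx] with y hy using hfp y (interior_subset hy)

/-- A `C¹` function is locally almost equal to its linearization. -/
lemma exists_ball_abs_sub_le {n : ℕ} {p : Pt n → ℝ} (hp : ContDiff ℝ 1 p) (x : Pt n) {η : ℝ}
    (hη : 0 < η) : ∃ s > 0, ∀ y ∈ Metric.ball x s, ∀ z ∈ Metric.ball x s,
      |p y - p z - fderiv ℝ p x (y - z)| ≤ η * ‖y - z‖ := by
  have h1 : HasStrictFDerivAt p (fderiv ℝ p x) x :=
    hp.contDiffAt.hasStrictFDerivAt (by simp)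
  have h2 := (hasStrictFDerivAt_iff_isLittleO.1 h1).def hη
  rw [Metric.eventually_nhds_iff_ball] at h2
  obtain ⟨s, hs, h⟩ := h2
  refine ⟨s, hs, fun y hy z hz => ?_⟩
  have h3 := h (y, z) (by
    rw [Metric.mem_ball, Prod.dist_eq]; exact max_lt hy hz)
  simpa using h3

/-- Plain mollification would enlarge the support beyond `Ω`. So `f` is first clamped between `-β`
and `β`, where `β` is Lipschitz and vanishes near the complement of `Ω`, and then mollified at a
smaller scale. The bounds are uniform and convergence holds inside the elements, which is what
dominated convergence needs. -/
lemma exists_test_approx {n r : ℕ} {c h : ℝ} {Ω : Set (Pt n)} {𝒯 : Finset (Finset (Pt n))}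
    (M : IsMesh c h Ω 𝒯) (hΩ : Ωᶜ.Nonempty) {f : Pt n → ℝ} (hf : IsFE r Ω 𝒯 f) :
    ∃ (ψ : ℕ → Pt n → ℝ) (B : ℝ), (∀ k, IsTest Ω (ψ k)) ∧
      (∀ k x, ‖ψ k x - f x‖ ≤ B ∧ ‖fderiv ℝ (ψ k) x - fderiv ℝ f x‖ ≤ B) ∧
      ∀ T ∈ 𝒯, ∀ x ∈ interior (elem T), Tendsto (fun k => ψ k x) atTop (𝓝 (f x)) ∧
        Tendsto (fun k => fderiv ℝ (ψ k) x) atTop (𝓝 (fderiv ℝ f x)) := by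
  obtain ⟨L, hL⟩ := hf.exists_lipschitz M
  obtain ⟨B₀, hB₀⟩ := hf.exists_bound M
  have hfc := hf.continuous M
  set e : ℕ → ℝ := fun k => 1 / ((k : ℝ) + 1) with he
  have hepos : ∀ k, 0 < e k := fun k => by positivity
  have he0 : Tendsto e atTop (𝓝 0) := tendsto_one_div_add_atTop_nhds_zero_nat
  set D : Pt n → ℝ := fun x => Metric.infDist x Ωᶜ with hD
  have hDc : Continuous D := Metric.continuous_infDist_pt _
  have hDlip : LipschitzWith 1 D := Metric.lipschitz_infDist_pt _
  have hD0 : ∀ x ∉ Ω, D x = 0 := fun x hx => Metric.infDist_zero_of_mem hx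
  have hDpos : ∀ x ∈ Ω, 0 < D x := fun x hx =>
    (M.isOpen.isClosed_compl.notMem_iff_infDist_pos hΩ).1 fun h => h hx
  have hfD : ∀ x, |f x| ≤ L * D x := by
    intro x
    have h1 : ∀ y ∈ Ωᶜ, |f x| ≤ L * dist x y := fun y hy => by
      have h2 := hL.dist_le_mul x y
      rwa [Real.dist_eq, hf.1 y hy, sub_zero] at h2
    rcases eq_or_lt_of_le L.coe_nonneg with hL0 | hL0
    · obtain ⟨y, hy⟩ := hΩ
      have := h1 y hy
      rw [← hL0, zero_mul] at this ⊢
      exact this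
    · rw [mul_comm, ← div_le_iff₀ hL0]
      refine (Metric.le_infDist hΩ).2 fun y hy => ?_
      rw [div_le_iff₀ hL0, mul_comm]
      exact h1 y hy
  -- As `|f| ≤ L * D`, the slope `2 * L` makes the clamp inactive where `D ≥ 2 * e k`, while the
  -- clamped function is 0 where `D ≤ e k`. Its Lipschitz constant `2 * L` does not depend on `k`.
  set β : ℕ → Pt n → ℝ := fun k x => max 0 (2 * L * (D x - e k)) with hβ
  have hβ0 : ∀ k x, 0 ≤ β k x := fun k x => le_max_left _ _
  set g : ℕ → Pt n → ℝ := fun k x => max (-β k x) (min (f x) (β k x)) with hg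
  have hβc : ∀ k, Continuous (β k) := fun k => by fun_prop
  have hgc : ∀ k, Continuous (g k) := fun k => by fun_prop
  have hβlip : ∀ k, LipschitzWith (2 * L) (β k) := fun k => by
    refine LipschitzWith.const_max (LipschitzWith.of_dist_le_mul fun x y => ?_) 0
    have h1 := hDlip.dist_le_mul x y
    rw [Real.dist_eq] at h1 ⊢
    rw [show 2 * (L : ℝ) * (D x - e k) - 2 * L * (D y - e k) = 2 * L * (D x - D y) by ring,
      abs_mul, abs_of_nonneg (by positivity)]
    push_cast
    refine mul_le_mul_of_nonneg_left ?_ (by positivity)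
    simpa using h1
  have hglip : ∀ k, LipschitzWith (2 * L) (g k) := fun k => by
    have h1 := (hβlip k).neg.max (hL.min (hβlip k))
    have h2 : max (2 * L) (max L (2 * L)) = 2 * L := by
      rw [max_eq_right (le_mul_of_one_le_left (zero_le) one_le_two), max_self]
    rwa [h2] at h1
  have hgle : ∀ k x, |g k x| ≤ |f x| := fun k x => by
    rw [abs_le]
    constructor
    · refine le_trans ?_ (le_max_right _ _)
      refine le_min (neg_abs_le _) ((neg_nonpos.2 (abs_nonneg _)).trans (hβ0 k x))
    · refine max_le ((neg_nonpos.2 (hβ0 k x)).trans (abs_nonneg _)) ?_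
      exact (min_le_left _ _).trans (le_abs_self _)
  have hgzero : ∀ k x, D x ≤ e k → g k x = 0 := fun k x hx => by
    have h1 : β k x = 0 := max_eq_left (mul_nonpos_of_nonneg_of_nonpos (by positivity) (by linarith))
    simp only [hg, h1, neg_zero]
    exact max_eq_left (min_le_right _ _)
  have hgeq : ∀ k x, 2 * e k ≤ D x → g k x = f x := fun k x hx => by
    have h1 : |f x| ≤ β k x := by
      refine (hfD x).trans (le_trans ?_ (le_max_right _ _))
      nlinarith [L.coe_nonneg]
    rw [abs_le] at h1
    simp only [hg]
    rw [min_eq_left h1.2, max_eq_right h1.1]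
  choose ψ hψs hψv hψd using fun k => exists_mollify (hgc k) (half_pos (hepos k))
  have hsupp : ∀ k, tsupport (ψ k) ⊆ {x | e k / 2 ≤ D x} := fun k => by
    refine closure_minimal (fun x hx => ?_) (isClosed_le continuous_const hDc)
    by_contra hlt
    rw [Set.mem_ofPred_eq, not_le] at hlt
    refine hx ?_
    have h1 := hψv k x 0 0 fun y hy => by
      have h2 := hDlip.dist_le_mul y x
      rw [Metric.mem_ball] at hy
      rw [Real.dist_eq, NNReal.coe_one, one_mul] at h2
      rw [hgzero k y (by linarith [le_abs_self (D y - D x)])]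
      simp
    simpa using h1
  have hKΩ : ∀ k, {x | e k / 2 ≤ D x} ⊆ Ω := fun k x hx => by
    by_contra hxΩ
    have h1 : e k / 2 ≤ D x := hx
    rw [hD0 x hxΩ] at h1
    linarith [hepos k]
  refine ⟨ψ, 2 * B₀ + (2 * L + L), fun k => ⟨hψs k, ?_, (hsupp k).trans (hKΩ k)⟩,
    fun k x => ⟨?_, ?_⟩, fun T hT x hx => ?_⟩
  · exact M.isCompact_closure.of_isClosed_subset (isClosed_tsupport _)
      (((hsupp k).trans (hKΩ k)).trans subset_closure)
  · have h1 := hψv k x 0 B₀ fun y _ => by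
      rw [sub_zero]; exact (hgle k y).trans (hB₀ y)
    rw [sub_zero] at h1
    have h2 := norm_sub_le (ψ k x) (f x)
    have h3 := hB₀ x
    rw [Real.norm_eq_abs (ψ k x)] at h2
    have := L.coe_nonneg
    linarith
  · have h1 := hψd k x 0 (2 * L) (e k) (half_lt_self (hepos k)) (by positivity) fun y _ z _ => by
      have := (hglip k).dist_le_mul y z
      rw [Real.dist_eq, dist_eq_norm] at this
      simpa using this
    rw [sub_zero] at h1
    have h2 := norm_sub_le (fderiv ℝ (ψ k) x) (fderiv ℝ f x)
    have h3 := norm_fderiv_le_of_lipschitz ℝ hL (x₀ := x)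
    have h4 : 0 ≤ B₀ := (norm_nonneg _).trans (hB₀ x)
    linarith
  · obtain ⟨p, hp, hfp⟩ := hf.2 T hT
    have hev := eventually_eq_of_mem_interior hfp hx
    have hxΩ := M.interior_elem_subset hT hx
    have hDx := hDpos x hxΩ
    obtain ⟨s₀, hs₀, hs₀f⟩ := Metric.eventually_nhds_iff_ball.1 hev
    have hgnear : ∀ᶠ k in atTop, ∀ y ∈ Metric.ball x (D x / 2), g k y = f y := by
      have h1 : ∀ᶠ k in atTop, e k < D x / 4 := he0.eventually (gt_mem_nhds (by linarith))
      filter_upwards [h1] with k hk y hy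
      refine hgeq k y ?_
      have h2 := hDlip.dist_le_mul y x
      rw [Metric.mem_ball] at hy
      rw [Real.dist_eq, NNReal.coe_one, one_mul] at h2
      linarith [neg_abs_le (D y - D x)]
    constructor
    · rw [Metric.tendsto_atTop']
      intro ε hε
      obtain ⟨s₁, hs₁, hs₁f⟩ := Metric.continuousAt_iff.1 hfc.continuousAt (ε / 2) (half_pos hε)
      have h1 : ∀ᶠ k in atTop, e k < min (D x / 2) s₁ :=
        he0.eventually (gt_mem_nhds (lt_min (by linarith) hs₁))
      obtain ⟨k₀, hk₀⟩ := (h1.and hgnear).exists_forall_of_atTop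
      refine ⟨k₀, fun k hk => ?_⟩
      obtain ⟨h2, h3⟩ := hk₀ k hk.le
      rw [Real.dist_eq]
      refine lt_of_le_of_lt (hψv k x (f x) (ε / 2) fun y hy => ?_) (half_lt_self hε)
      rw [Metric.mem_ball] at hy
      have h4 := min_le_left (D x / 2) s₁
      have h5 := min_le_right (D x / 2) s₁
      rw [h3 y (by rw [Metric.mem_ball]; linarith [hepos k])]
      exact (hs₁f (by linarith [hepos k])).le
    · rw [hev.fderiv_eq, Metric.tendsto_atTop']
      intro ε hε
      obtain ⟨s₁, hs₁, hs₁f⟩ := exists_ball_abs_sub_le hp.contDiff x (half_pos hε)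
      set s := min (min (D x / 2) s₁) s₀ with hs
      have hspos : 0 < s := lt_min (lt_min (by linarith) hs₁) hs₀
      obtain ⟨k₀, hk₀⟩ := ((he0.eventually (gt_mem_nhds hspos)).and hgnear).exists_forall_of_atTop
      refine ⟨k₀, fun k hk => ?_⟩
      obtain ⟨h2, h3⟩ := hk₀ k hk.le
      rw [dist_eq_norm]
      refine lt_of_le_of_lt (hψd k x (fderiv ℝ p x) (ε / 2) s (by linarith [hepos k])
        (by positivity) fun y hy z hz => ?_) (half_lt_self hε)
      have hb : ∀ y ∈ Metric.ball x s, g k y = p y ∧ y ∈ Metric.ball x s₁ := fun y hy => by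
        have e1 : s ≤ D x / 2 := (min_le_left _ _).trans (min_le_left _ _)
        have e2 : s ≤ s₁ := (min_le_left _ _).trans (min_le_right _ _)
        have e3 : s ≤ s₀ := min_le_right _ _
        rw [h3 y (Metric.ball_subset_ball e1 hy), hs₀f y (Metric.ball_subset_ball e3 hy)]
        exact ⟨rfl, Metric.ball_subset_ball e2 hy⟩
      rw [(hb y hy).1, (hb z hz).1]
      exact hs₁f y (hb y hy).2 z (hb z hz).2

/-! ### Components of matrix fields -/

/-- The `i`-th row of a matrix, as a linear form. -/
def row {N n : ℕ} (i : Fin N) : Mat N n →L[ℝ] (Pt n →L[ℝ] ℝ) :=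
  ∑ j : Fin n, (EuclideanSpace.proj (i, j) : Mat N n →L[ℝ] ℝ).smulRight
    (EuclideanSpace.proj j : Pt n →L[ℝ] ℝ)

section
variable {N n : ℕ}

lemma row_apply (A : Mat N n) (i : Fin N) (d : Pt n) : row i A d = ∑ j, A (i, j) * d j := by
  simp [row]

lemma row_single (A : Mat N n) (i : Fin N) (j : Fin n) :
    row i A (EuclideanSpace.single j 1) = A (i, j) := by
  rw [row_apply]
  simp

lemma clm_ext_single {ℓ ℓ' : Pt n →L[ℝ] ℝ}
    (h : ∀ j, ℓ (EuclideanSpace.single j 1) = ℓ' (EuclideanSpace.single j 1)) : ℓ = ℓ' := by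
  refine ContinuousLinearMap.coe_injective ((EuclideanSpace.basisFun (Fin n) ℝ).toBasis.ext fun j => ?_)
  simpa using h j

lemma norm_row_le (A : Mat N n) (i : Fin N) : ‖row i A‖ ≤ n * ‖A‖ := by
  refine ContinuousLinearMap.opNorm_le_bound _ (by positivity) fun d => ?_
  rw [row_apply]
  calc ‖∑ j, A (i, j) * d j‖ ≤ ∑ j : Fin n, ‖A (i, j) * d j‖ := norm_sum_le _ _
    _ ≤ ∑ _j : Fin n, ‖A‖ * ‖d‖ := Finset.sum_le_sum fun j _ => by
        rw [norm_mul]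
        exact mul_le_mul (PiLp.norm_apply_le A _) (PiLp.norm_apply_le d _) (norm_nonneg _)
          (norm_nonneg _)
    _ = n * ‖A‖ * ‖d‖ := by simp [mul_assoc]

lemma norm_le_sum_row (A : Mat N n) : ‖A‖ ≤ n * ∑ i, ‖row i A‖ := by
  have h1 : A = ∑ k, A k • EuclideanSpace.basisFun (Fin N × Fin n) ℝ k := by
    have := (EuclideanSpace.basisFun (Fin N × Fin n) ℝ).sum_repr A
    simpa using this.symm
  calc ‖A‖ = ‖∑ k, A k • EuclideanSpace.basisFun (Fin N × Fin n) ℝ k‖ := by rw [← h1]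
    _ ≤ ∑ k, ‖A k • EuclideanSpace.basisFun (Fin N × Fin n) ℝ k‖ := norm_sum_le _ _
    _ = ∑ i : Fin N, ∑ j : Fin n, ‖A (i, j)‖ := by
        rw [← Finset.univ_product_univ, Finset.sum_product]
        simp [norm_smul]
    _ ≤ ∑ i : Fin N, ∑ _j : Fin n, ‖row i A‖ := Finset.sum_le_sum fun i _ =>
        Finset.sum_le_sum fun j _ => by
          rw [← row_single]
          simpa using (row i A).le_opNorm (EuclideanSpace.single j 1)
    _ = n * ∑ i, ‖row i A‖ := by simp [Finset.mul_sum]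

lemma row_grad {φ : Pt n → Pt N} {x : Pt n} (hφ : DifferentiableAt ℝ φ x) (i : Fin N) :
    row i (grad φ x) = fderiv ℝ (fun y => φ y i) x := by
  refine clm_ext_single fun j => ?_
  rw [row_single]
  have h1 : fderiv ℝ (fun y => φ y i) x =
      (EuclideanSpace.proj i : Pt N →L[ℝ] ℝ).comp (fderiv ℝ φ x) :=
    ((EuclideanSpace.proj i : Pt N →L[ℝ] ℝ).hasFDerivAt.comp x
      hφ.hasFDerivAt).fderiv
  rw [h1]
  rfl

end

/-! ### Weak gradients -/

section
variable {N n : ℕ} {Ω U : Set (Pt n)}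

lemma IsTest.integrable_mul {g f : Pt n → ℝ} (hg : IsTest U g) (hf : LocallyIntegrableOn f U) :
    Integrable fun x => f x * g x := by
  obtain ⟨hs, hc, hsub⟩ := hg
  have h1 : IntegrableOn f (tsupport g) := hf.integrableOn_compact_subset hsub hc
  obtain ⟨B, hB⟩ := hc.exists_bound_of_continuous hs.continuous
  have h2 : IntegrableOn (fun x => f x * g x) (tsupport g) :=
    Integrable.mul_bdd h1 hs.continuous.aestronglyMeasurable (ae_of_all _ hB)
  rwa [integrableOn_iff_integrable_of_support_subset] at h2
  intro x hx
  by_contra hnot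
  exact hx (by simp [image_eq_zero_of_notMem_tsupport hnot])

lemma IsTest.setIntegral_mul {g : Pt n → ℝ} (hg : IsTest U g) (hU : U ⊆ Ω) (f : Pt n → ℝ) :
    ∫ x in Ω, f x * g x = ∫ x, f x * g x :=
  setIntegral_eq_integral_of_forall_compl_eq_zero fun x hx => by
    rw [image_eq_zero_of_notMem_tsupport fun h => hx (hU (hg.2.2 h)), mul_zero]

lemma IsTest.mono {g : Pt n → ℝ} (hg : IsTest U g) (hU : U ⊆ Ω) : IsTest Ω g :=
  ⟨hg.1, hg.2.1, hg.2.2.trans hU⟩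

lemma IsTest.fderiv_apply {g : Pt n → ℝ} (hg : IsTest U g) (d : Pt n) :
    IsTest U fun x => fderiv ℝ g x d := by
  refine ⟨?_, hg.2.1.fderiv_apply (𝕜 := ℝ) d, (closure_mono fun x hx => ?_).trans
    ((isClosed_tsupport g).closure_eq.subset.trans hg.2.2)⟩
  · exact (hg.1.fderiv_right (m := ∞) (by simp)).clm_apply contDiff_const
  · refine support_fderiv_subset ℝ fun h0 => hx ?_
    simp [h0]

lemma ae_eq_zero_of_test {f : Pt n → ℝ} (hU : IsOpen U) (hf : LocallyIntegrableOn f U)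
    (h : ∀ g, IsTest U g → ∫ x, f x * g x = 0) : ∀ᵐ x, x ∈ U → f x = 0 :=
  hU.ae_eq_zero_of_integral_contDiff_smul_eq_zero hf fun g h1 h2 h3 => by
    simpa [mul_comm] using h g ⟨h1, h2, h3⟩

lemma locallyIntegrableOn_apply {ι : Type*} [Fintype ι] {G : Pt n → EuclideanSpace ℝ ι}
    (hG : LocallyIntegrableOn G U) (k : ι) : LocallyIntegrableOn (fun x => G x k) U := fun x hx => by
  obtain ⟨t, ht, hi⟩ := hG x hx
  exact ⟨t, ht, (EuclideanSpace.proj k : EuclideanSpace ℝ ι →L[ℝ] ℝ).integrable_comp hi⟩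

/-- The fundamental lemma of the calculus of variations, applied to each entry. It makes the choice
in `weakGrad` immaterial. -/
lemma HasWeakGrad.ae_eq {v : Pt n → Pt N} {G G' : Pt n → Mat N n} (hΩ : IsOpen Ω)
    (h : HasWeakGrad Ω v G) (h' : HasWeakGrad Ω v G') : G =ᵐ[volume.restrict Ω] G' := by
  have key : ∀ k : Fin N × Fin n, ∀ᵐ x, x ∈ Ω → G x k - G' x k = 0 := by
    rintro ⟨i, j⟩
    have l1 := locallyIntegrableOn_apply h.2.1 (i, j)
    have l2 := locallyIntegrableOn_apply h'.2.1 (i, j)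
    refine ae_eq_zero_of_test hΩ (l1.sub l2) fun g hg => ?_
    have h1 := h.2.2 g hg i j
    rw [h'.2.2 g hg i j, hg.setIntegral_mul subset_rfl, hg.setIntegral_mul subset_rfl] at h1
    simp only [sub_mul]
    rw [integral_sub (hg.integrable_mul l1) (hg.integrable_mul l2)]
    linarith
  rw [Filter.EventuallyEq, ae_restrict_iff' hΩ.measurableSet]
  filter_upwards [ae_all_iff.2 key] with x hx hxΩ
  ext k
  exact sub_eq_zero.1 (hx k hxΩ)

lemma HasWeakGrad.ae_eq_weakGrad {v : Pt n → Pt N} {G : Pt n → Mat N n} (hΩ : IsOpen Ω)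
    (h : HasWeakGrad Ω v G) : weakGrad Ω v =ᵐ[volume.restrict Ω] G := by
  have hex : ∃ G, HasWeakGrad Ω v G := ⟨G, h⟩
  rw [weakGrad, dif_pos hex]
  exact hex.choose_spec.ae_eq hΩ h

/-- The weak gradient is local and agrees with the classical one. -/
lemma HasWeakGrad.ae_row_eq {v : Pt n → Pt N} {G : Pt n → Mat N n} (h : HasWeakGrad Ω v G)
    (hU : IsOpen U) (hUΩ : U ⊆ Ω) {p : Pt n → ℝ} (hp : ContDiff ℝ 1 p) {i : Fin N}
    (hvp : ∀ᵐ x, x ∈ U → v x i = p x) : ∀ᵐ x, x ∈ U → row i (G x) = fderiv ℝ p x := by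
  have key : ∀ j : Fin n, ∀ᵐ x, x ∈ U →
      G x (i, j) - fderiv ℝ p x (EuclideanSpace.single j 1) = 0 := by
    intro j
    have hpc : Continuous fun x => fderiv ℝ p x (EuclideanSpace.single j 1) :=
      (hp.continuous_fderiv (by simp)).clm_apply continuous_const
    have l1 := (locallyIntegrableOn_apply h.2.1 (i, j)).mono_set hUΩ
    have l2 := hpc.locallyIntegrable.locallyIntegrableOn (μ := volume) U
    refine ae_eq_zero_of_test hU (l1.sub l2) fun g hg => ?_
    have hgd := hg.fderiv_apply (EuclideanSpace.single j 1)
    have h1 := h.2.2 g (hg.mono hUΩ) i j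
    rw [hg.setIntegral_mul hUΩ, hgd.setIntegral_mul hUΩ] at h1
    have h2 : ∫ x, v x i * fderiv ℝ g x (EuclideanSpace.single j 1) =
        ∫ x, p x * fderiv ℝ g x (EuclideanSpace.single j 1) := by
      refine integral_congr_ae ?_
      filter_upwards [hvp] with x hx
      by_cases hxU : x ∈ U
      · simp only [hx hxU]
      · have h0 := image_eq_zero_of_notMem_tsupport fun h => hxU (hgd.2.2 h)
        simp only [h0, mul_zero]
    have lp := hp.continuous.locallyIntegrable.locallyIntegrableOn (μ := volume) U
    rw [h2, integral_mul_fderiv_eq_neg_fderiv_mul_of_integrable (hg.integrable_mul l2)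
      (hgd.integrable_mul lp) (hg.integrable_mul lp)
      (fun x _ => (hp.differentiable (by simp)) x)
      (fun x _ => (hg.1.differentiable (by simp)) x)] at h1
    simp only [sub_mul]
    rw [integral_sub (hg.integrable_mul l1) (hg.integrable_mul l2)]
    linarith
  filter_upwards [ae_all_iff.2 key] with x hx hxU
  refine clm_ext_single fun j => ?_
  rw [row_single]
  exact sub_eq_zero.1 (hx j hxU)

/-- Convergence in `W^{1,q}_0(Ω)` implies componentwise convergence in `W^{1,1}_0(Ω)`. -/
lemma MemW0.exists_isW0Limit {q : ℝ≥0∞} {v : Pt n → Pt N} (hv : MemW0 Ω q v) (hq : 1 ≤ q)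
    (hΩ : IsOpen Ω) (hΩt : volume Ω ≠ ⊤) :
    MemLp (weakGrad Ω v) 1 (volume.restrict Ω) ∧ MemLp v 1 (volume.restrict Ω) ∧
    HasWeakGrad Ω v (weakGrad Ω v) ∧
    ∃ φ : ℕ → Pt n → Pt N, (∀ k, IsTest Ω (φ k)) ∧
      ∀ i, IsW0Limit Ω (fun x => v x i) (fun x => row i (weakGrad Ω v x)) fun k x => φ k x i := by
  obtain ⟨G, hG, hvq, hGq, φ, hφ, ht, htg⟩ := hv
  have hex : ∃ G, HasWeakGrad Ω v G := ⟨G, hG⟩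
  have hw : HasWeakGrad Ω v (weakGrad Ω v) := by
    rw [weakGrad, dif_pos hex]; exact hex.choose_spec
  have hae := hG.ae_eq_weakGrad hΩ
  have : IsFiniteMeasure (volume.restrict Ω) := ⟨by simpa using hΩt.lt_top⟩
  have hG1 := hGq.mono_exponent hq
  have hv1 := hvq.mono_exponent hq
  have hwG1 : MemLp (weakGrad Ω v) 1 (volume.restrict Ω) := (memLp_congr_ae hae).2 hG1
  refine ⟨hwG1, hv1, hw, φ, hφ, fun i => ?_⟩
  have hφd : ∀ k, ContDiff ℝ 1 (φ k) := fun k => (hφ k).1.of_le (by simp)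
  have hgc : ∀ k, Continuous (grad (φ k)) := fun k => by
    have h1 := (hφd k).continuous_fderiv (by simp)
    unfold grad
    fun_prop
  -- Hölder's inequality on a set of finite measure passes from the exponent `q`, possibly `⊤`, to
  -- 1.
  have key : ∀ {F : Type} [NormedAddCommGroup F] (f : ℕ → Pt n → F),
      (∀ k, AEStronglyMeasurable (f k) (volume.restrict Ω)) →
      Tendsto (fun k => eLpNorm (f k) q (volume.restrict Ω)) atTop (𝓝 0) →
      Tendsto (fun k => ∫⁻ x in Ω, ‖f k x‖ₑ) atTop (𝓝 0) := by
    intro F _ f hm hf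
    have h1 : ∀ k, ∫⁻ x in Ω, ‖f k x‖ₑ ≤ eLpNorm (f k) q (volume.restrict Ω) *
        volume.restrict Ω Set.univ ^ (1 / (1 : ℝ≥0∞).toReal - 1 / q.toReal) := fun k => by
      rw [← eLpNorm_one_eq_lintegral_enorm]
      exact eLpNorm_le_eLpNorm_mul_rpow_measure_univ hq (hm k)
    refine tendsto_of_tendsto_of_tendsto_of_le_of_le tendsto_const_nhds ?_ (fun _ => zero_le) h1
    have h2 := ENNReal.Tendsto.mul_const
      (b := volume.restrict Ω Set.univ ^ (1 / (1 : ℝ≥0∞).toReal - 1 / q.toReal)) hf (Or.inr ?_)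
    · simpa using h2
    · refine ENNReal.rpow_ne_top_of_nonneg ?_ (measure_ne_top _ _)
      rcases eq_or_ne q ⊤ with rfl | hqt
      · simp
      · have : 1 ≤ q.toReal := by
          rw [← ENNReal.toReal_one]; exact ENNReal.toReal_mono hqt hq
        rw [ENNReal.toReal_one, sub_nonneg, one_div, one_div]
        exact inv_anti₀ one_pos this
  have t1 := key (fun k x => v x - φ k x) (fun k => hvq.1.sub (hφd k).continuous.aestronglyMeasurable) ht
  have t2 := key (fun k x => G x - grad (φ k) x) (fun k => hGq.1.sub (hgc k).aestronglyMeasurable) htg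
  refine ⟨fun k => ?_, fun k x hx => ?_, ?_, ?_, ?_, ?_⟩
  · have := hφd k
    fun_prop
  · rw [image_eq_zero_of_notMem_tsupport fun h => hx ((hφ k).2.2 h)]; rfl
  · exact (EuclideanSpace.proj i : Pt N →L[ℝ] ℝ).integrable_comp
      (memLp_one_iff_integrable.1 hv1)
  · exact (row i).continuous.comp_aestronglyMeasurable hwG1.1
  · refine tendsto_of_tendsto_of_tendsto_of_le_of_le tendsto_const_nhds t1 (fun _ => zero_le)
      fun k => lintegral_mono fun x => ?_
    rw [← ofReal_norm, ← ofReal_norm]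
    refine ENNReal.ofReal_le_ofReal ?_
    rw [norm_sub_rev]
    exact PiLp.norm_apply_le (v x - φ k x) i
  · have t3 := ENNReal.Tendsto.const_mul (a := (n : ℝ≥0∞)) t2 (Or.inr (by simp))
    rw [mul_zero] at t3
    refine tendsto_of_tendsto_of_tendsto_of_le_of_le tendsto_const_nhds t3 (fun _ => zero_le)
      fun k => ?_
    rw [← lintegral_const_mul' _ _ (by simp)]
    refine lintegral_mono_ae ?_
    filter_upwards [hae] with x hx
    have hd : DifferentiableAt ℝ (φ k) x := ((hφd k).differentiable (by simp)) x
    rw [hx, ← row_grad hd, ← map_sub, ← ofReal_norm, ← ofReal_norm, ← ENNReal.ofReal_natCast,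
      ← ENNReal.ofReal_mul (by positivity), norm_sub_rev (G x)]
    exact ENNReal.ofReal_le_ofReal (norm_row_le _ i)

end

/-! ### The finite element space inside `W^{1,1}_0` -/

section
variable {N n r : ℕ} {c h : ℝ} {Ω : Set (Pt n)} {𝒯 : Finset (Finset (Pt n))}

lemma IsMesh.ae_mem_interior (M : IsMesh c h Ω 𝒯) :
    ∀ᵐ x, x ∈ Ω → ∃ T ∈ 𝒯, x ∈ interior (elem T) := by
  have h0 : ∀ᵐ x, ∀ T ∈ 𝒯, x ∉ frontier (elem T) :=
    (ae_ball_iff 𝒯.countable_toSet).2 fun T _ => measure_eq_zero_iff_ae_notMem.1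
      (volume_frontier_elem T)
  filter_upwards [h0] with x hx hxΩ
  obtain ⟨T, hT, hxT⟩ := M.tri.exists_mem (subset_closure hxΩ)
  refine ⟨T, hT, ?_⟩
  by_contra hi
  refine hx T hT ?_
  rw [(isClosed_elem T).frontier_eq]
  exact ⟨hxT, hi⟩

/-- Mean difference estimate for smooth functions with almost bounded gradient. -/
lemma lintegral_ball_sub_le {φ : Pt n → ℝ} (hφ : ContDiff ℝ 1 φ) {L : ℝ≥0∞} {k : Pt n → ℝ≥0∞}
    (hk : ∀ᵐ x, ‖fderiv ℝ φ x‖ₑ ≤ L + k x) (x y : Pt n) (B : Set (Pt n)) :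
    ∫⁻ t in B, ‖φ (x + t) - φ (y + t)‖ₑ ≤ ‖y - x‖ₑ * (L * volume B + ∫⁻ t, k t) := by
  have hfc : Continuous (fderiv ℝ φ) := hφ.continuous_fderiv (by simp)
  have hz : ∀ z : Pt n, ∫⁻ t in B, ‖fderiv ℝ φ (z + t)‖ₑ ≤ L * volume B + ∫⁻ t, k t := by
    intro z
    have h1 : ∀ᵐ t, ‖fderiv ℝ φ (z + t)‖ₑ ≤ L + k (z + t) :=
      (measurePreserving_add_left volume z).quasiMeasurePreserving.ae hk
    calc ∫⁻ t in B, ‖fderiv ℝ φ (z + t)‖ₑ ≤ ∫⁻ t in B, (L + k (z + t)) :=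
          lintegral_mono_ae (ae_restrict_of_ae h1)
      _ = L * volume B + ∫⁻ t in B, k (z + t) := by
          rw [lintegral_add_left measurable_const, setLIntegral_const]
      _ ≤ L * volume B + ∫⁻ t, k (z + t) := add_le_add le_rfl (setLIntegral_le_lintegral _ _)
      _ = _ := by rw [lintegral_add_left_eq_self]
  calc ∫⁻ t in B, ‖φ (x + t) - φ (y + t)‖ₑ
      ≤ ∫⁻ t in B, ‖y - x‖ₑ * ∫⁻ s in Set.Icc (0 : ℝ) 1,
          ‖fderiv ℝ φ (((1 - s) • x + s • y) + t)‖ₑ := by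
        refine lintegral_mono fun t => (enorm_sub_le_lintegral_fderiv hφ _ _).trans (le_of_eq ?_)
        rw [add_sub_add_right_eq_sub]
        congr 1
        refine lintegral_congr fun s => ?_
        rw [show (1 - s) • (x + t) + s • (y + t) = (1 - s) • x + s • y + t by module]
    _ = ‖y - x‖ₑ * ∫⁻ s in Set.Icc (0 : ℝ) 1, ∫⁻ t in B,
          ‖fderiv ℝ φ (((1 - s) • x + s • y) + t)‖ₑ := by
        rw [lintegral_const_mul' _ _ (by simp), lintegral_lintegral_swap]
        refine Continuous.aemeasurable ?_
        refine (hfc.comp ?_).enorm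
        fun_prop
    _ ≤ ‖y - x‖ₑ * ∫⁻ _s in Set.Icc (0 : ℝ) 1, (L * volume B + ∫⁻ t, k t) :=
        mul_le_mul' le_rfl (lintegral_mono fun s => hz _)
    _ = _ := by simp

/-- A Sobolev limit of test functions that is piecewise polynomial agrees almost everywhere with a
finite element function. -/
lemma exists_isFE_of_limit (M : IsMesh c h Ω 𝒯) {f : Pt n → ℝ} {G : Pt n → Pt n →L[ℝ] ℝ}
    {φ : ℕ → Pt n → ℝ} (H : IsW0Limit Ω f G φ) (hφ : ∀ k, ∀ x ∉ Ω, fderiv ℝ (φ k) x = 0)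
    {p : Finset (Pt n) → Pt n → ℝ} (hp : ∀ T ∈ 𝒯, IsPoly r (p T))
    (hfp : ∀ T ∈ 𝒯, ∀ᵐ x, x ∈ interior (elem T) → f x = p T x)
    (hGp : ∀ T ∈ 𝒯, ∀ᵐ x, x ∈ interior (elem T) → G x = fderiv ℝ (p T) x) :
    ∃ F, IsFE r Ω 𝒯 F ∧ ∀ T ∈ 𝒯, ∀ x ∈ elem T, F x = p T x := by
  classical
  have hbd : ∀ T ∈ 𝒯, ∃ L : ℝ≥0, ∀ x ∈ elem T, ‖fderiv ℝ (p T) x‖ₑ ≤ L := fun T hT => by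
    have h1 : Continuous (fderiv ℝ (p T)) := (hp T hT).contDiff.continuous_fderiv (n := ⊤) (by simp)
    obtain ⟨B, hB⟩ := (isCompact_elem T).exists_bound_of_continuousOn h1.continuousOn
    refine ⟨B.toNNReal, fun x hx => ?_⟩
    rw [← ofReal_norm]
    exact ENNReal.ofReal_le_ofReal (hB x hx)
  choose! Lf hLf using hbd
  set L : ℝ≥0 := 𝒯.sup Lf with hL
  have hGL : ∀ᵐ x, x ∈ Ω → ‖G x‖ₑ ≤ L := by
    filter_upwards [M.ae_mem_interior, (ae_ball_iff 𝒯.countable_toSet).2 hGp] with x hx hxG hxΩ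
    obtain ⟨T, hT, hxT⟩ := hx hxΩ
    rw [hxG T hT hxT]
    refine (hLf T hT x (interior_subset hxT)).trans ?_
    exact_mod_cast Finset.le_sup (f := Lf) hT
  -- The gradient of `φ k` exceeds `L` only by an error that tends to 0 in L¹, and it vanishes
  -- outside `Ω`. As this holds on the whole space, segments that leave `Ω` do no harm.
  have hk : ∀ k, ∀ᵐ x, ‖fderiv ℝ (φ k) x‖ₑ ≤
      L + Ω.indicator (fun x => ‖fderiv ℝ (φ k) x - G x‖ₑ) x := by
    intro k
    filter_upwards [hGL] with x hx
    by_cases hxΩ : x ∈ Ω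
    · rw [Set.indicator_of_mem hxΩ, add_comm]
      have h1 := enorm_add_le (fderiv ℝ (φ k) x - G x) (G x)
      rw [sub_add_cancel] at h1
      exact h1.trans (add_le_add le_rfl (hx hxΩ))
    · rw [← ofReal_norm, hφ k x hxΩ, norm_zero, ENNReal.ofReal_zero]; exact zero_le
  set g : Pt n → ℝ := Ω.indicator f with hg
  have hge : ∀ k, ∫⁻ x, ‖φ k x - g x‖ₑ = ∫⁻ x in Ω, ‖φ k x - f x‖ₑ := by
    intro k
    rw [← lintegral_indicator M.isOpen.measurableSet]
    refine lintegral_congr fun x => ?_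
    by_cases hxΩ : x ∈ Ω
    · simp [hg, hxΩ]
    · simp [hg, hxΩ, H.eq_zero k x hxΩ]
  -- `A x q` entails that near `x` the extension of `f` by zero equals `q` almost everywhere. The
  -- points without such a `q` lie on the boundaries of elements.
  let A : Pt n → (Pt n → ℝ) → Prop := fun x q =>
    (∃ T ∈ 𝒯, x ∈ interior (elem T) ∧ q = p T) ∨ (x ∉ closure Ω ∧ q = 0)
  have hAcont : ∀ x q, A x q → Continuous q := by
    rintro x q (⟨T, hT, -, rfl⟩ | ⟨-, rfl⟩)
    · exact (hp T hT).continuous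
    · exact continuous_const
  have hAae : ∀ x q, A x q → ∃ δ > 0, ∀ᵐ y, y ∈ Metric.ball x δ → g y = q y := by
    rintro x q (⟨T, hT, hx, rfl⟩ | ⟨hx, rfl⟩)
    · obtain ⟨δ, hδ, hsub⟩ := Metric.isOpen_iff.1 isOpen_interior x hx
      refine ⟨δ, hδ, ?_⟩
      filter_upwards [hfp T hT] with y hy hyb
      rw [hg, Set.indicator_of_mem (M.interior_elem_subset hT (hsub hyb)), hy (hsub hyb)]
    · obtain ⟨δ, hδ, hsub⟩ := Metric.isOpen_iff.1 isClosed_closure.isOpen_compl x hx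
      refine ⟨δ, hδ, ae_of_all _ fun y hyb => ?_⟩
      rw [hg, Set.indicator_of_notMem fun hy => hsub hyb (subset_closure hy)]
      rfl
  have key : ∀ x y q q', A x q → A y q' → |q x - q' y| ≤ L * ‖x - y‖ := by
    intro x y q q' hx hy
    by_contra hlt
    push Not at hlt
    -- A violation of the Lipschitz bound persists, with the margin `m`, under all small common
    -- translations of `x` and `y`. Integrating over these translations involves only the L¹
    -- convergence of `φ k` and of its gradient.
    obtain ⟨m, hm1, hm2⟩ := exists_between hlt
    have hm0 : 0 ≤ m := le_trans (by positivity) hm1.le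
    obtain ⟨δ₁, hδ₁, h1⟩ := hAae x q hx
    obtain ⟨δ₂, hδ₂, h2⟩ := hAae y q' hy
    have hcont : Continuous fun t : Pt n => |q (x + t) - q' (y + t)| :=
      (((hAcont x q hx).comp (continuous_const.add continuous_id)).sub
        ((hAcont y q' hy).comp (continuous_const.add continuous_id))).abs
    have hev : ∀ᶠ t in 𝓝 (0 : Pt n), m < |q (x + t) - q' (y + t)| :=
      hcont.continuousAt.eventually (lt_mem_nhds (by simpa using hm2))
    obtain ⟨δ₃, hδ₃, h3⟩ := Metric.eventually_nhds_iff_ball.1 hev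
    set δ := min δ₃ (min δ₁ δ₂) with hδ
    have hδ0 : 0 < δ := lt_min hδ₃ (lt_min hδ₁ hδ₂)
    set B := Metric.ball (0 : Pt n) δ with hB
    have hB0 : volume B ≠ 0 := (Metric.measure_ball_pos volume _ hδ0).ne'
    have hBt : volume B ≠ ⊤ := measure_ball_lt_top.ne
    have hBm : MeasurableSet B := measurableSet_ball
    have haeq : ∀ (x : Pt n) (q : Pt n → ℝ) (δ' : ℝ), δ ≤ δ' →
        (∀ᵐ y, y ∈ Metric.ball x δ' → g y = q y) → ∀ᵐ t, t ∈ B → g (x + t) = q (x + t) := by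
      intro x q δ' hδ' hq
      filter_upwards [(measurePreserving_add_left volume x).quasiMeasurePreserving.ae hq] with t ht htB
      refine ht ?_
      rw [hB, mem_ball_zero_iff] at htB
      simpa [dist_eq_norm] using lt_of_lt_of_le htB hδ'
    have hgx := haeq x q δ₁ ((min_le_right _ _).trans (min_le_left _ _)) h1
    have hgy := haeq y q' δ₂ ((min_le_right _ _).trans (min_le_right _ _)) h2
    have hup : ∀ k, ENNReal.ofReal m * volume B ≤
        (∫⁻ x in Ω, ‖φ k x - f x‖ₑ) + (‖y - x‖ₑ * (L * volume B +
          ∫⁻ x in Ω, ‖fderiv ℝ (φ k) x - G x‖ₑ) + ∫⁻ x in Ω, ‖φ k x - f x‖ₑ) := by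
      intro k
      have hφc := (H.contDiff k).continuous
      have hm1 : Measurable fun t => ‖φ k (x + t) - φ k (y + t)‖ₑ :=
        ((hφc.comp (continuous_const.add continuous_id)).sub
          (hφc.comp (continuous_const.add continuous_id))).enorm.measurable
      calc ENNReal.ofReal m * volume B = ∫⁻ _t in B, ENNReal.ofReal m := by
            rw [setLIntegral_const]
        _ ≤ ∫⁻ t in B, (‖φ k (x + t) - g (x + t)‖ₑ + (‖φ k (x + t) - φ k (y + t)‖ₑ +
              ‖φ k (y + t) - g (y + t)‖ₑ)) := by
            refine setLIntegral_mono_ae' hBm ?_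
            filter_upwards [hgx, hgy] with t htx hty htB
            have e1 := h3 t (Metric.ball_subset_ball (min_le_left _ _) htB)
            rw [← htx htB, ← hty htB] at e1
            refine (ENNReal.ofReal_le_ofReal e1.le).trans ?_
            rw [← Real.norm_eq_abs, ofReal_norm]
            have e2 : g (x + t) - g (y + t) = -(φ k (x + t) - g (x + t)) +
                ((φ k (x + t) - φ k (y + t)) + (φ k (y + t) - g (y + t))) := by ring
            rw [e2]
            refine (enorm_add_le _ _).trans (add_le_add (enorm_neg _).le (enorm_add_le _ _))
        _ ≤ (∫⁻ t in B, ‖φ k (x + t) - g (x + t)‖ₑ) +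
            ((∫⁻ t in B, ‖φ k (x + t) - φ k (y + t)‖ₑ) +
              ∫⁻ t in B, ‖φ k (y + t) - g (y + t)‖ₑ) := by
            have hgm : AEMeasurable (fun z => ‖φ k z - g z‖ₑ) volume := by
              refine (hφc.aestronglyMeasurable.sub ?_).enorm
              exact (aestronglyMeasurable_indicator_iff M.isOpen.measurableSet).2
                H.integrableOn.aestronglyMeasurable
            have hgm' : AEMeasurable (fun t => ‖φ k (x + t) - g (x + t)‖ₑ) (volume.restrict B) :=
              (hgm.comp_quasiMeasurePreserving
                (measurePreserving_add_left volume x).quasiMeasurePreserving).restrict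
            rw [lintegral_add_left' hgm', lintegral_add_left hm1]
        _ ≤ _ := by
            refine add_le_add ?_ (add_le_add ?_ ?_)
            · refine (setLIntegral_le_lintegral _ _).trans (le_of_eq ?_)
              rw [lintegral_add_left_eq_self (fun z => ‖φ k z - g z‖ₑ), hge]
            · have e3 := lintegral_ball_sub_le (H.contDiff k) (hk k) x y B
              rwa [lintegral_indicator M.isOpen.measurableSet] at e3
            · refine (setLIntegral_le_lintegral _ _).trans (le_of_eq ?_)
              rw [lintegral_add_left_eq_self (fun z => ‖φ k z - g z‖ₑ), hge]
    have hlim : Tendsto (fun k => (∫⁻ x in Ω, ‖φ k x - f x‖ₑ) + (‖y - x‖ₑ * (L * volume B +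
          ∫⁻ x in Ω, ‖fderiv ℝ (φ k) x - G x‖ₑ) + ∫⁻ x in Ω, ‖φ k x - f x‖ₑ)) atTop
        (𝓝 (0 + (‖y - x‖ₑ * (L * volume B + 0) + 0))) :=
      H.tendsto.add ((ENNReal.Tendsto.const_mul (tendsto_const_nhds.add H.tendsto_grad)
        (Or.inr (by simp))).add H.tendsto)
    have hfin := ge_of_tendsto' hlim hup
    rw [zero_add, add_zero, add_zero, ← mul_assoc, ENNReal.mul_le_mul_iff_left hB0 hBt,
      ← ofReal_norm, ← ENNReal.ofReal_coe_nnreal, ← ENNReal.ofReal_mul (norm_nonneg _),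
      ENNReal.ofReal_le_ofReal_iff (by positivity), norm_sub_rev] at hfin
    linarith [mul_comm ‖x - y‖ (L : ℝ)]
  -- By `key` with `y = x` the value does not depend on the choice of `q`, and `F₀` is Lipschitz on
  -- the set where it is given by some `q`. A Lipschitz extension then agrees with `p T` on all of
  -- `elem T`, by density of the interior.
  let F₀ : Pt n → ℝ := fun x => if hx : ∃ q, A x q then hx.choose x else 0
  have hF₀ : ∀ x q, A x q → F₀ x = q x := by
    intro x q hq
    have hex : ∃ q, A x q := ⟨q, hq⟩
    have h1 := key x x _ _ hex.choose_spec hq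
    simp only [F₀, dif_pos hex]
    rw [sub_self, norm_zero, mul_zero, abs_nonpos_iff, sub_eq_zero] at h1
    exact h1
  have hlip : LipschitzOnWith L F₀ {x | ∃ q, A x q} := by
    refine LipschitzOnWith.of_dist_le_mul ?_
    rintro x ⟨q, hq⟩ y ⟨q', hq'⟩
    rw [hF₀ x q hq, hF₀ y q' hq', Real.dist_eq, dist_eq_norm]
    exact key x y q q' hq hq'
  obtain ⟨F, hFlip, hFeq⟩ := hlip.extend_real
  have hFT : ∀ T ∈ 𝒯, ∀ x ∈ elem T, F x = p T x := by
    intro T hT x hx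
    rw [← (M.simplex hT).closure_interior] at hx
    have h1 : Set.EqOn F (p T) (interior (elem T)) := fun y hy => by
      have hA : A y (p T) := Or.inl ⟨T, hT, hy, rfl⟩
      rw [← hFeq ⟨_, hA⟩, hF₀ y _ hA]
    exact h1.closure hFlip.continuous (hp T hT).continuous hx
  refine ⟨F, ⟨fun x hx => ?_, fun T hT => ⟨p T, hp T hT, hFT T hT⟩⟩, hFT⟩
  -- Since `Ω` is the interior of its closure, its complement is the closure of the exterior, where
  -- `F` is 0.
  rw [← M.interior_closure, ← Set.mem_compl_iff, ← closure_compl] at hx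
  have h1 : Set.EqOn F 0 (closure Ω)ᶜ := fun y hy => by
    have hA : A y 0 := Or.inr ⟨hy, rfl⟩
    rw [← hFeq ⟨_, hA⟩, hF₀ y _ hA]
  exact h1.closure hFlip.continuous continuous_const hx

end

section
variable {N n r : ℕ} {c h : ℝ} {Ω : Set (Pt n)} {𝒯 : Finset (Finset (Pt n))}

lemma norm_le_sum_apply {ι : Type*} [Fintype ι] (a : EuclideanSpace ℝ ι) : ‖a‖ ≤ ∑ i, ‖a i‖ := by
  classical
  have h1 : ∑ k, a k • EuclideanSpace.basisFun ι ℝ k = a := by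
    simpa using (EuclideanSpace.basisFun ι ℝ).sum_repr a
  calc ‖a‖ = ‖∑ k, a k • EuclideanSpace.basisFun ι ℝ k‖ := by rw [h1]
    _ ≤ ∑ k, ‖a k • EuclideanSpace.basisFun ι ℝ k‖ := norm_sum_le _ _
    _ = ∑ k, ‖a k‖ := by simp [norm_smul]

lemma IsFE.differentiableAt {f : Pt n → ℝ} (hf : IsFE r Ω 𝒯 f) {T : Finset (Pt n)} (hT : T ∈ 𝒯)
    {x : Pt n} (hx : x ∈ interior (elem T)) : DifferentiableAt ℝ f x := by
  obtain ⟨p, hp, hfp⟩ := hf.2 T hT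
  exact (hp.differentiable x).congr_of_eventuallyEq (eventually_eq_of_mem_interior hfp hx)

lemma grad_apply {w : Pt n → Pt N} {x : Pt n} (hw : DifferentiableAt ℝ w x) (i : Fin N)
    (j : Fin n) :
    grad w x (i, j) = fderiv ℝ (fun y => w y i) x (EuclideanSpace.single j 1) := by
  rw [← row_grad hw, row_single]

lemma tendsto_lintegral_enorm_zero {F : Type*} [NormedAddCommGroup F] {Ω : Set (Pt n)}
    (hΩ : volume Ω ≠ ⊤) {f : ℕ → Pt n → F} {B : ℝ}
    (hm : ∀ k, AEStronglyMeasurable (f k) (volume.restrict Ω))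
    (hB : ∀ k, ∀ᵐ x ∂volume.restrict Ω, ‖f k x‖ ≤ B)
    (ht : ∀ᵐ x ∂volume.restrict Ω, Tendsto (fun k => f k x) atTop (𝓝 0)) :
    Tendsto (fun k => eLpNorm (f k) 1 (volume.restrict Ω)) atTop (𝓝 0) := by
  simp only [eLpNorm_one_eq_lintegral_enorm]
  have h1 := tendsto_lintegral_of_dominated_convergence' (μ := volume.restrict Ω)
    (F := fun k x => ‖f k x‖ₑ) (f := fun _ => 0) (fun _ => ENNReal.ofReal B)
    (fun k => (hm k).enorm) (fun k => ?_) ?_ ?_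
  · simpa using h1
  · filter_upwards [hB k] with x hx
    rw [← ofReal_norm]; exact ENNReal.ofReal_le_ofReal hx
  · rw [lintegral_const]
    exact ENNReal.mul_ne_top ENNReal.ofReal_ne_top (by simpa using hΩ)
  · filter_upwards [ht] with x hx
    simpa using hx.enorm

lemma measurable_grad {w : Pt n → Pt N} : Measurable (grad w) := by
  have h1 : Measurable fun (x : Pt n) (ij : Fin N × Fin n) =>
      fderiv ℝ w x (EuclideanSpace.single ij.2 1) ij.1 := by
    refine measurable_pi_lambda _ fun ij => ?_
    exact (EuclideanSpace.proj ij.1 : Pt N →L[ℝ] ℝ).continuous.measurable.comp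
      (measurable_fderiv_apply_const ℝ w _)
  exact (PiLp.continuous_toLp 2 _).measurable.comp h1

lemma IsMesh.volume_ne_top (M : IsMesh c h Ω 𝒯) : volume Ω ≠ ⊤ :=
  ((measure_mono subset_closure).trans_lt M.isCompact_closure.measure_lt_top).ne

lemma IsMesh.ae_restrict_mem_interior (M : IsMesh c h Ω 𝒯) :
    ∀ᵐ x ∂volume.restrict Ω, ∃ T ∈ 𝒯, x ∈ interior (elem T) :=
  (ae_restrict_iff' M.isOpen.measurableSet).2 M.ae_mem_interior

lemma IsMesh.compl_nonempty (M : IsMesh c h Ω 𝒯) (hn : 1 ≤ n) : Ωᶜ.Nonempty := by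
  rw [Set.nonempty_compl]
  rintro rfl
  have : Nontrivial (Pt n) := by
    have : Nonempty (Fin n) := ⟨⟨0, by omega⟩⟩
    infer_instance
  have h1 := M.isCompact_closure
  rw [closure_univ] at h1
  exact noncompact_univ (Pt n) h1

/-- Vector fields with finite element components belong to `V_h`. -/
lemma mem_Vh_of_isFE (M : IsMesh c h Ω 𝒯) (hn : 1 ≤ n) {w : Pt n → Pt N}
    (hw : ∀ i, IsFE r Ω 𝒯 fun x => w x i) : w ∈ Vh N r Ω 𝒯 := by
  have hΩt := M.volume_ne_top
  have : IsFiniteMeasure (volume.restrict Ω) := ⟨by simpa using hΩt.lt_top⟩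
  have hdiff : ∀ T ∈ 𝒯, ∀ x ∈ interior (elem T), DifferentiableAt ℝ w x := fun T hT x hx =>
    differentiableAt_euclidean.2 fun i => (hw i).differentiableAt hT hx
  have hwc : Continuous w := by
    have h1 : Continuous fun x (i : Fin N) => w x i :=
      continuous_pi fun i => (hw i).continuous M
    exact (PiLp.continuous_toLp 2 fun _ : Fin N => ℝ).comp h1
  choose L hL using fun i => (hw i).exists_lipschitz M
  have hgb : ∀ x, ‖grad w x‖ ≤ n * ∑ i, (L i : ℝ) := fun x => by
    refine (norm_le_sum_row _).trans
      (mul_le_mul_of_nonneg_left (Finset.sum_le_sum fun i _ => ?_) (by positivity))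
    by_cases hd : DifferentiableAt ℝ w x
    · rw [row_grad hd]
      exact norm_fderiv_le_of_lipschitz ℝ (hL i)
    · have h0 : grad w x = 0 := by
        ext ij; simp [grad, fderiv_zero_of_not_differentiableAt hd]
      rw [h0, map_zero, norm_zero]
      exact NNReal.coe_nonneg _
  have hgm : AEStronglyMeasurable (grad w) (volume.restrict Ω) :=
    measurable_grad.aestronglyMeasurable
  have hgL : MemLp (grad w) 1 (volume.restrict Ω) :=
    MemLp.of_bound hgm _ (ae_of_all _ hgb)
  choose ψ B hψt hψB hψlim using fun i => exists_test_approx M (M.compl_nonempty hn) (hw i)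
  set φ : ℕ → Pt n → Pt N := fun k x => WithLp.toLp 2 fun i => ψ i k x with hφ
  have hφs : ∀ k, ContDiff ℝ ∞ (φ k) := fun k => contDiff_euclidean.2 fun i => (hψt i k).1
  have hφt : ∀ k, IsTest Ω (φ k) := by
    intro k
    have hsub : tsupport (φ k) ⊆ ⋃ i, tsupport (ψ i k) := by
      refine closure_minimal (fun x hx => ?_) (isClosed_iUnion_of_finite fun i =>
        isClosed_tsupport _)
      by_contra hnot
      simp only [Set.mem_iUnion, not_exists] at hnot
      refine hx ?_
      ext i
      exact image_eq_zero_of_notMem_tsupport (f := ψ i k) (hnot i)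
    have hsubΩ : tsupport (φ k) ⊆ Ω := hsub.trans (Set.iUnion_subset fun i => (hψt i k).2.2)
    exact ⟨hφs k, M.isCompact_closure.of_isClosed_subset (isClosed_tsupport _)
      (hsubΩ.trans subset_closure), hsubΩ⟩
  have hφd : ∀ k x, DifferentiableAt ℝ (φ k) x := fun k => (hφs k).differentiable (by simp)
  have hwL : MemLp w 1 (volume.restrict Ω) := by
    rw [memLp_one_iff_integrable]
    have h1 : IntegrableOn w (closure Ω) := hwc.continuousOn.integrableOn_compact M.isCompact_closure
    exact h1.mono_set subset_closure
  refine ⟨⟨grad w, ⟨?_, ?_, ?_⟩, hwL, hgL, φ, hφt, ?_, ?_⟩, fun T hT i => ?_⟩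
  · exact hwc.locallyIntegrable.locallyIntegrableOn Ω
  · have h1 : IntegrableOn (grad w) Ω := memLp_one_iff_integrable.1 hgL
    exact IntegrableOn.locallyIntegrableOn h1
  · intro g hg i j
    have hgd := hg.fderiv_apply (EuclideanSpace.single j 1)
    obtain ⟨K, hK⟩ := (hg.1.of_le (n := ∞) (m := 1) (by simp)).lipschitzWith_of_hasCompactSupport
      hg.2.1 one_ne_zero
    -- Each component is Lipschitz on the whole space, so integration by parts holds without any
    -- terms on the facets.
    have hibp := (hL i).integral_lineDeriv_mul_eq (μ := volume) hK hg.2.1 (EuclideanSpace.single j 1)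
    have h1 : ∫ x, lineDeriv ℝ g x (-EuclideanSpace.single j 1) * w x i =
        -∫ x, w x i * fderiv ℝ g x (EuclideanSpace.single j 1) := by
      rw [← integral_neg]
      refine integral_congr_ae (ae_of_all _ fun x => ?_)
      have hd : DifferentiableAt ℝ g x := (hg.1.differentiable (by simp)) x
      simp only [hd.lineDeriv_eq_fderiv, map_neg]
      ring
    rw [hgd.setIntegral_mul subset_rfl, ← neg_eq_iff_eq_neg, ← h1, ← hibp,
      ← hg.setIntegral_mul subset_rfl]
    refine integral_congr_ae ?_
    filter_upwards [M.ae_restrict_mem_interior] with x hx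
    obtain ⟨T, hT, hxT⟩ := hx
    have hd := (hw i).differentiableAt hT hxT
    simp only [hd.lineDeriv_eq_fderiv, grad_apply (hdiff T hT x hxT)]
  · refine tendsto_lintegral_enorm_zero hΩt (B := ∑ i, B i)
      (fun k => (hwc.sub (hφs k).continuous).aestronglyMeasurable)
      (fun k => ae_of_all _ fun x => ?_) ?_
    · refine (norm_le_sum_apply _).trans (Finset.sum_le_sum fun i _ => ?_)
      rw [PiLp.sub_apply, norm_sub_rev]
      exact (hψB i k x).1
    · filter_upwards [M.ae_restrict_mem_interior] with x hx
      obtain ⟨T, hT, hxT⟩ := hx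
      have h1 : Tendsto (fun k => φ k x) atTop (𝓝 (w x)) :=
        ((PiLp.continuous_toLp 2 fun _ : Fin N => ℝ).tendsto (fun i => w x i)).comp
          (tendsto_pi_nhds.2 fun i => (hψlim i T hT x hxT).1)
      simpa using (tendsto_const_nhds (x := w x)).sub h1
  · refine tendsto_lintegral_enorm_zero hΩt (B := ∑ ij : Fin N × Fin n, B ij.1)
      (fun k => hgm.sub measurable_grad.aestronglyMeasurable) (fun k => ?_) ?_
    · filter_upwards [M.ae_restrict_mem_interior] with x hx
      obtain ⟨T, hT, hxT⟩ := hx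
      refine (norm_le_sum_apply _).trans (Finset.sum_le_sum fun ij _ => ?_)
      obtain ⟨i, j⟩ := ij
      rw [PiLp.sub_apply, grad_apply (hdiff T hT x hxT), grad_apply (hφd k x),
        ← sub_apply]
      refine (ContinuousLinearMap.le_opNorm _ _).trans ?_
      rw [PiLp.norm_single, norm_one, mul_one, norm_sub_rev]
      exact (hψB i k x).2
    · filter_upwards [M.ae_restrict_mem_interior] with x hx
      obtain ⟨T, hT, hxT⟩ := hx
      have h1 : Tendsto (fun k => grad (φ k) x) atTop (𝓝 (grad w x)) := by
        refine ((PiLp.continuous_toLp 2 fun _ : Fin N × Fin n => ℝ).tendsto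
          (fun ij => grad w x ij)).comp (tendsto_pi_nhds.2 fun ij => ?_)
        obtain ⟨i, j⟩ := ij
        have h2 := ((ContinuousLinearMap.apply ℝ ℝ (EuclideanSpace.single j 1 : Pt n)).continuous.tendsto
          _).comp (hψlim i T hT x hxT).2
        rw [grad_apply (hdiff T hT x hxT)]
        refine h2.congr fun k => ?_
        exact (grad_apply (hφd k x) i j).symm
      simpa using (tendsto_const_nhds (x := grad w x)).sub h1
  · obtain ⟨p, ⟨P, hP, hpP⟩, hwp⟩ := (hw i).2 T hT
    refine ⟨P, hP, ?_⟩
    filter_upwards [ae_restrict_mem (measurableSet_elem T)] with x hx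
    exact (hwp x hx).trans (hpP x)

/-- Elements of `V_h` have continuous representatives. -/
lemma exists_isFE_of_mem_Vh (M : IsMesh c h Ω 𝒯) {w : Pt n → Pt N} (hw : w ∈ Vh N r Ω 𝒯) :
    ∃ w' : Pt n → Pt N, (∀ i, IsFE r Ω 𝒯 fun x => w' x i) ∧ w =ᵐ[volume.restrict Ω] w' ∧
      ∀ᵐ x ∂volume.restrict Ω, ∀ i,
        row i (weakGrad Ω w x) = fderiv ℝ (fun y => w' y i) x := by
  obtain ⟨hw0, hwP⟩ := hw
  obtain ⟨-, -, hwg, φ, hφ, hlim⟩ := hw0.exists_isW0Limit le_rfl M.isOpen M.volume_ne_top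
  have hpoly : ∀ T ∈ 𝒯, ∀ i, ∃ p, IsPoly r p ∧ ∀ᵐ x, x ∈ interior (elem T) → w x i = p x := by
    intro T hT i
    obtain ⟨P, hP, hwP⟩ := hwP T hT i
    refine ⟨_, ⟨P, hP, fun _ => rfl⟩, ?_⟩
    rw [ae_restrict_iff' (measurableSet_elem T)] at hwP
    filter_upwards [hwP] with x hx hxT using hx (interior_subset hxT)
  choose! p hp hwp using hpoly
  have hG : ∀ T ∈ 𝒯, ∀ i, ∀ᵐ x, x ∈ interior (elem T) →
      row i (weakGrad Ω w x) = fderiv ℝ (p T i) x := fun T hT i =>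
    hwg.ae_row_eq isOpen_interior (M.interior_elem_subset hT) (hp T hT i).contDiff (hwp T hT i)
  have hfe : ∀ i, ∃ F, IsFE r Ω 𝒯 F ∧ ∀ T ∈ 𝒯, ∀ x ∈ elem T, F x = p T i x := fun i =>
    exists_isFE_of_limit M (hlim i) (fun k x hx => by
      have hs := (hφ k).2.2
      have hd : DifferentiableAt ℝ (φ k) x := ((hφ k).1.differentiable (by simp)) x
      have h0 : fderiv ℝ (φ k) x = 0 := by
        by_contra hne
        exact hx (hs (support_fderiv_subset ℝ hne))
      rw [← row_grad hd]
      refine clm_ext_single fun j => ?_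
      rw [row_single]
      simp [grad, h0])
      (p := fun T => p T i) (fun T hT => hp T hT i) (fun T hT => hwp T hT i) (fun T hT => hG T hT i)
  choose F hF hFp using hfe
  have hall : ∀ᵐ x ∂volume.restrict Ω, ∀ i, ∃ T ∈ 𝒯, x ∈ interior (elem T) ∧ w x i = p T i x ∧
      row i (weakGrad Ω w x) = fderiv ℝ (p T i) x := by
    rw [ae_all_iff]
    intro i
    filter_upwards [M.ae_restrict_mem_interior,
      ae_restrict_of_ae ((ae_ball_iff 𝒯.countable_toSet).2 fun T hT => hwp T hT i),
      ae_restrict_of_ae ((ae_ball_iff 𝒯.countable_toSet).2 fun T hT => hG T hT i)]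
      with x ⟨T, hT, hxT⟩ h1 h2
    exact ⟨T, hT, hxT, h1 T hT hxT, h2 T hT hxT⟩
  refine ⟨fun x => WithLp.toLp 2 fun i => F i x, hF, ?_, ?_⟩
  · filter_upwards [hall] with x hx
    ext i
    obtain ⟨T, hT, hxT, h1, -⟩ := hx i
    rw [h1]
    exact (hFp i T hT x (interior_subset hxT)).symm
  · filter_upwards [hall] with x hx i
    obtain ⟨T, hT, hxT, -, h2⟩ := hx i
    rw [h2]
    exact ((eventually_eq_of_mem_interior (hFp i T hT) hxT).fderiv_eq).symm

/-- The `L²`-projection exists, and its components are the scalar projections. -/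
lemma isL2Proj_l2Proj (M : IsMesh c h Ω 𝒯) (hn : 1 ≤ n) {v : Pt n → Pt N}
    (hv : IntegrableOn v Ω) : IsL2Proj r Ω 𝒯 v (l2Proj r Ω 𝒯 v) := by
  have hvi : ∀ i, IntegrableOn (fun x => v x i) Ω := fun i =>
    (EuclideanSpace.proj i : Pt N →L[ℝ] ℝ).integrable_comp hv
  choose W hW hWo using fun i => exists_fe_proj M r (hvi i)
  have hex : ∃ w, IsL2Proj r Ω 𝒯 v w := by
    refine ⟨fun x => WithLp.toLp 2 fun i => W i x, mem_Vh_of_isFE M hn hW, fun ξ hξ => ?_⟩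
    obtain ⟨ξ', hξ', hae, -⟩ := exists_isFE_of_mem_Vh M hξ
    have h1 : ∫ x in Ω, inner ℝ (v x - WithLp.toLp 2 fun i => W i x) (ξ x) =
        ∫ x in Ω, ∑ i, (v x i * ξ' x i - W i x * ξ' x i) := by
      refine integral_congr_ae ?_
      filter_upwards [hae] with x hx
      rw [hx, PiLp.inner_apply]
      refine Finset.sum_congr rfl fun i _ => ?_
      simp
      ring
    rw [h1, integral_finsetSum]
    · refine Finset.sum_eq_zero fun i _ => ?_
      rw [integral_sub ((hξ' i).integrable_mul M (hvi i))
        ((hξ' i).integrable_mul M ((hW i).integrableOn M)), hWo i _ (hξ' i), sub_self]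
    · exact fun i _ => ((hξ' i).integrable_mul M (hvi i)).sub
        ((hξ' i).integrable_mul M ((hW i).integrableOn M))
  rw [l2Proj, dif_pos hex]
  exact hex.choose_spec

/-- Testing with fields having a single nonzero component decouples the projection into scalar
projections. -/
lemma exists_isFE_l2Proj (M : IsMesh c h Ω 𝒯) (hn : 1 ≤ n) {v w : Pt n → Pt N}
    (hv : IntegrableOn v Ω) (hw : IsL2Proj r Ω 𝒯 v w) :
    ∃ w' : Pt n → Pt N, (∀ i, IsFE r Ω 𝒯 fun x => w' x i) ∧
      (∀ i ξ, IsFE r Ω 𝒯 ξ → ∫ x in Ω, w' x i * ξ x = ∫ x in Ω, v x i * ξ x) ∧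
      ∀ᵐ x ∂volume.restrict Ω, ∀ i,
        row i (weakGrad Ω w x) = fderiv ℝ (fun y => w' y i) x := by
  classical
  obtain ⟨w', hw', hae, hg⟩ := exists_isFE_of_mem_Vh M hw.1
  refine ⟨w', hw', fun i ξ hξ => ?_, hg⟩
  have hvi : IntegrableOn (fun x => v x i) Ω :=
    (EuclideanSpace.proj i : Pt N →L[ℝ] ℝ).integrable_comp hv
  have hFE : ∀ j, IsFE r Ω 𝒯 fun x => (EuclideanSpace.single i (ξ x) : Pt N) j := fun j => by
    by_cases hj : j = i
    · subst hj; simpa using hξ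
    · have h0 : IsFE r Ω 𝒯 (fun _ => 0) := (feSpace r Ω 𝒯).zero_mem
      simpa [hj] using h0
  have h0 := hw.2 _ (mem_Vh_of_isFE M hn hFE)
  have h1 : ∫ x in Ω, inner ℝ (v x - w x) (EuclideanSpace.single i (ξ x) : Pt N) =
      ∫ x in Ω, (v x i * ξ x - w' x i * ξ x) := by
    refine integral_congr_ae ?_
    filter_upwards [hae] with x hx
    rw [hx, EuclideanSpace.inner_single_right]
    simp
    ring
  rw [h1, integral_sub (hξ.integrable_mul M hvi) (hξ.integrable_mul M ((hw' i).integrableOn M))] at h0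
  linarith

end

/-! ### The shifted N-function associated with `V` -/

/-- The function `t ↦ (a + t)^(p-2) t²`. -/
def shiftFun (p a t : ℝ) : ℝ := (a + t) ^ (p - 2) * t ^ 2

lemma shiftFun_nonneg {p a t : ℝ} (ha : 0 ≤ a) (ht : 0 ≤ t) : 0 ≤ shiftFun p a t :=
  mul_nonneg (Real.rpow_nonneg (by positivity) _) (sq_nonneg _)

lemma shiftFun_pos {p a t : ℝ} (ha : 0 ≤ a) (ht : 0 < t) : 0 < shiftFun p a t :=
  mul_pos (Real.rpow_pos_of_pos (by positivity) _) (by positivity)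

/-- `t ↦ shiftFun p a t / t` is increasing. -/
lemma mul_shiftFun_le {p a s t : ℝ} (hp : 1 < p) (ha : 0 ≤ a) (hs : 0 < s) (hst : s ≤ t) :
    t * shiftFun p a s ≤ s * shiftFun p a t := by
  have ht : 0 < t := hs.trans_le hst
  have e : ∀ u, 0 < u → (a + u) ^ (p - 2) = (a + u) ^ (p - 1) / (a + u) := fun u hu => by
    rw [← Real.rpow_sub_one (by positivity)]; ring_nf
  rw [shiftFun, shiftFun, e s hs, e t ht]
  have h1 : (a + s) ^ (p - 1) ≤ (a + t) ^ (p - 1) :=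
    Real.rpow_le_rpow (by positivity) (by linarith) (by linarith)
  have h2 : s / (a + s) ≤ t / (a + t) := by
    rw [div_le_div_iff₀ (by positivity) (by positivity)]; nlinarith
  have h3 : (a + s) ^ (p - 1) * (s / (a + s)) ≤ (a + t) ^ (p - 1) * (t / (a + t)) :=
    mul_le_mul h1 h2 (by positivity) (Real.rpow_nonneg (by positivity) _)
  calc t * ((a + s) ^ (p - 1) / (a + s) * s ^ 2)
      = s * t * ((a + s) ^ (p - 1) * (s / (a + s))) := by ring
    _ ≤ s * t * ((a + t) ^ (p - 1) * (t / (a + t))) := mul_le_mul_of_nonneg_left h3 (by positivity)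
    _ = _ := by ring

/-- The doubling property, uniform in the shift `a`. The exponent `p + 2` is crude but serves both
signs of `p - 2`. -/
lemma shiftFun_mul_le {p a b t : ℝ} (hp : 1 < p) (ha : 0 ≤ a) (hb : 1 ≤ b) (ht : 0 < t) :
    shiftFun p a (b * t) ≤ b ^ (p + 2) * shiftFun p a t := by
  have hb0 : 0 < b := by linarith
  have h1 : (a + b * t) ^ (p - 2) ≤ b ^ p * (a + t) ^ (p - 2) := by
    rcases le_or_gt 2 p with h2 | h2
    · calc (a + b * t) ^ (p - 2) ≤ (b * (a + t)) ^ (p - 2) :=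
            Real.rpow_le_rpow (by positivity) (by nlinarith) (by linarith)
        _ = b ^ (p - 2) * (a + t) ^ (p - 2) := Real.mul_rpow hb0.le (by positivity)
        _ ≤ b ^ p * (a + t) ^ (p - 2) := mul_le_mul_of_nonneg_right
            (Real.rpow_le_rpow_of_exponent_le hb (by linarith)) (Real.rpow_nonneg (by positivity) _)
    · calc (a + b * t) ^ (p - 2) ≤ (a + t) ^ (p - 2) :=
            Real.rpow_le_rpow_of_nonpos (by positivity) (by nlinarith) (by linarith)
        _ ≤ b ^ p * (a + t) ^ (p - 2) := le_mul_of_one_le_left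
            (Real.rpow_nonneg (by positivity) _) (Real.one_le_rpow hb (by linarith))
  rw [shiftFun, shiftFun, Real.rpow_add hb0]
  calc (a + b * t) ^ (p - 2) * (b * t) ^ 2 ≤ b ^ p * (a + t) ^ (p - 2) * (b * t) ^ 2 :=
        mul_le_mul_of_nonneg_right h1 (sq_nonneg _)
    _ = _ := by
        rw [show (b : ℝ) ^ (2 : ℝ) = b ^ 2 by norm_cast]; ring

/-- Jensen inequality up to constants for `shiftFun`, with a weight `k`. -/
lemma shiftFun_le_lintegral {X : Type*} [MeasurableSpace X] {μ : Measure X} {p a s C K : ℝ}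
    (hp : 1 < p) (ha : 0 ≤ a) (hs : 0 ≤ s) (hC : 0 < C) (hK : 0 < K) (hCK : 1 ≤ 2 * C * K)
    {k : X → ℝ≥0∞} (hk : Measurable k) (hkK : ∫⁻ x, k x ∂μ ≤ ENNReal.ofReal K) {f : X → ℝ}
    (hf : ∀ x, 0 ≤ f x)
    (hsf : ENNReal.ofReal s ≤ ENNReal.ofReal C * ∫⁻ x, k x * ENNReal.ofReal (f x) ∂μ) :
    ENNReal.ofReal (shiftFun p a s) ≤ ENNReal.ofReal ((2 * C * K) ^ (p + 2) / K) *
      ∫⁻ x, k x * ENNReal.ofReal (shiftFun p a (f x)) ∂μ := by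
  rcases hs.eq_or_lt with rfl | hs
  · simp [shiftFun]
  set b := 2 * C * K with hb
  have hb0 : 0 < b := by positivity
  set l := s / b with hl
  have hl0 : 0 < l := by positivity
  have hψl := shiftFun_pos (p := p) ha hl0
  set I := ∫⁻ x, k x * ENNReal.ofReal (shiftFun p a (f x)) ∂μ with hI
  -- Where `f ≤ l` the first term suffices; elsewhere the monotonicity of `shiftFun p a t / t` gives
  -- the second one.
  have hpt : ∀ x, ENNReal.ofReal (f x) ≤ ENNReal.ofReal l +
      ENNReal.ofReal (l / shiftFun p a l) * ENNReal.ofReal (shiftFun p a (f x)) := by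
    intro x
    rw [← ENNReal.ofReal_mul (by positivity), ← ENNReal.ofReal_add hl0.le
      (mul_nonneg (by positivity) (shiftFun_nonneg ha (hf x)))]
    refine ENNReal.ofReal_le_ofReal ?_
    rcases le_total (f x) l with h1 | h1
    · have := mul_nonneg (div_nonneg hl0.le hψl.le) (shiftFun_nonneg (p := p) ha (hf x))
      linarith
    · have h2 := mul_shiftFun_le hp ha hl0 h1
      rw [div_mul_eq_mul_div]
      have h3 : f x ≤ l * shiftFun p a (f x) / shiftFun p a l := by rwa [le_div_iff₀ hψl]
      linarith
  -- The choice `l = s / (2 C K)` makes the contribution of the constant `l` at most `s / 2`. Once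
  -- it is absorbed, `shiftFun p a l` is at most `I / K`, and doubling with the factor `b ≥ 1` leads
  -- from `l` back to `s`.
  have h1 : ENNReal.ofReal s ≤ ENNReal.ofReal (s / 2) +
      ENNReal.ofReal (C * (l / shiftFun p a l)) * I := by
    calc ENNReal.ofReal s ≤ ENNReal.ofReal C * ∫⁻ x, k x * ENNReal.ofReal (f x) ∂μ := hsf
      _ ≤ ENNReal.ofReal C * ∫⁻ x, (ENNReal.ofReal l * k x + ENNReal.ofReal (l / shiftFun p a l) *
          (k x * ENNReal.ofReal (shiftFun p a (f x)))) ∂μ := by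
          refine mul_le_mul' le_rfl (lintegral_mono fun x => ?_)
          refine (mul_le_mul' le_rfl (hpt x)).trans (le_of_eq ?_)
          ring
      _ = ENNReal.ofReal C * (ENNReal.ofReal l * ∫⁻ x, k x ∂μ) +
          ENNReal.ofReal C * (ENNReal.ofReal (l / shiftFun p a l) * I) := by
          rw [lintegral_add_left (hk.const_mul _), lintegral_const_mul' _ _ ENNReal.ofReal_ne_top,
            lintegral_const_mul' _ _ ENNReal.ofReal_ne_top, mul_add]
      _ ≤ ENNReal.ofReal C * (ENNReal.ofReal l * ENNReal.ofReal K) +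
          ENNReal.ofReal C * (ENNReal.ofReal (l / shiftFun p a l) * I) :=
          add_le_add (mul_le_mul' le_rfl (mul_le_mul' le_rfl hkK)) le_rfl
      _ = _ := by
          rw [← ENNReal.ofReal_mul hl0.le, ← ENNReal.ofReal_mul hC.le,
            ← mul_assoc (ENNReal.ofReal C), ← ENNReal.ofReal_mul hC.le]
          congr 2
          rw [hl, hb]
          field_simp
  rcases eq_or_ne I ⊤ with hIt | hIt
  · rw [hIt, ENNReal.mul_top]
    · exact le_top
    · simp only [ne_eq, ENNReal.ofReal_eq_zero, not_le]
      positivity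
  rw [← ENNReal.ofReal_toReal hIt] at h1 ⊢
  set J := I.toReal with hJ
  have hJ0 : 0 ≤ J := ENNReal.toReal_nonneg
  rw [← ENNReal.ofReal_mul (by positivity), ← ENNReal.ofReal_add (by positivity) (by positivity),
    ENNReal.ofReal_le_ofReal_iff (by positivity)] at h1
  rw [← ENNReal.ofReal_mul (by positivity)]
  refine ENNReal.ofReal_le_ofReal ?_
  have h2 : shiftFun p a l ≤ J / K := by
    have h3 : s / 2 ≤ C * (l / shiftFun p a l) * J := by linarith
    have h4 : C * (l / shiftFun p a l) * J = s / 2 * (J / K / shiftFun p a l) := by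
      rw [hl, hb]; field_simp
    rw [h4] at h3
    have h5 : 1 ≤ J / K / shiftFun p a l := by
      by_contra hlt
      push Not at hlt
      nlinarith
    rwa [one_le_div hψl] at h5
  have hsb : s = b * l := by rw [hl]; field_simp
  calc shiftFun p a s = shiftFun p a (b * l) := by rw [← hsb]
    _ ≤ b ^ (p + 2) * shiftFun p a l := shiftFun_mul_le hp ha hCK hl0
    _ ≤ b ^ (p + 2) * (J / K) := mul_le_mul_of_nonneg_left h2 (by positivity)
    _ = _ := by ring

section
variable {N n : ℕ}

/-- Two-sided estimate for differences of `V`, for ordered norms. -/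
lemma norm_V_sub_bounds {κ p : ℝ} (hκ : 0 ≤ κ) (hp : 1 < p) {P Q : Mat N n} (hPQ : ‖Q‖ ≤ ‖P‖) :
    ‖V κ p P - V κ p Q‖ ≤ (2 + |(p - 2) / 2|) * (κ + ‖P‖) ^ ((p - 2) / 2) * ‖P - Q‖ ∧
    (κ + ‖P‖) ^ ((p - 2) / 2) * ‖P - Q‖ ≤ 2 * ‖V κ p P - V κ p Q‖ := by
  set β := (p - 2) / 2 with hβ
  have hβ1 : -1 / 2 < β := by rw [hβ]; linarith
  rcases (add_nonneg hκ (norm_nonneg P)).eq_or_lt with h0 | hM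
  · have hP0 : ‖P‖ = 0 := by linarith [norm_nonneg P]
    have hQ0 : ‖Q‖ = 0 := le_antisymm (hP0 ▸ hPQ) (norm_nonneg _)
    rw [norm_eq_zero.1 hP0, norm_eq_zero.1 hQ0]
    simp
  set m := κ + ‖Q‖ with hm
  set Mx := κ + ‖P‖ with hMx
  have hm0 : 0 ≤ m := by positivity
  have hmM : m ≤ Mx := by linarith
  -- Both bounds reduce to inequalities for powers of the ratio `x`, with values in [0, 1].
  set x := m / Mx with hx
  have hx0 : 0 ≤ x := by positivity
  have hx1 : x ≤ 1 := (div_le_one hM).2 hmM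
  have hmx : m = x * Mx := by rw [hx]; field_simp
  have hmβ : m ^ β = x ^ β * Mx ^ β := by rw [hmx, Real.mul_rpow hx0 hM.le]
  have hMβ : 0 < Mx ^ β := Real.rpow_pos_of_pos hM _
  have hQm : ‖Q‖ ≤ x * Mx := by rw [← hmx]; linarith
  have hdiff : Mx * (1 - x) = ‖P‖ - ‖Q‖ := by
    have : Mx * (1 - x) = Mx - m := by rw [hmx]; ring
    rw [this]; simp only [hMx, hm]; ring
  have htri : ‖P‖ - ‖Q‖ ≤ ‖P - Q‖ := norm_sub_norm_le P Q
  have hVP : V κ p P = Mx ^ β • P := rfl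
  have hVQ : V κ p Q = m ^ β • Q := rfl
  have hdec : V κ p P - V κ p Q = Mx ^ β • (P - Q) + (Mx ^ β - m ^ β) • Q := by
    rw [hVP, hVQ]; module
  -- The factor `x`, supplied by `‖Q‖ ≤ x * Mx`, compensates the singularity of `x ^ β` at 0 for
  -- negative `β`.
  have hBern : |1 - x ^ β| * x ≤ (1 + |β|) * (1 - x) := by
    rcases le_or_gt 0 β with hb | hb
    · have h1 : x ^ β ≤ 1 := Real.rpow_le_one hx0 hx1 hb
      rw [abs_of_nonneg (by linarith), abs_of_nonneg hb]
      have h2 : 1 - x ^ β ≤ (1 + β) * (1 - x) := by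
        rcases le_or_gt 1 β with hb1 | hb1
        · have h3 := one_add_mul_self_le_rpow_one_add (s := x - 1) (by linarith) hb1
          rw [add_sub_cancel] at h3
          nlinarith
        · have h3 : x ≤ x ^ β := by
            calc x = x ^ (1 : ℝ) := (Real.rpow_one x).symm
              _ ≤ x ^ β := Real.rpow_le_rpow_of_exponent_ge' hx0 hx1 hb hb1.le
          nlinarith
      calc (1 - x ^ β) * x ≤ 1 - x ^ β := mul_le_of_le_one_right (by linarith) hx1
        _ ≤ _ := h2
    · rcases hx0.eq_or_lt with h0 | hxp
      · rw [← h0, mul_zero]; positivity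
      have h1 : 1 ≤ x ^ β := Real.one_le_rpow_of_pos_of_le_one_of_nonpos hxp hx1 hb.le
      rw [abs_of_nonpos (by linarith)]
      have h2 : x ^ β * x ≤ 1 := by
        rw [← Real.rpow_add_one hxp.ne']
        exact Real.rpow_le_one hx0 hx1 (by linarith)
      have h3 : 0 ≤ |β| * (1 - x) := mul_nonneg (abs_nonneg _) (by linarith)
      nlinarith
  constructor
  · have h2 : |Mx ^ β - m ^ β| * ‖Q‖ ≤ (1 + |β|) * Mx ^ β * ‖P - Q‖ := by
      have e1 : Mx ^ β - m ^ β = (1 - x ^ β) * Mx ^ β := by rw [hmβ]; ring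
      rw [e1, abs_mul, abs_of_pos hMβ]
      calc |1 - x ^ β| * Mx ^ β * ‖Q‖ ≤ |1 - x ^ β| * Mx ^ β * (x * Mx) :=
            mul_le_mul_of_nonneg_left hQm (by positivity)
        _ = (|1 - x ^ β| * x) * (Mx ^ β * Mx) := by ring
        _ ≤ ((1 + |β|) * (1 - x)) * (Mx ^ β * Mx) :=
            mul_le_mul_of_nonneg_right hBern (by positivity)
        _ = (1 + |β|) * Mx ^ β * (‖P‖ - ‖Q‖) := by rw [← hdiff]; ring
        _ ≤ _ := mul_le_mul_of_nonneg_left htri (by positivity)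
    rw [hdec]
    calc _ ≤ ‖Mx ^ β • (P - Q)‖ + ‖(Mx ^ β - m ^ β) • Q‖ := norm_add_le _ _
      _ = Mx ^ β * ‖P - Q‖ + |Mx ^ β - m ^ β| * ‖Q‖ := by
          rw [norm_smul, norm_smul, Real.norm_of_nonneg hMβ.le, Real.norm_eq_abs]
      _ ≤ Mx ^ β * ‖P - Q‖ + (1 + |β|) * Mx ^ β * ‖P - Q‖ := add_le_add le_rfl h2
      _ = _ := by ring
  · rcases le_or_gt 0 β with hb | hb
    · have hmβ1 : m ^ β ≤ Mx ^ β := Real.rpow_le_rpow hm0 hmM hb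
      have hmβ0 : 0 ≤ m ^ β := Real.rpow_nonneg hm0 _
      -- This expresses `‖Q‖ ≤ ‖P‖`. It costs at most half of the main term when the difference of
      -- `V` is paired with `P - Q`.
      have hin : -(‖P - Q‖ ^ 2) / 2 ≤ inner ℝ Q (P - Q) := by
        have h1 := norm_add_sq_real Q (P - Q)
        rw [add_sub_cancel] at h1
        have h2 : ‖Q‖ ^ 2 ≤ ‖P‖ ^ 2 := pow_le_pow_left₀ (norm_nonneg _) hPQ 2
        linarith
      have h3 : inner ℝ (V κ p P - V κ p Q) (P - Q) =
          Mx ^ β * ‖P - Q‖ ^ 2 + (Mx ^ β - m ^ β) * inner ℝ Q (P - Q) := by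
        rw [hdec, inner_add_left, real_inner_smul_left, real_inner_smul_left,
          real_inner_self_eq_norm_sq]
      have h4 := real_inner_le_norm (V κ p P - V κ p Q) (P - Q)
      have h5 : (Mx ^ β - m ^ β) * (-(‖P - Q‖ ^ 2) / 2) ≤
          (Mx ^ β - m ^ β) * inner ℝ Q (P - Q) := mul_le_mul_of_nonneg_left hin (by linarith)
      have h6 : Mx ^ β * ‖P - Q‖ ^ 2 / 2 ≤ ‖V κ p P - V κ p Q‖ * ‖P - Q‖ := by
        nlinarith [sq_nonneg ‖P - Q‖]
      rcases (norm_nonneg (P - Q)).eq_or_lt with h7 | h7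
      · rw [← h7, mul_zero]; positivity
      · have h8 : Mx ^ β * ‖P - Q‖ * ‖P - Q‖ ≤ 2 * ‖V κ p P - V κ p Q‖ * ‖P - Q‖ := by nlinarith
        exact le_of_mul_le_mul_right h8 h7
    · rcases hx0.eq_or_lt with h0 | hxp
      · have hQ0 : ‖Q‖ = 0 := by
          rw [← h0, zero_mul] at hQm; exact le_antisymm hQm (norm_nonneg _)
        have hQ : Q = 0 := norm_eq_zero.1 hQ0
        rw [hdec, hQ, smul_zero, add_zero, sub_zero, norm_smul, Real.norm_of_nonneg hMβ.le]
        nlinarith [mul_nonneg hMβ.le (norm_nonneg P)]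
      have h1 : 1 ≤ x ^ β := Real.one_le_rpow_of_pos_of_le_one_of_nonpos hxp hx1 hb.le
      have h2 : x ^ β * x ≤ 1 + (β + 1) * (x - 1) := by
        rw [← Real.rpow_add_one hxp.ne']
        have h3 := rpow_one_add_le_one_add_mul_self (s := x - 1) (p := β + 1) (by linarith)
          (by linarith) (by linarith)
        rwa [add_sub_cancel] at h3
      -- The factor 1/2 comes from `-β < 1 / 2`, which is `p > 1`.
      have h4 : (‖P‖ - ‖Q‖) / 2 ≤ ‖P‖ - x ^ β * ‖Q‖ := by
        have h5 : (x ^ β - 1) * ‖Q‖ ≤ (x ^ β - 1) * (x * Mx) :=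
          mul_le_mul_of_nonneg_left hQm (by linarith)
        have h6 : (x ^ β * x - x) * Mx ≤ (-β * (1 - x)) * Mx :=
          mul_le_mul_of_nonneg_right (by linarith) hM.le
        have h7 : -β * (Mx * (1 - x)) ≤ 1 / 2 * (Mx * (1 - x)) :=
          mul_le_mul_of_nonneg_right (by linarith) (mul_nonneg hM.le (by linarith))
        rw [hdiff] at h7
        nlinarith
      -- Both squares split into a radial part and a multiple of `‖P‖ * ‖Q‖ - inner ℝ P Q`. The
      -- radial parts are compared by `h4`, the others by `1 ≤ x ^ β`.
      have hsq : (Mx ^ β * ‖P - Q‖) ^ 2 ≤ (2 * ‖V κ p P - V κ p Q‖) ^ 2 := by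
        have e1 : ‖P - Q‖ ^ 2 = ‖P‖ ^ 2 - 2 * inner ℝ P Q + ‖Q‖ ^ 2 := norm_sub_sq_real P Q
        have e2 : ‖V κ p P - V κ p Q‖ ^ 2 =
            (Mx ^ β) ^ 2 * (‖P‖ ^ 2 - 2 * x ^ β * inner ℝ P Q + (x ^ β * ‖Q‖) ^ 2) := by
          rw [norm_sub_sq_real, hVP, hVQ, norm_smul, norm_smul, real_inner_smul_left,
            real_inner_smul_right, hmβ, Real.norm_of_nonneg hMβ.le,
            Real.norm_of_nonneg (by positivity)]
          ring
        have e3 := real_inner_le_norm P Q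
        rw [mul_pow, mul_pow, e1, e2, mul_left_comm]
        refine mul_le_mul_of_nonneg_left ?_ (sq_nonneg _)
        have e4 : ((‖P‖ - ‖Q‖) / 2) ^ 2 ≤ (‖P‖ - x ^ β * ‖Q‖) ^ 2 :=
          pow_le_pow_left₀ (by linarith) h4 2
        have e5 : (‖P‖ * ‖Q‖ - inner ℝ P Q) ≤ x ^ β * (‖P‖ * ‖Q‖ - inner ℝ P Q) :=
          le_mul_of_one_le_left (by linarith) h1
        have e6 : 2 ^ 2 * (‖P‖ ^ 2 - 2 * x ^ β * inner ℝ P Q + (x ^ β * ‖Q‖) ^ 2) =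
            4 * (‖P‖ - x ^ β * ‖Q‖) ^ 2 + 8 * (x ^ β * (‖P‖ * ‖Q‖ - inner ℝ P Q)) := by ring
        have e7 : ‖P‖ ^ 2 - 2 * inner ℝ P Q + ‖Q‖ ^ 2 =
            4 * ((‖P‖ - ‖Q‖) / 2) ^ 2 + 2 * (‖P‖ * ‖Q‖ - inner ℝ P Q) := by ring
        rw [e6, e7]
        linarith
      exact (pow_le_pow_iff_left₀ (by positivity) (by positivity) two_ne_zero).1 hsq

lemma rpow_le_of_le_three_mul {q y z : ℝ} (hy : 0 < y) (hyz : y ≤ z) (hz : z ≤ 3 * y) :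
    z ^ q ≤ 3 ^ |q| * y ^ q ∧ y ^ q ≤ 3 ^ |q| * z ^ q := by
  have hz0 : 0 < z := hy.trans_le hyz
  have h3 : (1 : ℝ) ≤ 3 ^ |q| := Real.one_le_rpow (by norm_num) (abs_nonneg _)
  rcases le_or_gt 0 q with hq | hq
  · constructor
    · rw [abs_of_nonneg hq, ← Real.mul_rpow (by norm_num) hy.le]
      exact Real.rpow_le_rpow hz0.le hz hq
    · exact (Real.rpow_le_rpow hy.le hyz hq).trans
        (le_mul_of_one_le_left (Real.rpow_nonneg hz0.le _) h3)
  · constructor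
    · exact (Real.rpow_le_rpow_of_nonpos hy hyz hq.le).trans
        (le_mul_of_one_le_left (Real.rpow_nonneg hy.le _) h3)
    · have h4 := Real.rpow_le_rpow_of_nonpos hz0 hz hq.le
      rw [Real.mul_rpow (by norm_num) hy.le] at h4
      rw [abs_of_neg hq, Real.rpow_neg (by norm_num), inv_mul_eq_div, le_div_iff₀ (by positivity),
        mul_comm]
      exact h4

/-- `|V(P) - V(Q)|²` is comparable to `(κ + |Q| + |P - Q|)^(p-2) |P - Q|²`. -/
lemma exists_V_bounds {p : ℝ} (hp : 1 < p) : ∃ C : ℝ, 0 < C ∧ ∀ (N n : ℕ) (κ : ℝ), 0 ≤ κ →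
    ∀ P Q : Mat N n, ‖V κ p P - V κ p Q‖ ^ 2 ≤ C * shiftFun p (κ + ‖Q‖) ‖P - Q‖ ∧
      shiftFun p (κ + ‖Q‖) ‖P - Q‖ ≤ C * ‖V κ p P - V κ p Q‖ ^ 2 := by
  set E : ℝ := 3 ^ |p - 2| with hE
  have hE1 : 1 ≤ E := Real.one_le_rpow (by norm_num) (abs_nonneg _)
  set A := 2 + |(p - 2) / 2| with hA
  have hA2 : 2 ≤ A := by have := abs_nonneg ((p - 2) / 2); linarith
  refine ⟨A ^ 2 * E, by positivity, fun N n κ hκ P Q => ?_⟩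
  -- `Mx` will be `κ` plus the larger of the two norms. It differs from `κ + ‖Q‖ + ‖P - Q‖` by a
  -- factor of at most 3.
  have key : ∀ Mx, 0 < Mx → Mx ≤ κ + ‖Q‖ + ‖P - Q‖ → κ + ‖Q‖ + ‖P - Q‖ ≤ 3 * Mx →
      ‖V κ p P - V κ p Q‖ ≤ A * Mx ^ ((p - 2) / 2) * ‖P - Q‖ →
      Mx ^ ((p - 2) / 2) * ‖P - Q‖ ≤ 2 * ‖V κ p P - V κ p Q‖ →
      ‖V κ p P - V κ p Q‖ ^ 2 ≤ A ^ 2 * E * shiftFun p (κ + ‖Q‖) ‖P - Q‖ ∧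
      shiftFun p (κ + ‖Q‖) ‖P - Q‖ ≤ A ^ 2 * E * ‖V κ p P - V κ p Q‖ ^ 2 := by
    intro Mx hM h1 h2 h3 h4
    obtain ⟨h5, h6⟩ := rpow_le_of_le_three_mul (q := p - 2) hM h1 h2
    have hsq : (Mx ^ ((p - 2) / 2)) ^ 2 = Mx ^ (p - 2) := by
      rw [← Real.rpow_natCast, ← Real.rpow_mul hM.le]; norm_num
    have hM0 : 0 ≤ Mx ^ ((p - 2) / 2) := Real.rpow_nonneg hM.le _
    constructor
    · calc ‖V κ p P - V κ p Q‖ ^ 2 ≤ (A * Mx ^ ((p - 2) / 2) * ‖P - Q‖) ^ 2 :=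
            pow_le_pow_left₀ (norm_nonneg _) h3 2
        _ = A ^ 2 * Mx ^ (p - 2) * ‖P - Q‖ ^ 2 := by rw [mul_pow, mul_pow, hsq]
        _ ≤ A ^ 2 * (E * (κ + ‖Q‖ + ‖P - Q‖) ^ (p - 2)) * ‖P - Q‖ ^ 2 := by gcongr
        _ = _ := by rw [shiftFun]; ring
    · calc shiftFun p (κ + ‖Q‖) ‖P - Q‖ ≤ E * Mx ^ (p - 2) * ‖P - Q‖ ^ 2 :=
            mul_le_mul_of_nonneg_right h5 (sq_nonneg _)
        _ = E * (Mx ^ ((p - 2) / 2) * ‖P - Q‖) ^ 2 := by rw [mul_pow, hsq]; ring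
        _ ≤ E * (2 * ‖V κ p P - V κ p Q‖) ^ 2 := mul_le_mul_of_nonneg_left
            (pow_le_pow_left₀ (by positivity) h4 2) (by positivity)
        _ = 2 ^ 2 * E * ‖V κ p P - V κ p Q‖ ^ 2 := by ring
        _ ≤ _ := by gcongr
  have t1 := norm_sub_le P Q
  have t2 := norm_sub_norm_le P Q
  have nP := norm_nonneg P
  have nQ := norm_nonneg Q
  have nPQ := norm_nonneg (P - Q)
  rcases le_total ‖Q‖ ‖P‖ with hle | hle
  · rcases (add_nonneg hκ nP).eq_or_lt with h0 | hM
    · have hP0 : P = 0 := norm_eq_zero.1 (by linarith)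
      have hQ0 : Q = 0 := norm_eq_zero.1 (by linarith)
      rw [hP0, hQ0]; simp [shiftFun]
    · obtain ⟨h1, h2⟩ := norm_V_sub_bounds hκ hp hle
      exact key (κ + ‖P‖) hM (by linarith) (by linarith) h1 h2
  · rcases (add_nonneg hκ nQ).eq_or_lt with h0 | hM
    · have hP0 : P = 0 := norm_eq_zero.1 (by linarith)
      have hQ0 : Q = 0 := norm_eq_zero.1 (by linarith)
      rw [hP0, hQ0]; simp [shiftFun]
    · obtain ⟨h1, h2⟩ := norm_V_sub_bounds hκ hp hle
      rw [norm_sub_rev (V κ p Q), norm_sub_rev Q] at h1 h2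
      exact key (κ + ‖Q‖) hM (by linarith) (by linarith) h1 h2

lemma measurable_V (κ p : ℝ) : Measurable (V κ p : Mat N n → Mat N n) := by
  have h1 : Measurable fun ξ : Mat N n => (κ + ‖ξ‖) ^ ((p - 2) / 2) := by fun_prop
  exact h1.smul measurable_id

end

/-! ### From the pointwise estimate to the Nikolskii seminorm -/

/-- The scaled decay kernel. -/
def scaledKern (n : ℕ) (h : ℝ) (z : Pt n) : ℝ≥0∞ :=
  ENNReal.ofReal ((h ^ n)⁻¹ * ((1 + ‖z‖ / h) ^ (n + 3))⁻¹)

lemma measurable_scaledKern (n : ℕ) (h : ℝ) : Measurable (scaledKern n h) := by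
  unfold scaledKern
  fun_prop

/-- Scaling by `h` produces `h ^ θ`. Since `‖y‖ ^ θ ≤ (1 + ‖y‖) ^ 2`, the decay of order `n + 3`
leaves the integrable order `n + 1`, with a constant independent of `θ`. The case `θ = 0` is the
mass of the kernel, and `θ = 2 α` is the moment paired with the Nikolskii seminorm. -/
lemma exists_scaledKern_moment (n : ℕ) : ∃ K : ℝ, 1 ≤ K ∧ ∀ h θ : ℝ, 0 < h → 0 ≤ θ → θ ≤ 2 →
    ∫⁻ z : Pt n, scaledKern n h z * ENNReal.ofReal (‖z‖ ^ θ) ≤ ENNReal.ofReal (h ^ θ * K) := by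
  set I := ∫⁻ y : Pt n, ENNReal.ofReal ((1 + ‖y‖) ^ (-((n : ℝ) + 1))) with hI
  have hIt : I < ⊤ := finite_integral_one_add_norm (by simp)
  refine ⟨I.toReal + 1, by linarith [ENNReal.toReal_nonneg (a := I)], fun h θ hh h0 h2 => ?_⟩
  have hsub := lintegral_comp_smul_add
    (fun z : Pt n => scaledKern n h z * ENNReal.ofReal (‖z‖ ^ θ)) hh.ne' 0
  simp only [add_zero] at hsub
  have hhn : 0 < h ^ n := by positivity
  have h1 : ∫⁻ z : Pt n, scaledKern n h z * ENNReal.ofReal (‖z‖ ^ θ) =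
      ENNReal.ofReal (h ^ n) *
        ∫⁻ y : Pt n, scaledKern n h (h • y) * ENNReal.ofReal (‖h • y‖ ^ θ) := by
    rw [hsub, ← mul_assoc, abs_of_pos (by positivity), ← ENNReal.ofReal_mul hhn.le,
      mul_inv_cancel₀ hhn.ne', ENNReal.ofReal_one, one_mul]
  have h3 : ∀ y : Pt n, scaledKern n h (h • y) * ENNReal.ofReal (‖h • y‖ ^ θ) ≤
      ENNReal.ofReal ((h ^ n)⁻¹ * h ^ θ) * ENNReal.ofReal ((1 + ‖y‖) ^ (-((n : ℝ) + 1))) := by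
    intro y
    have e1 : ‖h • y‖ = h * ‖y‖ := by rw [norm_smul, Real.norm_of_nonneg hh.le]
    rw [scaledKern, e1, ← ENNReal.ofReal_mul (by positivity), ← ENNReal.ofReal_mul (by positivity)]
    refine ENNReal.ofReal_le_ofReal ?_
    rw [mul_div_cancel_left₀ _ hh.ne', Real.mul_rpow hh.le (norm_nonneg y)]
    have hy : 0 < 1 + ‖y‖ := by positivity
    have e2 : ‖y‖ ^ θ ≤ (1 + ‖y‖) ^ (2 : ℝ) :=
      (Real.rpow_le_rpow (norm_nonneg y) (by linarith) h0).trans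
        (Real.rpow_le_rpow_of_exponent_le (by linarith [norm_nonneg y]) h2)
    have e3 : (1 + ‖y‖) ^ (-((n : ℝ) + 1)) = ((1 + ‖y‖) ^ (n + 3))⁻¹ * (1 + ‖y‖) ^ (2 : ℝ) := by
      rw [← Real.rpow_natCast, ← Real.rpow_neg hy.le, ← Real.rpow_add hy]
      congr 1
      push_cast
      ring
    rw [e3]
    calc (h ^ n)⁻¹ * ((1 + ‖y‖) ^ (n + 3))⁻¹ * (h ^ θ * ‖y‖ ^ θ)
        = (h ^ n)⁻¹ * h ^ θ * (((1 + ‖y‖) ^ (n + 3))⁻¹ * ‖y‖ ^ θ) := by ring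
      _ ≤ _ := by
        have := Real.rpow_nonneg hh.le θ
        gcongr
  rw [h1]
  calc _ ≤ ENNReal.ofReal (h ^ n) * (ENNReal.ofReal ((h ^ n)⁻¹ * h ^ θ) * I) := by
        refine mul_le_mul' le_rfl ?_
        rw [hI, ← lintegral_const_mul' _ _ ENNReal.ofReal_ne_top]
        exact lintegral_mono h3
    _ = ENNReal.ofReal (h ^ θ) * I := by
        rw [← mul_assoc, ← ENNReal.ofReal_mul hhn.le, mul_inv_cancel_left₀ hhn.ne']
    _ ≤ ENNReal.ofReal (h ^ θ) * ENNReal.ofReal (I.toReal + 1) := by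
        refine mul_le_mul' le_rfl ?_
        rw [← ENNReal.ofReal_toReal hIt.ne, ENNReal.toReal_ofReal ENNReal.toReal_nonneg]
        exact ENNReal.ofReal_le_ofReal (by linarith)
    _ = _ := by rw [← ENNReal.ofReal_mul (Real.rpow_nonneg hh.le _)]

lemma sq_eLpNorm_two {X F : Type*} [MeasurableSpace X] [NormedAddCommGroup F] (f : X → F)
    (μ : Measure X) : eLpNorm f 2 μ ^ 2 = ∫⁻ x, ‖f x‖ₑ ^ 2 ∂μ := by
  have h1 := eLpNorm_nnreal_pow_eq_lintegral (f := f) (μ := μ) (p := 2) two_ne_zero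
  simpa using h1

/-- Weighted double integrals of differences are controlled by integrals of shifts. -/
lemma lintegral_lintegral_sub_sq_le {n : ℕ} {F : Type*} [NormedAddCommGroup F] [MeasurableSpace F]
    [BorelSpace F] [SecondCountableTopology F] {Ω : Set (Pt n)} (hΩ : MeasurableSet Ω)
    {U : Pt n → F} (hU : Measurable U) {k : Pt n → ℝ≥0∞} (hk : Measurable k) :
    ∫⁻ x in Ω, ∫⁻ y in Ω, k (y - x) * ‖U y - U x‖ₑ ^ 2 ≤
      ∫⁻ z, k z * ∫⁻ x in Ω ∩ {x | x + z ∈ Ω}, ‖U (x + z) - U x‖ₑ ^ 2 := by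
  have hm : Measurable fun q : Pt n × Pt n => Ω.indicator (1 : Pt n → ℝ≥0∞) (q.1 + q.2) *
      (k q.2 * ‖U (q.1 + q.2) - U q.1‖ₑ ^ 2) := by
    have h1 : Measurable fun q : Pt n × Pt n => q.1 + q.2 := measurable_fst.add measurable_snd
    have h2 : Measurable fun q : Pt n × Pt n => Ω.indicator (1 : Pt n → ℝ≥0∞) (q.1 + q.2) :=
      (measurable_one.indicator hΩ).comp h1
    have h3 : Measurable fun q : Pt n × Pt n => U (q.1 + q.2) - U q.1 :=
      (hU.comp h1).sub (hU.comp measurable_fst)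
    exact h2.mul ((hk.comp measurable_snd).mul (h3.enorm.pow_const 2))
  calc ∫⁻ x in Ω, ∫⁻ y in Ω, k (y - x) * ‖U y - U x‖ₑ ^ 2
      = ∫⁻ x in Ω, ∫⁻ z, Ω.indicator (1 : Pt n → ℝ≥0∞) (x + z) *
          (k z * ‖U (x + z) - U x‖ₑ ^ 2) := by
        refine lintegral_congr fun x => ?_
        rw [← lintegral_indicator hΩ,
          ← lintegral_add_left_eq_self (μ := volume)
            (Ω.indicator fun y => k (y - x) * ‖U y - U x‖ₑ ^ 2) x]
        refine lintegral_congr fun z => ?_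
        by_cases hz : x + z ∈ Ω <;> simp [hz]
    _ = ∫⁻ z, ∫⁻ x in Ω, Ω.indicator (1 : Pt n → ℝ≥0∞) (x + z) *
          (k z * ‖U (x + z) - U x‖ₑ ^ 2) := by
        rw [lintegral_lintegral_swap]
        exact hm.aemeasurable
    _ ≤ _ := by
        refine lintegral_mono fun z => ?_
        have hS : MeasurableSet {x | x + z ∈ Ω} := measurable_add_const z hΩ
        rw [← lintegral_const_mul _ (by
          exact ((hU.comp (measurable_add_const z)).sub hU).enorm.pow_const 2),
          Set.inter_comm, ← Measure.restrict_restrict hS, ← lintegral_indicator hS]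
        refine lintegral_mono fun x => ?_
        by_cases hx : x + z ∈ Ω <;> simp [hx]

/-- If `B` is close to `A` in the sense of a weighted pointwise estimate then `V(B)` is close to
`V(A)` in terms of the Nikolskii seminorm of `V(A)`. -/
lemma exists_eLpNorm_V_sub_le (n N : ℕ) {p : ℝ} (hp : 1 < p) (C₀ : ℝ≥0) :
    ∃ C : ℝ, 0 < C ∧ ∀ (h κ α : ℝ), 0 < h → 0 ≤ κ → 0 < α → α ≤ 1 →
      ∀ Ω : Set (Pt n), MeasurableSet Ω → ∀ A B : Pt n → Mat N n,
      AEStronglyMeasurable A (volume.restrict Ω) →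
      (∀ᵐ x ∂volume.restrict Ω, ENNReal.ofReal (h ^ n) * ‖B x - A x‖ₑ ≤
        C₀ * ∫⁻ y in Ω, kern (n + 3) h x y * ‖A y - A x‖ₑ) →
      eLpNorm (fun x => V κ p (A x) - V κ p (B x)) 2 (volume.restrict Ω) ≤
        ENNReal.ofReal (C * h ^ α) * nikolskii α 2 Ω (fun x => V κ p (A x)) := by
  obtain ⟨K, hK1, hK⟩ := exists_scaledKern_moment n
  obtain ⟨E, hE, hVE⟩ := exists_V_bounds hp
  have hK0 : 0 < K := by linarith
  -- The `+ 1` ensures `1 ≤ 2 * C₁ * K`, as the Jensen inequality requires.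
  set C₁ : ℝ := C₀ + 1 with hC₁
  have hC₁0 : 0 < C₁ := by positivity
  set D : ℝ := (2 * C₁ * K) ^ (p + 2) / K with hD
  have hD0 : 0 < D := by positivity
  refine ⟨√(E * D * E * K), by positivity,
    fun h κ α hh hκ hα hα1 Ω hΩ A B hA hAB => ?_⟩
  have hhn : 0 < h ^ n := by positivity
  have hker : ∀ x y : Pt n, scaledKern n h (y - x) =
      ENNReal.ofReal (h ^ n)⁻¹ * kern (n + 3) h x y := fun x y => by
    rw [scaledKern, kern, ← ENNReal.ofReal_mul (by positivity), dist_comm, dist_eq_norm]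
  set U : Pt n → Mat N n := fun x => V κ p (A x) with hU
  set S := nikolskii α 2 Ω U with hS
  have hpt : ∀ᵐ x ∂volume.restrict Ω, ‖U x - V κ p (B x)‖ₑ ^ 2 ≤
      ENNReal.ofReal (E * D * E) *
        ∫⁻ y in Ω, scaledKern n h (y - x) * ‖U y - U x‖ₑ ^ 2 := by
    filter_upwards [hAB] with x hx
    have hmeas : Measurable fun y : Pt n => scaledKern n h (y - x) :=
      (measurable_scaledKern n h).comp (measurable_id.sub_const x)
    have hmass : ∫⁻ y in Ω, scaledKern n h (y - x) ≤ ENNReal.ofReal K := by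
      refine (setLIntegral_le_lintegral _ _).trans ?_
      rw [lintegral_sub_right_eq_self (fun z => scaledKern n h z) x]
      simpa using hK h 0 hh le_rfl zero_le_two
    have hs : ENNReal.ofReal ‖B x - A x‖ ≤ ENNReal.ofReal C₁ *
        ∫⁻ y in Ω, scaledKern n h (y - x) * ENNReal.ofReal ‖A y - A x‖ := by
      have h1 : ENNReal.ofReal (h ^ n)⁻¹ * ENNReal.ofReal (h ^ n) = 1 := by
        rw [← ENNReal.ofReal_mul (by positivity), inv_mul_cancel₀ hhn.ne', ENNReal.ofReal_one]
      calc ENNReal.ofReal ‖B x - A x‖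
          = ENNReal.ofReal (h ^ n)⁻¹ * (ENNReal.ofReal (h ^ n) * ‖B x - A x‖ₑ) := by
            rw [← mul_assoc, h1, one_mul, ofReal_norm]
        _ ≤ ENNReal.ofReal (h ^ n)⁻¹ * (C₀ * ∫⁻ y in Ω, kern (n + 3) h x y * ‖A y - A x‖ₑ) :=
            mul_le_mul' le_rfl hx
        _ = C₀ * ∫⁻ y in Ω, scaledKern n h (y - x) * ENNReal.ofReal ‖A y - A x‖ := by
            rw [mul_left_comm, ← lintegral_const_mul' _ _ ENNReal.ofReal_ne_top]
            simp only [hker, ofReal_norm, mul_assoc]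
        _ ≤ _ := by
            refine mul_le_mul' ?_ le_rfl
            rw [← ENNReal.ofReal_coe_nnreal]
            exact ENNReal.ofReal_le_ofReal (by rw [hC₁]; linarith)
    -- The shift `κ + ‖A x‖` is the same for `B x - A x` and for every `A y - A x`, so both can be
    -- translated into differences of `V` at the fixed point `x`.
    have hJ := shiftFun_le_lintegral (μ := volume.restrict Ω) (a := κ + ‖A x‖) hp (by positivity)
      (norm_nonneg _) hC₁0 hK0 (by nlinarith [C₀.coe_nonneg]) hmeas hmass
      (fun y => norm_nonneg (A y - A x)) hs
    have e1 : ∀ a : Mat N n, ‖a‖ₑ ^ 2 = ENNReal.ofReal (‖a‖ ^ 2) := fun a => by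
      rw [← ofReal_norm, ENNReal.ofReal_pow (norm_nonneg _)]
    calc ‖U x - V κ p (B x)‖ₑ ^ 2 ≤ ENNReal.ofReal (E * shiftFun p (κ + ‖A x‖) ‖B x - A x‖) := by
          rw [e1, norm_sub_rev]
          exact ENNReal.ofReal_le_ofReal (hVE N n κ hκ (B x) (A x)).1
      _ = ENNReal.ofReal E * ENNReal.ofReal (shiftFun p (κ + ‖A x‖) ‖B x - A x‖) :=
          ENNReal.ofReal_mul hE.le
      _ ≤ ENNReal.ofReal E * (ENNReal.ofReal D * ∫⁻ y in Ω, scaledKern n h (y - x) *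
            ENNReal.ofReal (shiftFun p (κ + ‖A x‖) ‖A y - A x‖)) := mul_le_mul' le_rfl hJ
      _ ≤ ENNReal.ofReal E * (ENNReal.ofReal D * ∫⁻ y in Ω, ENNReal.ofReal E *
            (scaledKern n h (y - x) * ‖U y - U x‖ₑ ^ 2)) := by
          refine mul_le_mul' le_rfl (mul_le_mul' le_rfl (lintegral_mono fun y => ?_))
          rw [mul_left_comm]
          refine mul_le_mul' le_rfl ?_
          rw [e1, ← ENNReal.ofReal_mul hE.le]
          exact ENNReal.ofReal_le_ofReal (hVE N n κ hκ (A y) (A x)).2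
      _ = _ := by
          rw [lintegral_const_mul' _ _ ENNReal.ofReal_ne_top, ENNReal.ofReal_mul (by positivity),
            ENNReal.ofReal_mul hE.le]
          ring
  have hUm : AEMeasurable U (volume.restrict Ω) := (measurable_V κ p).comp_aemeasurable hA.aemeasurable
  -- A measurable representative permits the exchange of integrals; the seminorm of `U` is
  -- unaffected by null sets.
  set U' := hUm.mk U with hU'
  have hU'm : Measurable U' := hUm.measurable_mk
  have hUU' : U =ᵐ[volume.restrict Ω] U' := hUm.ae_eq_mk
  have hUU'v : ∀ᵐ x, x ∈ Ω → U x = U' x := (ae_restrict_iff' hΩ).1 hUU'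
  have hshift : ∀ z : Pt n, ∫⁻ x in Ω ∩ {x | x + z ∈ Ω}, ‖U' (x + z) - U' x‖ₑ ^ 2 ≤
      ENNReal.ofReal (‖z‖ ^ (2 * α)) * S ^ 2 := by
    intro z
    rcases eq_or_ne z 0 with rfl | hz
    · simp
    have hzn : 0 < ‖z‖ := norm_pos_iff.2 hz
    have hSm : MeasurableSet (Ω ∩ {x | x + z ∈ Ω}) := hΩ.inter (measurable_add_const z hΩ)
    have e1 : ∫⁻ x in Ω ∩ {x | x + z ∈ Ω}, ‖U' (x + z) - U' x‖ₑ ^ 2 =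
        eLpNorm (fun x => U (x + z) - U x) 2 (volume.restrict (Ω ∩ {x | x + z ∈ Ω})) ^ 2 := by
      rw [sq_eLpNorm_two]
      refine setLIntegral_congr_fun_ae hSm ?_
      have h2 : ∀ᵐ x, x + z ∈ Ω → U (x + z) = U' (x + z) :=
        (measurePreserving_add_right volume z).quasiMeasurePreserving.ae hUU'v
      filter_upwards [hUU'v, h2] with x hx1 hx2 hx
      rw [hx1 hx.1, hx2 hx.2]
    have e2 : ENNReal.ofReal (‖z‖ ^ (-α)) *
        eLpNorm (fun x => U (x + z) - U x) 2 (volume.restrict (Ω ∩ {x | x + z ∈ Ω})) ≤ S :=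
      le_iSup₂ (f := fun (z : Pt n) (_ : z ≠ 0) => ENNReal.ofReal (‖z‖ ^ (-α)) *
        eLpNorm (fun x => U (x + z) - U x) 2 (volume.restrict (Ω ∩ {x | x + z ∈ Ω}))) z hz
    have e3 : eLpNorm (fun x => U (x + z) - U x) 2 (volume.restrict (Ω ∩ {x | x + z ∈ Ω})) ≤
        ENNReal.ofReal (‖z‖ ^ α) * S := by
      refine le_trans (le_of_eq ?_) (mul_le_mul' le_rfl e2)
      rw [← mul_assoc, ← ENNReal.ofReal_mul (Real.rpow_nonneg hzn.le _), ← Real.rpow_add hzn,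
        add_neg_cancel, Real.rpow_zero, ENNReal.ofReal_one, one_mul]
    rw [e1]
    refine (pow_le_pow_left' e3 2).trans (le_of_eq ?_)
    rw [mul_pow, ← ENNReal.ofReal_pow (Real.rpow_nonneg hzn.le _), ← Real.rpow_natCast,
      ← Real.rpow_mul hzn.le]
    congr 3
    push_cast
    ring
  have hsq : eLpNorm (fun x => U x - V κ p (B x)) 2 (volume.restrict Ω) ^ 2 ≤
      (ENNReal.ofReal (√(E * D * E * K) * h ^ α) * S) ^ 2 := by
    rw [sq_eLpNorm_two]
    calc ∫⁻ x in Ω, ‖U x - V κ p (B x)‖ₑ ^ 2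
        ≤ ∫⁻ x in Ω, ENNReal.ofReal (E * D * E) *
            ∫⁻ y in Ω, scaledKern n h (y - x) * ‖U y - U x‖ₑ ^ 2 := lintegral_mono_ae hpt
      _ = ENNReal.ofReal (E * D * E) *
            ∫⁻ x in Ω, ∫⁻ y in Ω, scaledKern n h (y - x) * ‖U' y - U' x‖ₑ ^ 2 := by
          rw [lintegral_const_mul' _ _ ENNReal.ofReal_ne_top]
          congr 1
          refine lintegral_congr_ae ?_
          filter_upwards [hUU'] with x hx
          refine lintegral_congr_ae ?_
          filter_upwards [hUU'] with y hy
          rw [hx, hy]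
      _ ≤ ENNReal.ofReal (E * D * E) *
            ∫⁻ z, scaledKern n h z * (ENNReal.ofReal (‖z‖ ^ (2 * α)) * S ^ 2) := by
          refine mul_le_mul' le_rfl ((lintegral_lintegral_sub_sq_le hΩ hU'm
            (measurable_scaledKern n h)).trans (lintegral_mono fun z => ?_))
          exact mul_le_mul' le_rfl (hshift z)
      _ = ENNReal.ofReal (E * D * E) *
            ((∫⁻ z, scaledKern n h z * ENNReal.ofReal (‖z‖ ^ (2 * α))) * S ^ 2) := by
          rw [← lintegral_mul_const]
          · simp only [mul_assoc]
          · exact (measurable_scaledKern n h).mul (by fun_prop)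
      _ ≤ ENNReal.ofReal (E * D * E) * (ENNReal.ofReal (h ^ (2 * α) * K) * S ^ 2) :=
          mul_le_mul' le_rfl (mul_le_mul' (hK h (2 * α) hh (by linarith) (by linarith)) le_rfl)
      _ = _ := by
          have hha := Real.rpow_nonneg hh.le α
          rw [mul_pow, ← ENNReal.ofReal_pow (by positivity), mul_pow, Real.sq_sqrt (by positivity),
            ← mul_assoc, ← ENNReal.ofReal_mul (by positivity), ← Real.rpow_natCast (h ^ α),
            ← Real.rpow_mul hh.le]
          congr 2
          rw [mul_comm 2 α]
          push_cast
          ring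
  exact (ENNReal.pow_le_pow_left_iff two_ne_zero).1 hsq

/-! ### The main estimate -/

lemma hT_pos {n : ℕ} {T : Finset (Pt n)} (hn : 1 ≤ n) (h : IsSimplex T) : 0 < hT T := by
  obtain ⟨a, ha, b, hb, hab⟩ := Finset.one_lt_card.1 (show 1 < T.card by rw [h.1]; omega)
  have hbd : Bornology.IsBounded (elem T) :=
    (isCompact_elem T).isBounded
  exact (dist_pos.2 hab).trans_le (Metric.dist_le_diam_of_mem hbd
    (subset_convexHull ℝ _ ha) (subset_convexHull ℝ _ hb))

/-- An element contains balls of diameter greater than half of `rhoT`, and `meshSize ≤ σ * γ *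
rhoT`, so a ball of radius `s` with `meshSize ≤ 4 * γ * σ * s` fits. The form `|γ * σ| + 1` makes
`c` positive and at most 1 for all real `γ` and `σ`. -/
lemma IsPolyhedralDomain.isMesh {n : ℕ} {γ σ : ℝ} {Ω : Set (Pt n)} {𝒯 : Finset (Finset (Pt n))}
    (hn : 1 ≤ n) (hΩ : IsPolyhedralDomain Ω) (h𝒯 : IsTriangulation Ω 𝒯) (hγ : ShapeRegular γ 𝒯)
    (hσ : QuasiUniform σ 𝒯) (hc : PatchesConnected 𝒯) :
    IsMesh (1 / (4 * (|γ * σ| + 1))) (meshSize 𝒯) Ω 𝒯 := by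
  have hle : ∀ T ∈ 𝒯, hT T ≤ meshSize 𝒯 := fun T hT' =>
    le_ciSup (f := fun T : 𝒯 => hT (T : Finset (Pt n))) (Set.finite_range _).bddAbove ⟨T, hT'⟩
  have hpos : 0 < meshSize 𝒯 := by
    obtain ⟨x, hx⟩ := hΩ.isConnected.nonempty
    obtain ⟨T, hT', -⟩ := h𝒯.exists_mem (subset_closure hx)
    exact (hT_pos hn (h𝒯.simplex T hT')).trans_le (hle T hT')
  have habs := abs_nonneg (γ * σ)
  refine ⟨h𝒯, hΩ.isOpen, hΩ.interior_closure, hpos, by positivity, ?_, fun T hT' x hx y hy => ?_,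
    fun T hT' => ?_, hc⟩
  · rw [div_le_one (by positivity)]
    linarith
  · exact (Metric.dist_le_diam_of_mem
      (isCompact_elem T).isBounded hx hy).trans (hle T hT')
  · have hh := hT_pos hn (h𝒯.simplex T hT')
    have hρ0 : 0 ≤ rhoT T := by
      refine Real.sSup_nonneg ?_
      rintro d ⟨x, s, hs, -, rfl⟩
      positivity
    have hTγ := hγ T hT'
    have hρ : 0 < rhoT T := by
      rcases hρ0.lt_or_eq with h | h
      · exact h
      · rw [← h, mul_zero] at hTγ
        linarith
    have hγ0 : 0 < γ := pos_of_mul_pos_left (hh.trans_le hTγ) hρ0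
    have hσT := hσ T hT'
    have hσ0 : 0 < σ := pos_of_mul_pos_left (hpos.trans_le hσT) hh.le
    have hne : {d : ℝ | ∃ (x : Pt n) (s : ℝ), 0 ≤ s ∧ Metric.closedBall x s ⊆ elem T ∧
        d = 2 * s}.Nonempty := by
      by_contra hemp
      rw [Set.not_nonempty_iff_eq_empty] at hemp
      rw [rhoT, hemp, Real.sSup_empty] at hρ
      exact hρ.false
    obtain ⟨d, ⟨x, s, hs, hsub, rfl⟩, hd⟩ := exists_lt_of_lt_csSup hne (half_lt_self hρ)
    change rhoT T / 2 < 2 * s at hd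
    refine ⟨x, (Metric.closedBall_subset_closedBall ?_).trans hsub⟩
    rw [div_mul_eq_mul_div, one_mul, div_le_iff₀ (by positivity)]
    have h1 : meshSize 𝒯 ≤ γ * σ * (4 * s) :=
      calc meshSize 𝒯 ≤ σ * (γ * rhoT T) :=
            hσT.trans (mul_le_mul_of_nonneg_left hTγ hσ0.le)
        _ = γ * σ * rhoT T := by ring
        _ ≤ γ * σ * (4 * s) := mul_le_mul_of_nonneg_left (by linarith) (by positivity)
    have h2 : γ * σ * (4 * s) ≤ |γ * σ| * (4 * s) :=
      mul_le_mul_of_nonneg_right (le_abs_self _) (by positivity)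
    nlinarith

/-- The pointwise estimate for the gradient of the `L²`-projection of a vector-valued function. -/
lemma exists_gradient_estimate_l2Proj (n N r m : ℕ) (hn : 1 ≤ n) (hr : 1 ≤ r) (c : ℝ)
    (hc : 0 < c) :
    ∃ C : ℝ≥0, ∀ {h : ℝ} {Ω : Set (Pt n)} {𝒯 : Finset (Finset (Pt n))}, IsMesh c h Ω 𝒯 →
      ∀ {q : ℝ≥0∞}, 1 ≤ q → ∀ {v w : Pt n → Pt N}, MemW0 Ω q v → IsL2Proj r Ω 𝒯 v w →
      ∀ᵐ x ∂volume.restrict Ω, ENNReal.ofReal (h ^ n) * ‖weakGrad Ω w x - weakGrad Ω v x‖ₑ ≤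
        C * ∫⁻ y in Ω, kern m h x y * ‖weakGrad Ω v y - weakGrad Ω v x‖ₑ := by
  obtain ⟨C, hC⟩ := exists_gradient_estimate n r m hn hr c hc
  refine ⟨n * (N * (C * n)), fun {h Ω 𝒯} M {q} hq {v w} hv hw => ?_⟩
  obtain ⟨-, hv1, -, φ, -, hφ⟩ := hv.exists_isW0Limit hq M.isOpen M.volume_ne_top
  obtain ⟨w', hw', horth, hgrad⟩ := exists_isFE_l2Proj M hn (memLp_one_iff_integrable.1 hv1) hw
  filter_upwards [hgrad, M.ae_restrict_mem_interior] with x hx ⟨T, hT', hxT⟩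
  set A := weakGrad Ω v
  set B := weakGrad Ω w
  set I := ∫⁻ y in Ω, kern m h x y * ‖A y - A x‖ₑ
  have hrow : ∀ i, ENNReal.ofReal (h ^ n) * ‖row i (B x - A x)‖ₑ ≤ C * n * I := by
    intro i
    obtain ⟨p, hp, hwp⟩ := (hw' i).2 T hT'
    -- The scalar estimate holds for every `Q` at every point of the element, so `Q` may be the row
    -- of `A x` at the very point `x`; no exceptional null set depends on it.
    have h1 := hC M _ _ _ _ (hφ i) (hw' i) (horth i) T hT' p hp hwp x (interior_subset hxT)
      (row i (A x))
    rw [← (eventually_eq_of_mem_interior hwp hxT).fderiv_eq, ← hx i, ← map_sub] at h1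
    refine h1.trans ?_
    rw [mul_assoc, ← lintegral_const_mul' _ _ (ENNReal.natCast_ne_top n)]
    refine mul_le_mul' le_rfl (lintegral_mono fun y => ?_)
    have h2 : ‖row i (A y) - row i (A x)‖ₑ ≤ n * ‖A y - A x‖ₑ := by
      rw [← map_sub, ← ofReal_norm, ← ofReal_norm, ← ENNReal.ofReal_natCast,
        ← ENNReal.ofReal_mul (by positivity)]
      exact ENNReal.ofReal_le_ofReal (norm_row_le _ _)
    exact (mul_le_mul' le_rfl h2).trans_eq (mul_left_comm _ _ _)
  have hsum : ‖B x - A x‖ₑ ≤ n * ∑ i, ‖row i (B x - A x)‖ₑ := by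
    simp only [← ofReal_norm]
    rw [← ENNReal.ofReal_sum_of_nonneg fun i _ => norm_nonneg _, ← ENNReal.ofReal_natCast,
      ← ENNReal.ofReal_mul (by positivity)]
    exact ENNReal.ofReal_le_ofReal (norm_le_sum_row _)
  calc ENNReal.ofReal (h ^ n) * ‖B x - A x‖ₑ
      ≤ ENNReal.ofReal (h ^ n) * (n * ∑ i, ‖row i (B x - A x)‖ₑ) := mul_le_mul' le_rfl hsum
    _ = n * ∑ i, ENNReal.ofReal (h ^ n) * ‖row i (B x - A x)‖ₑ := by
        rw [mul_left_comm, Finset.mul_sum]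
    _ ≤ n * ∑ _i : Fin N, C * n * I :=
        mul_le_mul' le_rfl (Finset.sum_le_sum fun i _ => hrow i)
    _ = _ := by
        rw [Finset.sum_const, Finset.card_univ, Fintype.card_fin, nsmul_eq_mul]
        push_cast
        ring

end FEM

end

theorem theorem4p4 (n N r : ℕ) (hn : 2 ≤ n) (hr : 1 ≤ r) (p γ σ : ℝ) (hp : 1 < p) :
    ∃ C : ℝ, 0 < C ∧
      ∀ (κ : ℝ), 0 ≤ κ → ∀ (α : ℝ), 0 < α → α ≤ 1 →
      ∀ (Ω : Set (FEM.Pt n)), FEM.IsPolyhedralDomain Ω →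
      ∀ (𝒯 : Finset (Finset (FEM.Pt n))), FEM.IsTriangulation Ω 𝒯 →
        FEM.ShapeRegular γ 𝒯 → FEM.QuasiUniform σ 𝒯 → FEM.PatchesConnected 𝒯 →
      ∀ (v : FEM.Pt n → FEM.Pt N), FEM.MemW0 Ω (ENNReal.ofReal p) v →
        FEM.IsL2Proj r Ω 𝒯 v (FEM.l2Proj r Ω 𝒯 v) ∧
        eLpNorm (fun x => FEM.V κ p (FEM.weakGrad Ω v x)
            - FEM.V κ p (FEM.weakGrad Ω (FEM.l2Proj r Ω 𝒯 v) x)) 2 (volume.restrict Ω)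
          ≤ ENNReal.ofReal (C * FEM.meshSize 𝒯 ^ α) *
            FEM.nikolskii α 2 Ω (fun x => FEM.V κ p (FEM.weakGrad Ω v x)) := by
  have hn1 : 1 ≤ n := by omega
  have hq : 1 ≤ ENNReal.ofReal p := ENNReal.one_le_ofReal.2 hp.le
  have hc : 0 < 1 / (4 * (|γ * σ| + 1)) := by positivity
  -- Decay of order `n + 3` gives the kernel finite moments up to order 2, which covers `2 * α` for
  -- all `α ≤ 1` with one constant.
  obtain ⟨C₀, hC₀⟩ := FEM.exists_gradient_estimate_l2Proj n N r (n + 3) hn1 hr _ hc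
  obtain ⟨C, hC, hV⟩ := FEM.exists_eLpNorm_V_sub_le n N hp C₀
  refine ⟨C, hC, fun κ hκ α hα hα1 Ω hΩ 𝒯 h𝒯 hγ hσ hpc v hv => ?_⟩
  have M := hΩ.isMesh hn1 h𝒯 hγ hσ hpc
  obtain ⟨hG, hv1, -, -⟩ := hv.exists_isW0Limit hq M.isOpen M.volume_ne_top
  have hproj : FEM.IsL2Proj r Ω 𝒯 v (FEM.l2Proj r Ω 𝒯 v) :=
    FEM.isL2Proj_l2Proj M hn1 (memLp_one_iff_integrable.1 hv1)
  exact ⟨hproj, hV _ κ α M.h_pos hκ hα hα1 Ω M.isOpen.measurableSet _ _ hG.1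
    (hC₀ M hq hv hproj)⟩
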